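/- Fix $0\le\theta_L<\theta_R$. For $\theta\ge 0$ let $\nu_\theta$ be the geometric distribution on $\mathbb N=\{0,1,2,\dots\}$, $\nu_\theta(n)=\frac1{1+\theta}\big(\frac{\theta}{1+\theta}\big)^n$. For $N\in\mathbb N$ let $\Theta_{1,N}\le\dots\le\Theta_{N,N}$ be the order statistics of $N$ independent uniform random variables on $[\theta_L,\theta_R]$, and let $\mu_N$ be the law on $\mathbb N^N$ of $\eta=(\eta_1,\dots,\eta_N)=(\eta_{1,N},\dots,\eta_{N,N})$ which, conditionally on $\Theta=\theta$, has distribution $\otimes_{i=1}^N\nu_{\theta_i}$: $$\mu_N=\mathbb E\big[\otimes_{i=1}^N\nu_{\Theta_{i,N}}\big]$$ (this mixed product state is the form of the non-equilibrium steady state of the boundary driven harmonic model considered here). For every $N$ let $\eta$ have law $\mu_N$; below $\mathbb E[\,\cdot\,|\Theta=\theta]$ denotes expectation under $\otimes_i\nu_{\theta_i}$, for any fixed $\theta\in[0,\infty)^N$. Let $\rho(x)=\theta_L+(\theta_R-\theta_L)x$ for $x\in[0,1]$, and let $\phi:[0,1]\to\mathbb R$ be smooth. **(1) Local functions.** Let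 $g:\mathbb N^k\to\mathbb R$ and write $(\tau_n g)[\eta]=g(\eta_{n+1},\dots,\eta_{n+k})$. Assume that for all $N$, all $n\in\{0,\dots,N-k\}$ and all $\theta\in[\theta_L,\theta_R]^N$, $$\mathbb E\Big[\big((\tau_n g)[\eta]-\mathbb E((\tau_n g)[\eta]\,|\,\Theta=\theta)\big)^4\,\Big|\,\Theta=\theta\Big]<\infty .$$ Put $$h(\theta)=\mathbb E\big[g(\eta_1,\dots,\eta_k)\,\big|\,\Theta\equiv\theta\big],\qquad V(\theta)=\sum_{m=1}^{2k-1}\mathrm{Cov}\big(g(\eta_k,\dots,\eta_{2k-1}),\,g(\eta_m,\dots,\eta_{m+k-1})\,\big|\,\Theta\equiv\theta\big)$$ for $\theta\in[\theta_L,\theta_R]$, where $\Theta\equiv\theta$ means that all the parameters involved are equal to $\theta$. Then $h$ is continuously differentiable and $V$ is continuous on $[\theta_L,\theta_R]$, the quantities $$\sigma_T^2=(\theta_R-\theta_L)^2\int_0^1\!\!\int_0^1 (s\wedge t-st)\,\phi(s)\phi(t)\,h'(\rho(s))\,h'(\rho(t))\,ds\,dt,\qquad \sigma_E^2=\int_0^1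 V(\rho(x))\,\phi(x)^2\,dx$$ are nonnegative, and as $N\to\infty$ $$\frac1{\sqrt N}\sum_{n=0}^{N-k}\big((\tau_n g)[\eta]-\mathbb E((\tau_n g)[\eta])\big)\,\phi\Big(\frac n{N+1}\Big)\ \longrightarrow\ \mathcal N(0,\sigma_T^2+\sigma_E^2)\quad\text{in distribution.}$$ **(2) Density field.** Let $\overline B=\{\overline B(s):0\le s\le1\}$ be a Brownian bridge (centred Gaussian with covariance $s\wedge t-st$ and a.s. continuous paths), and let $\mathcal W$ be an independent white noise with variance density $x\mapsto\mathrm{Var}(\nu_{\rho(x)})$, i.e. a centred Gaussian family indexed by the smooth functions on $[0,1]$ with $\mathrm{Cov}(\mathcal W(\phi),\mathcal W(\psi))=\int_0^1\mathrm{Var}(\nu_{\rho(x)})\,\phi(x)\psi(x)\,dx$. Then, as $N\to\infty$, both $$\frac1{\sqrt N}\sum_{n=0}^{N-1}\big(\eta_{n+1}-\mathbb E(\eta_{n+1})\big)\,\phi\Big(\frac n{N+1}\Big)\qquad\text{and}\qquad \frac1{\sqrt N}\sum_{n=1}^{N}\big(\eta_n-\mathbb E(\eta_n)\big)\,\phi\Big(\frac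 n{N+1}\Big)$$ converge in distribution to $$(\theta_R-\theta_L)\int_0^1\phi(s)\,\overline B(s)\,ds+\mathcal W(\phi).$$ -/

import Mathlib

open MeasureTheory ProbabilityTheory Set Filter
open scoped ENNReal NNReal

namespace HarmonicNESS

/-! ### The mixed product state -/

/-- The geometric distribution `ν_θ` on `ℕ` with mean `θ ≥ 0`, i.e.
`ν_θ(n) = 1/(1+θ) * (θ/(1+θ))^n` (see `geom_singleton`): the geometric law with success probability
`1/(1+θ)`. The projection to `[0,1]` has no effect for `θ ≥ 0`. -/
noncomputable def geom (θ : ℝ) : Measure ℕ :=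
  geometricMeasure (projIcc (0 : ℝ) 1 zero_le_one (1 / (1 + θ)))

instance (θ : ℝ) : IsProbabilityMeasure (geom θ) := by
  unfold geom; infer_instance

/-- The product measure `⊗ ν_{θ i}` on configurations. -/
noncomputable def geomProd {N : ℕ} (θ : Fin N → ℝ) : Measure (Fin N → ℕ) :=
  Measure.pi fun i => geom (θ i)

instance {N : ℕ} (θ : Fin N → ℝ) : IsProbabilityMeasure (geomProd θ) := by
  unfold geomProd; infer_instance

/-- The increasing rearrangement of `u`; entry `i` is the `(i+1)`-st order statistic. -/
noncomputable def orderStatistics {N : ℕ} (u : Fin N → ℝ) : Fin N → ℝ := u ∘ Tuple.sort u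

/-- The mixture measure: the joint law of the order statistics of `N` independent
uniform random variables on `[θL, θR]`. -/
noncomputable def mixtureMeasure (θL θR : ℝ) (N : ℕ) : Measure (Fin N → ℝ) :=
  (Measure.pi fun _ : Fin N => cond (volume : Measure ℝ) (Icc θL θR)).map orderStatistics

/-- The non-equilibrium steady state `μ_N = ∫ ⊗ ν_{θ i} Λ_N(dθ)` on `ℕ^N`, where `Λ_N` is the
mixture measure. -/
noncomputable def ness (θL θR : ℝ) (N : ℕ) : Measure (Fin N → ℕ) :=
  (mixtureMeasure θL θR N).bind geomProd

/-! Sanity facts: `geom` has the stated weights, and `map` / `bind` above are applied to measurable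
maps, so that `ness` is a probability measure. -/

lemma geom_singleton {θ : ℝ} (hθ : 0 ≤ θ) (n : ℕ) :
    geom θ {n} = ENNReal.ofReal (1 / (1 + θ) * (θ / (1 + θ)) ^ n) := by
  have h0 : (0 : ℝ) < 1 / (1 + θ) := by positivity
  have h1 : 1 / (1 + θ) ≤ 1 := by
    rw [div_le_one (by positivity)]; linarith
  have hp : projIcc (0 : ℝ) 1 zero_le_one (1 / (1 + θ)) = ⟨1 / (1 + θ), h0.le, h1⟩ :=
    projIcc_of_mem zero_le_one ⟨h0.le, h1⟩
  have hne : (⟨1 / (1 + θ), h0.le, h1⟩ : unitInterval) ≠ 0 := by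
    intro h
    exact h0.ne' (congrArg Subtype.val h)
  unfold geom
  rw [hp, geometricMeasure_singleton hne]
  have : 1 - 1 / (1 + θ) = θ / (1 + θ) := by field_simp; ring
  simp only [this]
  rw [mul_comm]

lemma measurable_orderStatistics {N : ℕ} : Measurable (orderStatistics (N := N)) := by
  refine measurable_pi_lambda _ fun i s hs => ?_
  have key : (fun u : Fin N → ℝ => orderStatistics u i) ⁻¹' s
      = ⋃ σ : Equiv.Perm (Fin N), {u | σ = Tuple.sort u} ∩ {u | u (σ i) ∈ s} := by
    ext u
    simp [orderStatistics]
  rw [key]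
  refine MeasurableSet.iUnion fun σ => MeasurableSet.inter ?_ (measurable_pi_apply (σ i) hs)
  simp only [Tuple.eq_sort_iff, Monotone, Function.comp_apply]
  simp only [ofPred_and, ofPred_forall]
  refine MeasurableSet.inter ?_ ?_
  · exact MeasurableSet.iInter fun a => MeasurableSet.iInter fun b => MeasurableSet.iInter fun _ =>
      measurableSet_le (measurable_pi_apply _) (measurable_pi_apply _)
  · refine MeasurableSet.iInter fun a => MeasurableSet.iInter fun b => MeasurableSet.iInter fun _ =>
      ?_
    by_cases h : σ a < σ b
    · simp [h]
    · simp only [h, imp_false]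
      exact (measurableSet_eq_fun (measurable_pi_apply (σ a)) (measurable_pi_apply (σ b))).compl

lemma measurable_geom : Measurable geom := by
  have h1 : Measurable geometricMeasure := by
    refine Measurable.ite (measurableSet_singleton (0 : unitInterval)).compl ?_ measurable_const
    refine Measure.measurable_of_measurable_coe _ fun s hs => ?_
    simp only [Measure.sum_apply _ hs, Measure.smul_apply, smul_eq_mul]
    fun_prop
  have h2 : Measurable fun θ : ℝ => projIcc (0 : ℝ) 1 zero_le_one (1 / (1 + θ)) :=
    continuous_projIcc.measurable.comp (by fun_prop)
  exact h1.comp h2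

lemma measurable_geomProd {N : ℕ} : Measurable (geomProd (N := N)) := by
  refine Measure.measurable_of_measurable_coe _ fun s hs => ?_
  simp only [← Measure.tsum_indicator_apply_singleton _ s hs]
  refine Measurable.tsum fun η => ?_
  by_cases h : η ∈ s
  · simp only [indicator_of_mem h, geomProd, Measure.pi_singleton]
    exact Finset.measurable_prod _ fun i _ =>
      (Measure.measurable_coe (measurableSet_singleton _)).comp
        (measurable_geom.comp (measurable_pi_apply i))
  · simp [indicator_of_notMem h]

lemma isProbabilityMeasure_ness {θL θR : ℝ} (h : θL < θR) (N : ℕ) :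
    IsProbabilityMeasure (ness θL θR N) := by
  have : IsProbabilityMeasure (cond (volume : Measure ℝ) (Icc θL θR)) :=
    cond_isProbabilityMeasure_of_finite (by simp [h]) (by simp)
  have : IsProbabilityMeasure (mixtureMeasure θL θR N) :=
    Measure.isProbabilityMeasure_map measurable_orderStatistics.aemeasurable
  refine ⟨?_⟩
  rw [ness, Measure.bind_apply MeasurableSet.univ measurable_geomProd.aemeasurable]
  simp

/-! ### Local functions and fluctuation fields -/

/-- `(τ_n g)(η) = g(η_{n+1}, …, η_{n+k})` (sites are numbered from `0` in `Fin N`) for a local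
function `g` with dependence set `{1, …, k}`. -/
def shift {k N : ℕ} (g : (Fin k → ℕ) → ℝ) (n : ℕ) (h : n + k ≤ N) (η : Fin N → ℕ) : ℝ :=
  g fun j => η ⟨n + j, by omega⟩

/-- All conditional centred fourth moments
`E[(τ_n g(η) - E(τ_n g(η) | Θ = θ))^4 | Θ = θ]`, `θ ∈ [θL, θR]^N`, are finite. -/
def FiniteFourthMoments (θL θR : ℝ) {k : ℕ} (g : (Fin k → ℕ) → ℝ) : Prop :=
  ∀ (N n : ℕ) (h : n + k ≤ N) (θ : Fin N → ℝ), (∀ i, θ i ∈ Icc θL θR) →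
    Integrable (fun η => (shift g n h η - ∫ ξ, shift g n h ξ ∂geomProd θ) ^ 4) (geomProd θ)

/-- `N^{-1/2} ∑_{n=0}^{N-k} (τ_n g(η) - E τ_n g(η)) φ(n/(N+1))`, with `E` the expectation
under `μ`. -/
noncomputable def fluctuationField {k : ℕ} (g : (Fin k → ℕ) → ℝ) (φ : ℝ → ℝ) (N : ℕ)
    (μ : Measure (Fin N → ℕ)) (η : Fin N → ℕ) : ℝ :=
  (√(N : ℝ))⁻¹ * ∑ n : Fin (N + 1 - k),
    (shift g n (by omega) η - ∫ ξ, shift g n (by omega) ξ ∂μ) * φ ((n : ℝ) / (N + 1))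

/-- `N^{-1/2} ∑_{i=1}^{N} (η_i - E η_i) φ(i/(N+1))`, with `E` the expectation under `μ`. -/
noncomputable def densityField (φ : ℝ → ℝ) (N : ℕ)
    (μ : Measure (Fin N → ℕ)) (η : Fin N → ℕ) : ℝ :=
  (√(N : ℝ))⁻¹ * ∑ i : Fin N,
    ((η i : ℝ) - ∫ ξ, (ξ i : ℝ) ∂μ) * φ (((i : ℝ) + 1) / (N + 1))

/-! ### The limiting variances -/

/-- The macroscopic profile `ρ(x) = θL + (θR - θL) x` on `[0,1]`. -/
noncomputable def profile (θL θR : ℝ) : ℝ → ℝ :=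
  (Icc (0 : ℝ) 1).indicator fun x => θL + (θR - θL) * x

/-- `h(θ) = E[g(η_1, …, η_k) | Θ_1 = ⋯ = Θ_k = θ]`. -/
noncomputable def localMean {k : ℕ} (g : (Fin k → ℕ) → ℝ) (θ : ℝ) : ℝ :=
  ∫ η, g η ∂geomProd fun _ : Fin k => θ

/-- `V(θ) = ∑_{m=1}^{2k-1} Cov(g(η_k, …, η_{2k-1}), g(η_m, …, η_{m+k-1}))` for `η` with independent
`ν_θ` coordinates. (Indices are numbered from `0` below; `3k-2` sites are involved.) -/
noncomputable def localVariance {k : ℕ} (g : (Fin k → ℕ) → ℝ) (θ : ℝ) : ℝ :=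
  ∑ m : Fin (2 * k - 1),
    cov[shift g (k - 1) (by omega), shift g m (by omega); geomProd fun _ : Fin (3 * k - 2) => θ]

/-- `σ_T² = (θR-θL)² ∫∫ (s ∧ t - s t) φ(s) φ(t) h'(ρ(s)) h'(ρ(t)) ds dt`. -/
noncomputable def sigmaTSq (θL θR : ℝ) {k : ℕ} (g : (Fin k → ℕ) → ℝ) (φ : ℝ → ℝ) : ℝ :=
  (θR - θL) ^ 2 * ∫ s in (0 : ℝ)..1, ∫ t in (0 : ℝ)..1,
    (min s t - s * t) * φ s * φ t *
      derivWithin (localMean g) (Icc θL θR) (profile θL θR s) *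
      derivWithin (localMean g) (Icc θL θR) (profile θL θR t)

/-- `σ_E² = ∫ V(ρ(x)) φ(x)² dx`. -/
noncomputable def sigmaESq (θL θR : ℝ) {k : ℕ} (g : (Fin k → ℕ) → ℝ) (φ : ℝ → ℝ) : ℝ :=
  ∫ x in (0 : ℝ)..1, localVariance g (profile θL θR x) * φ x ^ 2

/-! ### Brownian bridge and white noise -/

/-- A standard Brownian bridge on `[0,1]`: a centred Gaussian process with covariance
`s ∧ t - s t` and almost surely continuous paths. -/
structure IsBrownianBridge {Ω : Type*} {mΩ : MeasurableSpace Ω}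
    (B : unitInterval → Ω → ℝ) (P : Measure Ω) : Prop where
  gaussian : IsGaussianProcess B P
  mean_zero : ∀ s, ∫ ω, B s ω ∂P = 0
  covariance_eq : ∀ s t : unitInterval, cov[B s, B t; P] = min (s : ℝ) t - s * t
  continuous_paths : ∀ᵐ ω ∂P, Continuous fun s => B s ω

/-- Smooth test functions on `[0,1]`. -/
abbrev TestFunction : Type := {φ : ℝ → ℝ // ContDiffOn ℝ (⊤ : ℕ∞) φ (Icc 0 1)}

/-- A white noise on `[0,1]` with variance density `w`: a centred Gaussian family indexed by test
functions with `Cov(W φ, W ψ) = ∫ w φ ψ`. -/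
structure IsWhiteNoise {Ω : Type*} {mΩ : MeasurableSpace Ω}
    (w : ℝ → ℝ) (W : TestFunction → Ω → ℝ) (P : Measure Ω) : Prop where
  gaussian : IsGaussianProcess W P
  mean_zero : ∀ φ, ∫ ω, W φ ω ∂P = 0
  covariance_eq : ∀ φ ψ : TestFunction,
    cov[W φ, W ψ; P] = ∫ x in (0 : ℝ)..1, w x * φ.1 x * ψ.1 x

end HarmonicNESS

/-!
Conditionally on the parameters `θ` the occupation numbers are independent, so the fluctuation field
splits (`fluctuationField_eq`) into a function of `θ` alone, the centred conditional mean
`meanFluctuation`, and a sum of conditionally centred local functions with finite range dependence.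
The limit is identified by characteristic functions, in
`tendsto_integral_cexp_fluctuationField`.

*The conditionally centred part.* Stein's method in Tikhomirov's form, i.e. an approximate differential
equation for the characteristic function, gives a central limit theorem with error `O(N^{-1/2})`,
uniformly in `θ` (`exists_norm_integral_cexp_centred_le`). It only needs moments that are uniform in
`θ`, and these follow from the density `geomDensity` of `⊗ ν_{θ i}` with respect to the product measure
with the largest parameter `θR`, which is bounded and Lipschitz in `θ`. The same density shows that
conditional expectations are Lipschitz in the parameters (`exists_lipschitz_integral_geomProd`) and
continuously differentiable on the diagonal (`exists_contDiff_localMean`).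

*The part driven by the parameters.* The conditional mean and the conditional variance are both weighted
averages, over windows of consecutive order statistics of a uniform sample, of a Lipschitz function.
For such averages there is a deterministic expansion (`exists_abs_windowAverage_sub_le`). In a monotone
configuration the increments telescope, so the function may be replaced by its values on the diagonal.
What remains is a linear statistic of the order statistics, which is a function of the empirical
distribution function; its linearization is the average of `influence` over the sample, with an error
controlled by the squared distance of the empirical distribution function from the identity, of mean
`O(1/N)`. Hence the conditional variance converges to `sigmaESq` in mean
(`exists_condVariance_bounds`), and the centred conditional mean is, up to `O(N^{-1/2})` in mean, a
normalized sum of independent identically distributed variables with variance `sigmaTSq`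
(`integral_influence_sq_eq_sigmaTSq`), to which the classical central limit theorem applies.

*The density field.* For the local function `η ↦ η_1` the two limiting variances are those of the integral
against the Brownian bridge and of the white noise. The former integral is an almost sure limit of
Gaussian Riemann sums, independent of the white noise, so the proposed limit has the Gaussian
characteristic function found before (`integral_cexp_bridge_add_noise`).
-/

namespace HarmonicNESS
open scoped Topology

/-! ### Functions of class `C¹` on a compact interval -/

lemma contDiff_primitive {G : ℝ → ℝ} (hG : Continuous G) (a c : ℝ) :
    ContDiff ℝ 1 fun x => c + ∫ y in a..x, G y := by
  have hd : ∀ x, HasDerivAt (fun x => c + ∫ y in a..x, G y) (G x) x := fun x =>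
    (intervalIntegral.integral_hasDerivAt_right (hG.intervalIntegrable _ _)
      (hG.stronglyMeasurableAtFilter _ _) hG.continuousAt).const_add c
  rw [contDiff_one_iff_deriv]
  refine ⟨fun x => (hd x).differentiableAt, ?_⟩
  rw [funext fun x => (hd x).deriv]
  exact hG

/-- A function with a derivative in the open interval that extends continuously to the closed one
coincides there with a `C¹` function on the line. -/
lemma exists_contDiff_eqOn_of_hasDerivAt {f G : ℝ → ℝ} {a b : ℝ} (hab : a ≤ b)
    (hf : ContinuousOn f (Icc a b)) (hd : ∀ x ∈ Ioo a b, HasDerivAt f (G x) x)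
    (hG : ContinuousOn G (Icc a b)) :
    ∃ F : ℝ → ℝ, ContDiff ℝ 1 F ∧ EqOn f F (Icc a b) := by
  set G' : ℝ → ℝ := IccExtend hab ((Icc a b).domRestrict G) with hG'
  have hG'c : Continuous G' := (continuousOn_iff_continuous_domRestrict.1 hG).Icc_extend'
  refine ⟨fun x => f a + ∫ y in a..x, G' y, contDiff_primitive hG'c _ _, fun x hx => ?_⟩
  have h : ∫ y in a..x, G' y = f x - f a := by
    refine intervalIntegral.integral_eq_sub_of_hasDerivAt_of_le hx.1
      (hf.mono (Icc_subset_Icc_right hx.2)) (fun y hy => ?_) (hG'c.intervalIntegrable _ _)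
    have hy' : y ∈ Ioo a b := ⟨hy.1, hy.2.trans_le hx.2⟩
    rw [hG', IccExtend_of_mem hab _ (Ioo_subset_Icc_self hy')]
    exact hd y hy'
  simp only [h]; ring

lemma exists_contDiff_eqOn {f : ℝ → ℝ} {a b : ℝ} (hab : a < b)
    (hf : ContDiffOn ℝ 1 f (Icc a b)) :
    ∃ F : ℝ → ℝ, ContDiff ℝ 1 F ∧ EqOn f F (Icc a b) := by
  refine exists_contDiff_eqOn_of_hasDerivAt hab.le hf.continuousOn (G := derivWithin f (Icc a b))
    (fun x hx => ?_) (hf.continuousOn_derivWithin (uniqueDiffOn_Icc hab) le_rfl)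
  have h1 := (hf.differentiableOn one_ne_zero x (Ioo_subset_Icc_self hx)).hasDerivWithinAt
  exact h1.hasDerivAt (Icc_mem_nhds hx.1 hx.2)

/-- A `C¹` function is bounded and Lipschitz on a compact interval. -/
lemma exists_bound_lipschitz {F : ℝ → ℝ} (hF : ContDiff ℝ 1 F) (a b : ℝ) :
    ∃ L : ℝ, 0 ≤ L ∧ (∀ x ∈ Icc a b, |F x| ≤ L) ∧ (∀ x ∈ Icc a b, |deriv F x| ≤ L) ∧
      ∀ x ∈ Icc a b, ∀ y ∈ Icc a b, |F x - F y| ≤ L * |x - y| := by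
  obtain ⟨L₁, h₁⟩ := isCompact_Icc.exists_bound_of_continuousOn (hF.continuous.continuousOn (s := Icc a b))
  obtain ⟨L₂, h₂⟩ := isCompact_Icc.exists_bound_of_continuousOn
    ((hF.continuous_deriv le_rfl).continuousOn (s := Icc a b))
  refine ⟨max (max L₁ L₂) 0, le_max_right _ _, fun x hx => (h₁ x hx).trans (by simp),
    fun x hx => (h₂ x hx).trans (by simp), fun x hx y hy => ?_⟩
  refine (convex_Icc a b).norm_image_sub_le_of_norm_deriv_le (f := F)
    (fun z _ => (hF.differentiable one_ne_zero).differentiableAt)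
    (fun z hz => (h₂ z hz).trans (by simp)) hy hx

/-! ### Densities of product geometric measures -/

/-- The weight `θ^n / (1+θ)^(n+1)` of `n` under the geometric distribution with mean `θ`, divided by
its weight under the geometric distribution with mean `b`. -/
noncomputable def geomRatio (b θ : ℝ) (n : ℕ) : ℝ :=
  (1 + b) * (1 / (1 + θ)) * ((θ / (1 + θ)) * ((1 + b) / b)) ^ n

lemma geomRatio_base_mem {b θ : ℝ} (hb : 0 < b) (hθ : θ ∈ Icc 0 b) :
    (θ / (1 + θ)) * ((1 + b) / b) ∈ Icc (0 : ℝ) 1 := by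
  have h0 := hθ.1
  refine ⟨by positivity, ?_⟩
  rw [div_mul_div_comm, div_le_one (by positivity)]
  nlinarith [hθ.2]

lemma geomRatio_nonneg {b θ : ℝ} (hb : 0 < b) (hθ : θ ∈ Icc 0 b) (n : ℕ) :
    0 ≤ geomRatio b θ n := by
  have h0 := hθ.1
  have := (geomRatio_base_mem hb hθ).1
  unfold geomRatio; positivity

lemma geomRatio_le {b θ : ℝ} (hb : 0 < b) (hθ : θ ∈ Icc 0 b) (n : ℕ) :
    geomRatio b θ n ≤ 1 + b := by
  have h0 := hθ.1
  have h1 : 1 / (1 + θ) ≤ 1 := by rw [div_le_one (by positivity)]; linarith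
  have h2 := pow_le_one₀ (n := n) (geomRatio_base_mem hb hθ).1 (geomRatio_base_mem hb hθ).2
  have h3 := pow_nonneg (geomRatio_base_mem hb hθ).1 n
  unfold geomRatio
  have h4 : 0 ≤ 1 / (1 + θ) := by positivity
  calc _ ≤ (1 + b) * 1 * 1 := by gcongr
    _ = _ := by ring

lemma abs_pow_sub_pow_le {x y : ℝ} (hx : x ∈ Icc (0 : ℝ) 1) (hy : y ∈ Icc (0 : ℝ) 1) (n : ℕ) :
    |x ^ n - y ^ n| ≤ n * |x - y| := by
  induction n with
  | zero => simp
  | succ n ih =>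
    have e : x ^ (n + 1) - y ^ (n + 1) = x * (x ^ n - y ^ n) + (x - y) * y ^ n := by ring
    rw [e]
    have hyn := pow_le_one₀ (n := n) hy.1 hy.2
    have hyn0 := pow_nonneg hy.1 n
    calc _ ≤ |x| * |x ^ n - y ^ n| + |x - y| * |y ^ n| := by
          rw [← abs_mul, ← abs_mul]; exact abs_add_le _ _
      _ ≤ 1 * (n * |x - y|) + |x - y| * 1 := by
          rw [abs_of_nonneg hx.1, abs_of_nonneg hyn0]
          gcongr
          exact hx.2
      _ = _ := by push_cast; ring

lemma abs_geomRatio_sub_le {b θ θ' : ℝ} (hb : 0 < b) (hθ : θ ∈ Icc 0 b) (hθ' : θ' ∈ Icc 0 b)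
    (n : ℕ) :
    |geomRatio b θ n - geomRatio b θ' n| ≤ ((1 + b) ^ 2 / b * (n + 1)) * |θ - θ'| := by
  have h0 := hθ.1
  have h0' := hθ'.1
  have hx := geomRatio_base_mem hb hθ
  have hy := geomRatio_base_mem hb hθ'
  set x := (θ / (1 + θ)) * ((1 + b) / b) with hxd
  set y := (θ' / (1 + θ')) * ((1 + b) / b) with hyd
  have hinv : |1 / (1 + θ) - 1 / (1 + θ')| ≤ |θ - θ'| := by
    have : 1 / (1 + θ) - 1 / (1 + θ') = (θ' - θ) * (1 / ((1 + θ) * (1 + θ'))) := by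
      field_simp; ring
    rw [this, abs_mul, abs_sub_comm θ' θ]
    have : |1 / ((1 + θ) * (1 + θ'))| ≤ 1 := by
      rw [abs_of_nonneg (by positivity), div_le_one (by positivity)]
      nlinarith
    exact mul_le_of_le_one_right (abs_nonneg _) this
  have hxy : |x - y| ≤ |θ - θ'| * ((1 + b) / b) := by
    have e : x - y = (1 / (1 + θ') - 1 / (1 + θ)) * ((1 + b) / b) := by
      rw [hxd, hyd]; field_simp; ring
    rw [e, abs_mul, abs_sub_comm, abs_of_nonneg (by positivity : 0 ≤ (1 + b) / b)]
    gcongr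
  have hpow := abs_pow_sub_pow_le hx hy n
  have hxn := pow_le_one₀ (n := n) hx.1 hx.2
  have hxn0 := pow_nonneg hx.1 n
  have e : geomRatio b θ n - geomRatio b θ' n
      = (1 + b) * ((1 / (1 + θ) - 1 / (1 + θ')) * x ^ n + (1 / (1 + θ')) * (x ^ n - y ^ n)) := by
    simp only [geomRatio, ← hxd, ← hyd]; ring
  have h1 : |1 / (1 + θ')| ≤ 1 := by
    rw [abs_of_nonneg (by positivity), div_le_one (by positivity)]; linarith
  rw [e, abs_mul, abs_of_pos (by positivity : 0 < 1 + b)]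
  calc _ ≤ (1 + b) * (|1 / (1 + θ) - 1 / (1 + θ')| * |x ^ n| + |1 / (1 + θ')| * |x ^ n - y ^ n|) := by
        gcongr
        rw [← abs_mul, ← abs_mul]; exact abs_add_le _ _
    _ ≤ (1 + b) * (|θ - θ'| * 1 + 1 * (n * (|θ - θ'| * ((1 + b) / b)))) := by
        rw [abs_of_nonneg hxn0]
        gcongr
        exact hpow.trans (by gcongr)
    _ ≤ (1 + b) * (|θ - θ'| * ((1 + b) / b) + 1 * (n * (|θ - θ'| * ((1 + b) / b)))) := by
        gcongr
        rw [le_div_iff₀ hb]; linarith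
    _ = _ := by ring

lemma contDiffOn_geomRatio (b : ℝ) (n : ℕ) : ContDiffOn ℝ 1 (fun θ => geomRatio b θ n) (Ioi (-1)) := by
  unfold geomRatio
  have h : ∀ θ ∈ Ioi (-1 : ℝ), 1 + θ ≠ 0 := fun θ hθ => by
    have := mem_Ioi.1 hθ; linarith
  have h1 : ContDiffOn ℝ 1 (fun θ : ℝ => 1 + θ) (Ioi (-1)) := by fun_prop
  exact ((contDiffOn_const.mul (contDiffOn_const.div h1 h))).mul
    (((contDiffOn_id.div h1 h).mul contDiffOn_const).pow n)

lemma geom_singleton_eq_ratio {b θ : ℝ} (hb : 0 < b) (hθ : θ ∈ Icc 0 b) (n : ℕ) :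
    geom θ {n} = ENNReal.ofReal (geomRatio b θ n) * geom b {n} := by
  have h0 := hθ.1
  rw [geom_singleton hθ.1, geom_singleton hb.le, ← ENNReal.ofReal_mul (geomRatio_nonneg hb hθ n)]
  congr 1
  unfold geomRatio
  rw [mul_pow, div_pow (1 + b), div_pow b]
  field_simp

/-- The reference measure: the homogeneous product measure with the largest parameter. -/
noncomputable abbrev geomRef (b : ℝ) (K : ℕ) : Measure (Fin K → ℕ) := geomProd fun _ => b

/-- The density of `geomProd θ` with respect to `geomRef b K`. -/
noncomputable def geomDensity {K : ℕ} (b : ℝ) (θ : Fin K → ℝ) (η : Fin K → ℕ) : ℝ :=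
  ∏ i, geomRatio b (θ i) (η i)

lemma geomDensity_nonneg {K : ℕ} {b : ℝ} (hb : 0 < b) {θ : Fin K → ℝ} (hθ : ∀ i, θ i ∈ Icc 0 b)
    (η : Fin K → ℕ) : 0 ≤ geomDensity b θ η :=
  Finset.prod_nonneg fun i _ => geomRatio_nonneg hb (hθ i) _

lemma geomDensity_le {K : ℕ} {b : ℝ} (hb : 0 < b) {θ : Fin K → ℝ} (hθ : ∀ i, θ i ∈ Icc 0 b)
    (η : Fin K → ℕ) : geomDensity b θ η ≤ (1 + b) ^ K := by
  refine (Finset.prod_le_prod (fun i _ => geomRatio_nonneg hb (hθ i) _)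
    fun i _ => geomRatio_le hb (hθ i) _).trans ?_
  simp

lemma geomProd_eq_withDensity {K : ℕ} {b : ℝ} (hb : 0 < b) {θ : Fin K → ℝ}
    (hθ : ∀ i, θ i ∈ Icc 0 b) :
    geomProd θ = (geomRef b K).withDensity fun η => ENNReal.ofReal (geomDensity b θ η) := by
  refine Measure.ext_of_singleton fun η => ?_
  rw [withDensity_apply _ (measurableSet_singleton _), lintegral_singleton, geomRef, geomProd, geomProd,
    Measure.pi_singleton, Measure.pi_singleton, geomDensity,
    ENNReal.ofReal_prod_of_nonneg fun i _ => geomRatio_nonneg hb (hθ i) _, ← Finset.prod_mul_distrib]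
  exact Finset.prod_congr rfl fun i _ => geom_singleton_eq_ratio hb (hθ i) _

lemma integral_geomProd {K : ℕ} {b : ℝ} (hb : 0 < b) {θ : Fin K → ℝ}
    (hθ : ∀ i, θ i ∈ Icc 0 b) (f : (Fin K → ℕ) → ℝ) :
    ∫ η, f η ∂geomProd θ = ∫ η, geomDensity b θ η * f η ∂geomRef b K := by
  rw [geomProd_eq_withDensity hb hθ, integral_withDensity_eq_integral_toReal_smul
    (measurable_of_countable _) (by simp)]
  simp [ENNReal.toReal_ofReal (geomDensity_nonneg hb hθ _)]

lemma geomProd_le {K : ℕ} {b : ℝ} (hb : 0 < b) {θ : Fin K → ℝ} (hθ : ∀ i, θ i ∈ Icc 0 b) :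
    geomProd θ ≤ ENNReal.ofReal ((1 + b) ^ K) • geomRef b K := by
  rw [geomProd_eq_withDensity hb hθ, ← withDensity_const]
  exact withDensity_mono (ae_of_all _ fun η => ENNReal.ofReal_le_ofReal (geomDensity_le hb hθ η))

lemma memLp_geomProd {K : ℕ} {b : ℝ} (hb : 0 < b) {θ : Fin K → ℝ} (hθ : ∀ i, θ i ∈ Icc 0 b)
    {f : (Fin K → ℕ) → ℝ} {p : ℝ≥0∞} (hf : MemLp f p (geomRef b K)) : MemLp f p (geomProd θ) :=
  (hf.smul_measure ENNReal.ofReal_ne_top).mono_measure (geomProd_le hb hθ)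

/-- Expectations of nonnegative functions are uniformly controlled by those under the reference
measure. -/
lemma integral_geomProd_le {K : ℕ} {b : ℝ} (hb : 0 < b) {θ : Fin K → ℝ} (hθ : ∀ i, θ i ∈ Icc 0 b)
    {f : (Fin K → ℕ) → ℝ} (hf0 : 0 ≤ f) (hf : Integrable f (geomRef b K)) :
    ∫ η, f η ∂geomProd θ ≤ (1 + b) ^ K * ∫ η, f η ∂geomRef b K := by
  have h := integral_mono_measure (geomProd_le hb hθ) (ae_of_all _ hf0)
    (hf.smul_measure ENNReal.ofReal_ne_top)
  rwa [integral_smul_measure, ENNReal.toReal_ofReal (by positivity), smul_eq_mul] at h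

/-! ### Regularity of expectations in the parameters -/

/-- The weight `∏ (η_i + 1)`, which controls the derivatives of `geomDensity`. -/
def siteWeight {K : ℕ} (η : Fin K → ℕ) : ℝ := ∏ i, ((η i : ℝ) + 1)

lemma integrable_geom_sq {b : ℝ} (hb : 0 < b) :
    Integrable (fun n : ℕ => ((n : ℝ) + 1) ^ 2) (geom b) := by
  have h1 : 1 / (1 + b) ≤ 1 := by rw [div_le_one (by positivity)]; linarith
  have h0 : (0 : ℝ) < 1 / (1 + b) := by positivity
  have hp : projIcc (0 : ℝ) 1 zero_le_one (1 / (1 + b)) = ⟨1 / (1 + b), h0.le, h1⟩ :=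
    projIcc_of_mem zero_le_one ⟨h0.le, h1⟩
  have hne : (⟨1 / (1 + b), h0.le, h1⟩ : unitInterval) ≠ 0 := fun h =>
    h0.ne' (congrArg Subtype.val h)
  rw [geom, hp, integrable_geometricMeasure_iff hne]
  have hr : ‖1 - 1 / (1 + b)‖ < 1 := by
    rw [Real.norm_of_nonneg (by linarith)]; linarith
  have s2 := summable_pow_mul_geometric_of_norm_lt_one 2 hr
  have s1 := summable_pow_mul_geometric_of_norm_lt_one 1 hr
  have s0 := summable_pow_mul_geometric_of_norm_lt_one 0 hr
  refine (((s2.add (s1.mul_left 2)).add s0).mul_left (1 / (1 + b))).congr fun n => ?_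
  rw [Real.norm_of_nonneg (by positivity)]
  ring

lemma memLp_siteWeight {b : ℝ} (hb : 0 < b) (K : ℕ) :
    MemLp (siteWeight (K := K)) 2 (geomRef b K) := by
  rw [memLp_two_iff_integrable_sq (measurable_of_countable _).aestronglyMeasurable]
  simp only [siteWeight, ← Finset.prod_pow]
  exact Integrable.fintype_prod (f := fun _ (n : ℕ) => ((n : ℝ) + 1) ^ 2) fun _ => integrable_geom_sq hb

/-- Telescoping over the factors. Since `w i ≥ 1`, the weight of the one factor that changes is bounded by
the product of all weights. -/
lemma abs_prod_sub_prod_le {ι : Type*} {s : Finset ι} {u v w δ : ι → ℝ} {D : ℝ} (hD : 1 ≤ D)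
    (hu : ∀ i, |u i| ≤ D) (hv : ∀ i, |v i| ≤ D) (hw : ∀ i, 1 ≤ w i)
    (h : ∀ i, |u i - v i| ≤ D * w i * δ i) (hδ : ∀ i, 0 ≤ δ i) :
    |∏ i ∈ s, u i - ∏ i ∈ s, v i| ≤ D ^ s.card * (∏ i ∈ s, w i) * ∑ i ∈ s, δ i := by
  classical
  induction s using Finset.induction_on with
  | empty => simp
  | insert j s hj ih =>
    rw [Finset.prod_insert hj, Finset.prod_insert hj, Finset.prod_insert hj, Finset.sum_insert hj,
      Finset.card_insert_of_notMem hj]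
    set A := ∏ i ∈ s, u i
    set B := ∏ i ∈ s, v i with hB
    set W := ∏ i ∈ s, w i
    set Δ := ∑ i ∈ s, δ i with hΔ
    have hW : 1 ≤ W := by
      simpa using Finset.prod_le_prod (s := s) (f := fun _ => (1 : ℝ)) (fun _ _ => zero_le_one)
        fun i _ => hw i
    have hΔ0 : 0 ≤ Δ := Finset.sum_nonneg fun i _ => hδ i
    have hBb : |B| ≤ D ^ s.card := by
      rw [hB, Finset.abs_prod]
      exact (Finset.prod_le_prod (fun i _ => abs_nonneg _) fun i _ => hv i).trans (by simp)
    have hD0 : 0 ≤ D := by linarith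
    have hDs : 0 ≤ D ^ s.card := by positivity
    have e : u j * A - v j * B = u j * (A - B) + (u j - v j) * B := by ring
    rw [e]
    have hwj := hw j
    have hδj := hδ j
    calc _ ≤ |u j| * |A - B| + |u j - v j| * |B| := by
          rw [← abs_mul, ← abs_mul]; exact abs_add_le _ _
      _ ≤ D * (D ^ s.card * W * Δ) + (D * w j * δ j) * D ^ s.card := by
          gcongr
          · exact hu j
          · exact h j
      _ ≤ D * (D ^ s.card * (w j * W) * Δ) + (D * (w j * W) * δ j) * D ^ s.card := by
          gcongr
          · nlinarith
          · nlinarith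
      _ = _ := by ring

/-- The Lipschitz constant of `geomDensity` relative to `siteWeight`. -/
noncomputable def densityLip (b : ℝ) (K : ℕ) : ℝ := ((1 + b) ^ 2 / b) ^ K

lemma densityLip_nonneg {b : ℝ} (hb : 0 < b) (K : ℕ) : 0 ≤ densityLip b K := by
  unfold densityLip; positivity

lemma abs_geomDensity_sub_le {K : ℕ} {b : ℝ} (hb : 0 < b) {θ θ' : Fin K → ℝ}
    (hθ : ∀ i, θ i ∈ Icc 0 b) (hθ' : ∀ i, θ' i ∈ Icc 0 b) (η : Fin K → ℕ) :
    |geomDensity b θ η - geomDensity b θ' η|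
      ≤ densityLip b K * siteWeight η * ∑ i, |θ i - θ' i| := by
  have hD : 1 + b ≤ (1 + b) ^ 2 / b := by
    rw [le_div_iff₀ hb]; nlinarith
  have h := abs_prod_sub_prod_le (s := Finset.univ) (u := fun i => geomRatio b (θ i) (η i))
    (v := fun i => geomRatio b (θ' i) (η i)) (w := fun i => (η i : ℝ) + 1)
    (δ := fun i => |θ i - θ' i|) (D := (1 + b) ^ 2 / b) (by linarith)
    (fun i => by
      rw [abs_of_nonneg (geomRatio_nonneg hb (hθ i) _)]
      exact (geomRatio_le hb (hθ i) _).trans hD)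
    (fun i => by
      rw [abs_of_nonneg (geomRatio_nonneg hb (hθ' i) _)]
      exact (geomRatio_le hb (hθ' i) _).trans hD)
    (fun i => by simp) (fun i => abs_geomRatio_sub_le hb (hθ i) (hθ' i) _) fun i => abs_nonneg _
  simpa [geomDensity, densityLip, siteWeight] using h

lemma integrable_siteWeight_mul {K : ℕ} {b : ℝ} (hb : 0 < b) {f : (Fin K → ℕ) → ℝ}
    (hf : MemLp f 2 (geomRef b K)) : Integrable (fun η => siteWeight η * f η) (geomRef b K) :=
  (memLp_siteWeight hb K).integrable_mul hf

lemma integrable_geomDensity_mul {K : ℕ} {b : ℝ} (hb : 0 < b) {θ : Fin K → ℝ}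
    (hθ : ∀ i, θ i ∈ Icc 0 b) {f : (Fin K → ℕ) → ℝ} (hf : Integrable f (geomRef b K)) :
    Integrable (fun η => geomDensity b θ η * f η) (geomRef b K) := by
  refine hf.bdd_mul (c := (1 + b) ^ K) (measurable_of_countable _).aestronglyMeasurable
    (ae_of_all _ fun η => ?_)
  rw [Real.norm_of_nonneg (geomDensity_nonneg hb hθ η)]
  exact geomDensity_le hb hθ η

/-- Expectations of square integrable local functions are Lipschitz in the parameters. -/
lemma exists_lipschitz_integral_geomProd {K : ℕ} {b : ℝ} (hb : 0 < b) {f : (Fin K → ℕ) → ℝ}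
    (hf : MemLp f 2 (geomRef b K)) :
    ∃ L : ℝ, 0 ≤ L ∧ ∀ θ θ' : Fin K → ℝ, (∀ i, θ i ∈ Icc 0 b) → (∀ i, θ' i ∈ Icc 0 b) →
      |∫ η, f η ∂geomProd θ - ∫ η, f η ∂geomProd θ'| ≤ L * ∑ i, |θ i - θ' i| := by
  refine ⟨densityLip b K * ∫ η, |siteWeight η * f η| ∂geomRef b K,
    mul_nonneg (densityLip_nonneg hb K) (integral_nonneg fun _ => abs_nonneg _),
    fun θ θ' hθ hθ' => ?_⟩
  have hi := hf.integrable one_le_two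
  rw [integral_geomProd hb hθ, integral_geomProd hb hθ',
    ← integral_sub (integrable_geomDensity_mul hb hθ hi) (integrable_geomDensity_mul hb hθ' hi)]
  refine (abs_integral_le_integral_abs).trans ?_
  rw [mul_right_comm, ← integral_const_mul]
  refine integral_mono_of_nonneg (ae_of_all _ fun _ => abs_nonneg _)
    ((integrable_siteWeight_mul hb hf).abs.const_mul _) (ae_of_all _ fun η => ?_)
  have hw : 0 ≤ siteWeight η := Finset.prod_nonneg fun i _ => by positivity
  simp only [← sub_mul]
  rw [abs_mul, abs_mul, abs_of_nonneg hw]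
  calc _ ≤ (densityLip b K * siteWeight η * ∑ i, |θ i - θ' i|) * |f η| := by
        gcongr
        exact abs_geomDensity_sub_le hb hθ hθ' η
    _ = _ := by ring

/-- The homogeneous expectation of a square integrable local function is of class `C¹` up to the
largest parameter: inside the interval one differentiates under the integral, and the derivative
extends continuously because the derivatives of the density are dominated by `siteWeight`. -/
lemma exists_contDiff_localMean {K : ℕ} {a b : ℝ} (ha : 0 ≤ a) (hab : a < b)
    {f : (Fin K → ℕ) → ℝ} (hf : MemLp f 2 (geomRef b K)) :
    ∃ F : ℝ → ℝ, ContDiff ℝ 1 F ∧ EqOn (localMean f) F (Icc a b) := by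
  have hb : 0 < b := ha.trans_lt hab
  have hsub : Icc a b ⊆ Icc 0 b := Icc_subset_Icc_left ha
  set R : ℝ → (Fin K → ℕ) → ℝ := fun θ η => geomDensity b (fun _ => θ) η with hR
  have hRc : ∀ η, ContDiffOn ℝ 1 (fun θ => R θ η) (Ioi (-1)) := fun η => by
    simp only [hR, geomDensity]
    exact contDiffOn_prod fun i _ => contDiffOn_geomRatio b (η i)
  have hnhds : ∀ x ∈ Icc a b, Ioi (-1 : ℝ) ∈ 𝓝 x := fun x hx =>
    Ioi_mem_nhds (by linarith [hx.1])
  have hRd : ∀ η, ∀ x ∈ Icc a b, HasDerivAt (fun θ => R θ η) (deriv (fun θ => R θ η) x) x :=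
    fun η x hx => (((hRc η).contDiffAt (hnhds x hx)).differentiableAt one_ne_zero).hasDerivAt
  set C := densityLip b K * K with hC
  have hC0 : 0 ≤ C := mul_nonneg (densityLip_nonneg hb K) (by positivity)
  have hRlip : ∀ η, ∀ x ∈ Icc a b, ∀ y ∈ Icc a b,
      |R x η - R y η| ≤ (C * siteWeight η) * |x - y| := fun η x hx y hy => by
    have := abs_geomDensity_sub_le hb (θ := fun _ : Fin K => x) (θ' := fun _ => y)
      (fun _ => hsub hx) (fun _ => hsub hy) η
    simp only [Finset.sum_const, Finset.card_univ, Fintype.card_fin, nsmul_eq_mul] at this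
    calc _ ≤ _ := this
      _ = _ := by rw [hC]; ring
  have hw : ∀ η : Fin K → ℕ, 0 ≤ siteWeight η := fun η => Finset.prod_nonneg fun i _ => by positivity
  have hRb : ∀ η, ∀ x ∈ Icc a b, |deriv (fun θ => R θ η) x| ≤ C * siteWeight η := fun η x hx => by
    have hd := (hRd η x hx).hasDerivWithinAt (s := Icc a b)
    have hne : (𝓝[Icc a b \ {x}] x).NeBot :=
      accPt_principal_iff_nhdsWithin.1 (uniqueDiffWithinAt_iff_accPt.1 (uniqueDiffOn_Icc hab x hx))
    refine le_of_tendsto (hasDerivWithinAt_iff_tendsto_slope.1 hd).abs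
      (eventually_mem_nhdsWithin.mono fun y hy => ?_)
    have hyx : 0 < |y - x| := abs_pos.2 (sub_ne_zero.2 hy.2)
    rw [slope_def_field, abs_div, div_le_iff₀ hyx]
    exact hRlip η y hy.1 x hx
  have hmean : ∀ x ∈ Icc a b, localMean f x = ∫ η, R x η * f η ∂geomRef b K := fun x hx =>
    integral_geomProd hb (fun _ => hsub hx) f
  have hi := hf.integrable one_le_two
  have hRi : ∀ x ∈ Icc a b, Integrable (fun η => R x η * f η) (geomRef b K) := fun x hx =>
    integrable_geomDensity_mul hb (fun _ => hsub hx) hi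
  have hdom : Integrable (fun η => C * |siteWeight η * f η|) (geomRef b K) :=
    (integrable_siteWeight_mul hb hf).abs.const_mul _
  have hbound : ∀ x ∈ Icc a b, ∀ η, ‖deriv (fun θ => R θ η) x * f η‖ ≤ C * |siteWeight η * f η| :=
    fun x hx η => by
      rw [Real.norm_eq_abs, abs_mul, abs_mul, abs_of_nonneg (hw η), ← mul_assoc]
      gcongr
      exact hRb η x hx
  refine exists_contDiff_eqOn_of_hasDerivAt hab.le
    (G := fun x => ∫ η, deriv (fun θ => R θ η) x * f η ∂geomRef b K) ?_ ?_ ?_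
  · obtain ⟨L, hL0, hL⟩ := exists_lipschitz_integral_geomProd hb hf
    have : LipschitzOnWith (L * K).toNNReal (localMean f) (Icc a b) := by
      refine LipschitzOnWith.of_dist_le_mul fun x hx y hy => ?_
      rw [Real.coe_toNNReal _ (by positivity)]
      have := hL (fun _ => x) (fun _ => y) (fun _ => hsub hx) (fun _ => hsub hy)
      simp only [Finset.sum_const, Finset.card_univ, Fintype.card_fin, nsmul_eq_mul] at this
      rw [mul_assoc]
      exact this
    exact this.continuousOn
  · intro x hx
    have hxn : Icc a b ∈ 𝓝 x := Icc_mem_nhds hx.1 hx.2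
    have hx' := Ioo_subset_Icc_self hx
    have := (hasDerivAt_integral_of_dominated_loc_of_deriv_le (μ := geomRef b K)
      (F := fun x η => R x η * f η) (F' := fun x η => deriv (fun θ => R θ η) x * f η) (x₀ := x)
      (s := Icc a b) (bound := fun η => C * |siteWeight η * f η|) hxn
      (Eventually.of_forall fun _ => (measurable_of_countable _).aestronglyMeasurable)
      (hRi x hx') (measurable_of_countable _).aestronglyMeasurable
      (ae_of_all _ fun η y hy => hbound y hy η) hdom
      (ae_of_all _ fun η y hy => (hRd η y hy).mul_const _)).2
    exact this.congr_of_eventuallyEq (Filter.mem_of_superset hxn fun y hy => hmean y hy)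
  · refine fun x hx => continuousWithinAt_of_dominated (bound := fun η => C * |siteWeight η * f η|)
      (Eventually.of_forall fun _ => (measurable_of_countable _).aestronglyMeasurable)
      (eventually_mem_nhdsWithin.mono fun y hy => ae_of_all _ fun η => hbound y hy η) hdom
      (ae_of_all _ fun η => ?_)
    have h1 : ContinuousOn (deriv fun θ => R θ η) (Ioi (-1)) :=
      (hRc η).continuousOn_deriv_of_isOpen isOpen_Ioi le_rfl
    exact ((h1.continuousAt (hnhds x hx)).continuousWithinAt).mul_const _

/-! ### Local functions -/

/-- The restriction of a configuration (or of the parameters) to the window `{n, …, n + K - 1}`. -/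
def window {α : Type*} {K N : ℕ} (n : ℕ) (h : n + K ≤ N) (x : Fin N → α) : Fin K → α :=
  fun j => x ⟨n + j, by omega⟩

lemma geomProd_map_window {K N : ℕ} (n : ℕ) (h : n + K ≤ N) (θ : Fin N → ℝ) :
    (geomProd θ).map (window n h) = geomProd (window n h θ) := by
  have hind : iIndepFun (fun (i : Fin N) (η : Fin N → ℕ) => η i) (geomProd θ) :=
    iIndepFun_pi (X := fun _ n => n) fun _ => measurable_id.aemeasurable
  have hinj : Function.Injective fun j : Fin K => (⟨n + j, by omega⟩ : Fin N) := fun i j hij => by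
    simp only [Fin.mk.injEq] at hij; omega
  have := (iIndepFun_iff_map_fun_eq_pi_map
    fun i => (measurable_pi_apply _).aemeasurable).1 (hind.precomp hinj)
  refine this.trans ?_
  rw [geomProd]
  congr 1
  funext j
  exact (measurePreserving_eval (fun i => geom (θ i)) _).map_eq

lemma integral_shift {K N : ℕ} (g : (Fin K → ℕ) → ℝ) (n : ℕ) (h : n + K ≤ N) (θ : Fin N → ℝ) :
    ∫ η, shift g n h η ∂geomProd θ = ∫ η, g η ∂geomProd (window n h θ) := by
  rw [← geomProd_map_window, integral_map (measurable_of_countable _).aemeasurable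
    (measurable_of_countable _).aestronglyMeasurable]
  rfl

lemma memLp_shift {K N : ℕ} {g : (Fin K → ℕ) → ℝ} {n : ℕ} {h : n + K ≤ N} {θ : Fin N → ℝ}
    {p : ℝ≥0∞} (hg : MemLp g p (geomProd (window n h θ))) : MemLp (shift g n h) p (geomProd θ) := by
  rw [← geomProd_map_window] at hg
  exact hg.comp_of_map (measurable_of_countable _).aemeasurable

/-- A function whose centred fourth power is integrable has a fourth moment. If it failed to be
integrable, its integral would be zero by convention and no centring would take place. -/
lemma FiniteFourthMoments.memLp {θL θR : ℝ} (hLR : θL < θR) {k : ℕ}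
    {g : (Fin k → ℕ) → ℝ} (h : FiniteFourthMoments θL θR g) : MemLp g 4 (geomRef θR k) := by
  have h1 := h k 0 (by omega) (fun _ => θR) fun _ => right_mem_Icc.2 hLR.le
  have hs : shift g 0 (by omega) = g := by
    funext η; simp [shift]
  rw [hs] at h1
  have h2 : MemLp (fun η => g η - ∫ ξ, g ξ ∂geomRef θR k) 4 (geomRef θR k) := by
    rw [← integrable_norm_rpow_iff (measurable_of_countable _).aestronglyMeasurable (by simp)
      (by simp)]
    refine h1.congr (ae_of_all _ fun η => ?_)
    simp only [ENNReal.toReal_ofNat, Real.norm_eq_abs]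
    rw [show (4 : ℝ) = ((4 : ℕ) : ℝ) by norm_num, Real.rpow_natCast, Even.pow_abs (by decide)]
  have h3 := h2.add (memLp_const (∫ ξ, g ξ ∂geomRef θR k))
  exact h3.congr_norm (measurable_of_countable _).aestronglyMeasurable (ae_of_all _ fun η => by simp)

/-! ### Characteristic functions of sums with local dependence -/

open Complex in
lemma norm_cexp_sub_one_le (y : ℝ) : ‖cexp (y * I) - 1‖ ≤ |y| := by
  rw [mul_comm]; exact Real.norm_exp_I_mul_ofReal_sub_one_le

open Complex in
lemma norm_cexp_sub_cexp_le (x y : ℝ) : ‖cexp (x * I) - cexp (y * I)‖ ≤ |x - y| := by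
  have : cexp (x * I) - cexp (y * I) = cexp (y * I) * (cexp ((x - y : ℝ) * I) - 1) := by
    rw [mul_sub, ← Complex.exp_add, mul_one]; congr 2; push_cast; ring
  rw [this, norm_mul, norm_exp_ofReal_mul_I, one_mul]
  exact norm_cexp_sub_one_le _

open Complex in
lemma norm_cexp_sub_one_sub_le (y : ℝ) : ‖cexp (y * I) - 1 - y * I‖ ≤ 2 * y ^ 2 := by
  have hn : ‖(y : ℂ) * I‖ = |y| := by simp
  by_cases h : |y| ≤ 1
  · refine (norm_exp_sub_one_sub_id_le (hn ▸ h)).trans ?_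
    rw [hn, sq_abs]; nlinarith [sq_nonneg y]
  · push Not at h
    have h1 := norm_cexp_sub_one_le y
    calc _ ≤ ‖cexp (y * I) - 1‖ + ‖(y : ℂ) * I‖ := norm_sub_le _ _
      _ ≤ |y| + |y| := by rw [hn]; gcongr
      _ ≤ 2 * y ^ 2 := by rw [← sq_abs]; nlinarith

lemma abs_exp_neg_sub_exp_neg_le {x y : ℝ} (hx : 0 ≤ x) (hy : 0 ≤ y) :
    |Real.exp (-x) - Real.exp (-y)| ≤ |x - y| := by
  wlog h : x ≤ y generalizing x y
  · rw [abs_sub_comm, abs_sub_comm x]; exact this hy hx (le_of_not_ge h)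
  rw [abs_of_nonneg (sub_nonneg.2 (Real.exp_le_exp.2 (neg_le_neg h))), abs_sub_comm,
    abs_of_nonneg (sub_nonneg.2 h)]
  have h1 : Real.exp (-x) - Real.exp (-y) = Real.exp (-x) * (1 - Real.exp (-(y - x))) := by
    rw [mul_sub, ← Real.exp_add]; ring_nf
  rw [h1]
  have h2 := Real.add_one_le_exp (-(y - x))
  have h3 : Real.exp (-x) ≤ 1 := Real.exp_le_one_iff.2 (by linarith)
  have h4 : Real.exp (-(y - x)) ≤ 1 := Real.exp_le_one_iff.2 (by linarith)
  nlinarith [Real.exp_pos (-x)]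

/-- A solution of a perturbed equation `f' = - v t f` with `f 0 = 1` is close to `exp (- v t² / 2)`,
by differentiating `f(t) exp (v t² / 2)`. -/
lemma norm_sub_exp_le_of_hasDerivAt {f f' : ℝ → ℂ} {v β γ : ℝ} (hv : 0 ≤ v)
    (hβ : 0 ≤ β) (hγ : 0 ≤ γ) (hf0 : f 0 = 1)
    (hf : ∀ t, HasDerivAt f (f' t) t) (hb : ∀ t, ‖f' t + (t * v : ℝ) * f t‖ ≤ t ^ 2 * β + |t| * γ)
    (t : ℝ) :
    ‖f t - (Real.exp (-(v * t ^ 2 / 2)) : ℂ)‖ ≤ |t| ^ 3 * β + t ^ 2 * γ := by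
  set p : ℝ → ℂ := fun s => f s * (Real.exp (v * s ^ 2 / 2) : ℂ) with hp
  have hd : ∀ s, HasDerivAt p ((f' s + (s * v : ℝ) * f s) * (Real.exp (v * s ^ 2 / 2) : ℂ)) s := by
    intro s
    have h1 : HasDerivAt (fun s : ℝ => Real.exp (v * s ^ 2 / 2))
        (Real.exp (v * s ^ 2 / 2) * (s * v)) s := by
      have h2 : HasDerivAt (fun s : ℝ => v * s ^ 2 / 2) (s * v) s := by
        have := ((hasDerivAt_pow 2 s).const_mul v).div_const 2
        convert! this using 1
        simp; ring
      exact h2.exp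
    have h3 := (hf s).mul h1.ofReal_comp
    convert! h3 using 1
    push_cast; ring
  set E := Real.exp (v * t ^ 2 / 2) with hE
  have hEpos : 0 < E := Real.exp_pos _
  have hbd : ∀ s ∈ Icc (-|t|) |t|,
      ‖(f' s + (s * v : ℝ) * f s) * (Real.exp (v * s ^ 2 / 2) : ℂ)‖ ≤ (t ^ 2 * β + |t| * γ) * E := by
    intro s hs
    have hst : |s| ≤ |t| := abs_le.2 hs
    have hst2 : s ^ 2 ≤ t ^ 2 := sq_le_sq.2 hst
    rw [norm_mul, Complex.norm_real, Real.norm_of_nonneg (Real.exp_pos _).le]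
    have h1 : Real.exp (v * s ^ 2 / 2) ≤ E := Real.exp_le_exp.2 (by gcongr)
    have h2 := hb s
    calc _ ≤ (s ^ 2 * β + |s| * γ) * Real.exp (v * s ^ 2 / 2) := by gcongr
      _ ≤ _ := by gcongr
  have hmv := (convex_Icc (-|t|) |t|).norm_image_sub_le_of_norm_hasDerivWithin_le (f := p)
    (fun s _ => (hd s).hasDerivWithinAt) hbd (x := 0) (y := t) (by simp)
    ⟨neg_abs_le t, le_abs_self t⟩
  have hp0 : p 0 = 1 := by simp [hp, hf0]
  have e : f t - (Real.exp (-(v * t ^ 2 / 2)) : ℂ) = (p t - p 0) * ((E⁻¹ : ℝ) : ℂ) := by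
    have hEne : ((E : ℝ) : ℂ) ≠ 0 := Complex.ofReal_ne_zero.2 hEpos.ne'
    rw [hp0, Real.exp_neg, ← hE]
    simp only [hp, ← hE]
    push_cast
    field_simp
  rw [e, norm_mul, Complex.norm_real, Real.norm_of_nonneg (by positivity)]
  calc _ ≤ ((t ^ 2 * β + |t| * γ) * E * ‖t - 0‖) * E⁻¹ := by gcongr
    _ = _ := by
      rw [sub_zero, Real.norm_eq_abs, ← sq_abs t]; field_simp

lemma integral_abs_sub_integral_le_sqrt_variance {Ω : Type*} {mΩ : MeasurableSpace Ω} {P : Measure Ω}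
    [IsProbabilityMeasure P] {Y : Ω → ℝ} (hY : MemLp Y 2 P) :
    ∫ ω, |Y ω - ∫ ω', Y ω' ∂P| ∂P ≤ √(Var[Y; P]) := by
  refine Real.le_sqrt_of_sq_le ?_
  have hm : MemLp (fun ω => |Y ω - ∫ ω', Y ω' ∂P|) 2 P := (hY.sub (memLp_const _)).abs
  have h := variance_nonneg (fun ω => |Y ω - ∫ ω', Y ω' ∂P|) P
  rw [variance_eq_sub hm] at h
  rw [variance_eq_integral hY.1.aemeasurable]
  simp only [Pi.pow_apply, sq_abs] at h
  linarith

section LocalDependence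

variable {Ω ι : Type*} {mΩ : MeasurableSpace Ω} {P : Measure Ω}

/-- The sum of the variables in the dependence neighbourhood of `i`. -/
def nbSum (X : ι → Ω → ℝ) (nb : ι → Finset ι) (i : ι) (ω : Ω) : ℝ := ∑ j ∈ nb i, X j ω

variable {X : ι → Ω → ℝ} {nb : ι → Finset ι}

lemma memLp_nbSum (hX : ∀ i, MemLp (X i) 4 P) (i : ι) : MemLp (nbSum X nb i) 4 P :=
  memLp_finsetSum _ fun j _ => hX j

lemma memLp_mul_nbSum (hX : ∀ i, MemLp (X i) 4 P) (i : ι) :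
    MemLp (fun ω => X i ω * nbSum X nb i ω) 2 P := by
  have : ENNReal.HolderTriple 4 4 2 := ⟨by
    rw [← two_mul, show (4 : ℝ≥0∞) = 2 * 2 by norm_num,
      ENNReal.mul_inv (by simp) (by simp), ← mul_assoc, ENNReal.mul_inv_cancel (by simp) (by simp),
      one_mul]⟩
  exact (memLp_nbSum hX i).mul (hX i)

/-- The random variable `∑ X_i D_i`, with `D_i` the sum over the dependence neighbourhood of `i`,
whose mean is the variance of `∑ X_i`. -/
def localSquare [Fintype ι] (X : ι → Ω → ℝ) (nb : ι → Finset ι) (ω : Ω) : ℝ := ∑ i, X i ω * nbSum X nb i ω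

lemma memLp_localSquare [Fintype ι] (hX : ∀ i, MemLp (X i) 4 P) : MemLp (localSquare X nb) 2 P :=
  memLp_finsetSum _ fun i _ => memLp_mul_nbSum hX i

variable [IsProbabilityMeasure P] [Fintype ι] [DecidableEq ι]

lemma integral_localSquare_nonneg (hX : ∀ i, MemLp (X i) 4 P) (h0 : ∀ i, ∫ ω, X i ω ∂P = 0)
    (hind : ∀ i, IndepFun (X i) (fun ω => ∑ j ∈ (nb i)ᶜ, X j ω) P) :
    0 ≤ ∫ ω, localSquare X nb ω ∂P := by
  have h42 : (2 : ℝ≥0∞) ≤ 4 := by norm_num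
  have hX2 : ∀ i, MemLp (X i) 2 P := fun i => (hX i).mono_exponent h42
  have hc2 : ∀ i, MemLp (fun ω => ∑ j ∈ (nb i)ᶜ, X j ω) 2 P := fun i =>
    memLp_finsetSum _ fun j _ => hX2 j
  have h : ∫ ω, localSquare X nb ω ∂P = ∫ ω, (∑ i, X i ω) ^ 2 ∂P := by
    have e : ∀ ω, (∑ i, X i ω) ^ 2 =
        localSquare X nb ω + ∑ i, X i ω * ∑ j ∈ (nb i)ᶜ, X j ω := fun ω => by
      rw [localSquare, ← Finset.sum_add_distrib, sq, Finset.sum_mul]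
      refine Finset.sum_congr rfl fun i _ => ?_
      rw [nbSum, ← mul_add, Finset.sum_add_sum_compl]
    simp_rw [e]
    have hi : ∀ i, Integrable (fun ω => X i ω * ∑ j ∈ (nb i)ᶜ, X j ω) P := fun i =>
      (hX2 i).integrable_mul (hc2 i)
    rw [integral_add ((memLp_localSquare hX).integrable one_le_two)
      (integrable_finsetSum _ fun i _ => hi i), integral_finsetSum _ fun i _ => hi i]
    rw [Finset.sum_eq_zero fun i _ => ?_, add_zero]
    have := (hind i).integral_fun_mul_eq_mul_integral (hX2 i).1 (hc2 i).1
    rw [this, h0 i, zero_mul]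
  rw [h]
  exact integral_nonneg fun _ => sq_nonneg _

/-- **Quantitative central limit theorem under local dependence.** If each centred `X i` is
independent of the sum of the `X j` outside its neighbourhood, then the characteristic function of
`S = ∑ X i` nearly solves the differential equation of the Gaussian one: independence allows to
replace `E[X_i exp(itS)]` by `E[X_i (exp(itS) - exp(it(S - D_i)))]`, which is `it E[X_i D_i exp(itS)]`
up to the third order term, and `∑ X_i D_i` is nearly constant. -/
lemma norm_integral_cexp_sum_sub_le (hX : ∀ i, MemLp (X i) 4 P) (h0 : ∀ i, ∫ ω, X i ω ∂P = 0)
    (hind : ∀ i, IndepFun (X i) (fun ω => ∑ j ∈ (nb i)ᶜ, X j ω) P) (t : ℝ) :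
    ‖∫ ω, Complex.exp ((t * ∑ i, X i ω : ℝ) * Complex.I) ∂P -
        (Real.exp (-((∫ ω, localSquare X nb ω ∂P) * t ^ 2 / 2)) : ℂ)‖ ≤
      |t| ^ 3 * (2 * ∑ i, ∫ ω, |X i ω| * nbSum X nb i ω ^ 2 ∂P) +
        t ^ 2 * √(Var[localSquare X nb; P]) := by
  have h42 : (2 : ℝ≥0∞) ≤ 4 := by norm_num
  have hX2 : ∀ i, MemLp (X i) 2 P := fun i => (hX i).mono_exponent h42
  have hXi : ∀ i, Integrable (X i) P := fun i => (hX2 i).integrable one_le_two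
  have hD4 : ∀ i, MemLp (nbSum X nb i) 4 P := memLp_nbSum hX
  have hXDD : ∀ i, Integrable (fun ω => |X i ω| * nbSum X nb i ω ^ 2) P := fun i => by
    have h := (memLp_mul_nbSum (nb := nb) hX i).abs.integrable_mul
      ((hD4 i).abs.mono_exponent h42)
    refine h.congr (ae_of_all _ fun ω => ?_)
    change |X i ω * nbSum X nb i ω| * |nbSum X nb i ω| = |X i ω| * nbSum X nb i ω ^ 2
    rw [abs_mul, ← sq_abs (nbSum X nb i ω)]
    ring
  set S : Ω → ℝ := fun ω => ∑ i, X i ω with hS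
  have hSi : Integrable S P := integrable_finsetSum _ fun i _ => hXi i
  have hQ := memLp_localSquare (nb := nb) hX
  have hQi := hQ.integrable one_le_two
  set v := ∫ ω, localSquare X nb ω ∂P with hv
  set e : ℝ → Ω → ℂ := fun t ω => Complex.exp ((t * S ω : ℝ) * Complex.I) with he
  have hen : ∀ t ω, ‖e t ω‖ = 1 := fun t ω => Complex.norm_exp_ofReal_mul_I _
  have hem : ∀ t, AEStronglyMeasurable (e t) P := fun t =>
    (Complex.continuous_exp.comp (Complex.continuous_ofReal.mul continuous_const)).comp_aestronglyMeasurable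
      (hSi.1.const_mul t)
  have hei : ∀ t, Integrable (e t) P := fun t =>
    (integrable_const (1 : ℝ)).mono (hem t) (ae_of_all _ fun ω => by simp [hen])
  have hmul : ∀ {Y : Ω → ℝ} (t : ℝ), Integrable Y P → Integrable (fun ω => (Y ω : ℂ) * e t ω) P :=
    fun t hY => hY.ofReal.mul_bdd (c := 1) (hem t) (ae_of_all _ fun ω => (hen t ω).le)
  -- the characteristic function may be differentiated under the expectation
  have hderiv : ∀ t, HasDerivAt (fun t => ∫ ω, e t ω ∂P)
      (∫ ω, (S ω : ℂ) * e t ω * Complex.I ∂P) t := fun t => by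
    refine (hasDerivAt_integral_of_dominated_loc_of_deriv_le (F' := fun t ω => (S ω : ℂ) * e t ω * Complex.I)
      (bound := fun ω => |S ω|) univ_mem (Eventually.of_forall hem) (hei t)
      ((hmul t hSi).mul_const _).1 (ae_of_all _ fun ω s _ => ?_) hSi.abs
      (ae_of_all _ fun ω s _ => ?_)).2
    · simp [hen]
    · have h1 : HasDerivAt (fun s : ℝ => ((s * S ω : ℝ) : ℂ) * Complex.I) (S ω * Complex.I) s := by
        have := ((hasDerivAt_id s).mul_const (S ω)).ofReal_comp.mul_const Complex.I
        simpa using this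
      have := h1.cexp
      convert! this using 1
      simp only [he]; ring
  refine norm_sub_exp_le_of_hasDerivAt (integral_localSquare_nonneg hX h0 hind)
    (mul_nonneg zero_le_two (Finset.sum_nonneg fun i _ => integral_nonneg fun _ => by positivity))
    (Real.sqrt_nonneg _) (by simp [he]) hderiv (fun t => ?_) t
  -- independence removes the contribution of the far variables
  have hstep : ∀ i, ∫ ω, (X i ω : ℂ) * Complex.exp ((t * (S ω - nbSum X nb i ω) : ℝ) * Complex.I) ∂P = 0 := by
    intro i
    have hcompl : ∀ ω, S ω - nbSum X nb i ω = ∑ j ∈ (nb i)ᶜ, X j ω := fun ω => by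
      simp only [hS, nbSum]
      rw [← Finset.sum_add_sum_compl (nb i) fun j => X j ω]; ring
    simp_rw [hcompl]
    have := (hind i).integral_fun_comp_mul_comp (f := fun x : ℝ => (x : ℂ))
      (g := fun y : ℝ => Complex.exp ((t * y : ℝ) * Complex.I)) (hXi i).1.aemeasurable
      (integrable_finsetSum _ fun j _ => hXi j).1.aemeasurable
      (by fun_prop) (by fun_prop)
    have h1 : ∫ ω, (X i ω : ℂ) ∂P = 0 := by rw [integral_complex_ofReal, h0 i, Complex.ofReal_zero]
    rw [this, h1, zero_mul]
  have hfar : ∀ i, Integrable (fun ω => (X i ω : ℂ) *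
      Complex.exp ((t * (S ω - nbSum X nb i ω) : ℝ) * Complex.I)) P := fun i =>
    (hXi i).ofReal.mul_bdd (c := 1)
      ((Complex.continuous_exp.comp (Complex.continuous_ofReal.mul continuous_const)).comp_aestronglyMeasurable
        ((hSi.1.sub (hD4 i).1).const_mul t))
      (ae_of_all _ fun ω => (Complex.norm_exp_ofReal_mul_I _).le)
  have hXDi : ∀ i, Integrable (fun ω => X i ω * nbSum X nb i ω) P := fun i =>
    (memLp_mul_nbSum hX i).integrable one_le_two
  have hsum : ∫ ω, (S ω : ℂ) * e t ω * Complex.I ∂P + (t * v : ℝ) * ∫ ω, e t ω ∂P =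
      ∑ i, ∫ ω, ((X i ω : ℂ) * e t ω * Complex.I - (X i ω : ℂ) *
          Complex.exp ((t * (S ω - nbSum X nb i ω) : ℝ) * Complex.I) * Complex.I
          + t * (((X i ω * nbSum X nb i ω : ℝ) : ℂ) * e t ω)) ∂P
        - t * ∫ ω, ((localSquare X nb ω - v : ℝ) : ℂ) * e t ω ∂P := by
    have h1 : ∀ i, ∫ ω, ((X i ω : ℂ) * e t ω * Complex.I - (X i ω : ℂ) *
          Complex.exp ((t * (S ω - nbSum X nb i ω) : ℝ) * Complex.I) * Complex.I
          + t * (((X i ω * nbSum X nb i ω : ℝ) : ℂ) * e t ω)) ∂P =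
        (∫ ω, (X i ω : ℂ) * e t ω ∂P) * Complex.I +
          t * ∫ ω, ((X i ω * nbSum X nb i ω : ℝ) : ℂ) * e t ω ∂P := fun i => by
      have hA : Integrable (fun ω => (X i ω : ℂ) * e t ω * Complex.I - (X i ω : ℂ) *
          Complex.exp ((t * (S ω - nbSum X nb i ω) : ℝ) * Complex.I) * Complex.I) P :=
        ((hmul t (hXi i)).mul_const _).sub ((hfar i).mul_const _)
      rw [integral_add hA
        ((hmul t (hXDi i)).const_mul _), integral_sub ((hmul t (hXi i)).mul_const _)
        ((hfar i).mul_const _), integral_mul_const, integral_mul_const, hstep i, integral_const_mul]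
      ring
    have h2 : ∫ ω, ((localSquare X nb ω - v : ℝ) : ℂ) * e t ω ∂P =
        ∑ i, ∫ ω, ((X i ω * nbSum X nb i ω : ℝ) : ℂ) * e t ω ∂P - v * ∫ ω, e t ω ∂P := by
      rw [← integral_finsetSum _ fun i _ => hmul t (hXDi i), ← integral_const_mul,
        ← integral_sub (integrable_finsetSum _ fun i _ => hmul t (hXDi i)) ((hei t).const_mul _)]
      refine integral_congr_ae (ae_of_all _ fun ω => ?_)
      simp only [localSquare]
      push_cast
      rw [sub_mul, Finset.sum_mul]
    have h3 : ∫ ω, (S ω : ℂ) * e t ω * Complex.I ∂P = (∑ i, ∫ ω, (X i ω : ℂ) * e t ω ∂P) * Complex.I := by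
      rw [← integral_finsetSum _ fun i _ => hmul t (hXi i), integral_mul_const]
      congr 1
      refine integral_congr_ae (ae_of_all _ fun ω => ?_)
      simp only [hS]
      push_cast
      rw [Finset.sum_mul]
    simp_rw [h1]
    rw [h2, h3, Finset.sum_add_distrib, ← Finset.sum_mul, ← Finset.mul_sum]
    push_cast; ring
  rw [hsum]
  refine (norm_sub_le _ _).trans (add_le_add ?_ ?_)
  · rw [mul_left_comm, ← mul_assoc, mul_assoc, Finset.mul_sum]
    rw [Finset.mul_sum]
    refine (norm_sum_le _ _).trans (Finset.sum_le_sum fun i _ => ?_)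
    rw [← integral_const_mul, ← integral_const_mul]
    refine (norm_integral_le_integral_norm _).trans (integral_mono_of_nonneg
      (ae_of_all _ fun _ => norm_nonneg _) (((hXDD i).const_mul _).const_mul _)
      (ae_of_all _ fun ω => ?_))
    have e1 : (X i ω : ℂ) * e t ω * Complex.I - (X i ω : ℂ) *
          Complex.exp ((t * (S ω - nbSum X nb i ω) : ℝ) * Complex.I) * Complex.I
          + t * (((X i ω * nbSum X nb i ω : ℝ) : ℂ) * e t ω) =
        -((X i ω : ℂ) * e t ω * Complex.I) * (Complex.exp ((-(t * nbSum X nb i ω) : ℝ) * Complex.I) - 1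
          - (-(t * nbSum X nb i ω) : ℝ) * Complex.I) := by
      have e2 : Complex.exp ((t * (S ω - nbSum X nb i ω) : ℝ) * Complex.I) =
          e t ω * Complex.exp ((-(t * nbSum X nb i ω) : ℝ) * Complex.I) := by
        rw [he, ← Complex.exp_add]; congr 1; push_cast; ring
      rw [e2]
      push_cast
      linear_combination ((X i ω : ℂ) * e t ω * t * nbSum X nb i ω) * Complex.I_mul_I
    simp only
    rw [e1, norm_mul]
    have h5 := norm_cexp_sub_one_sub_le (-(t * nbSum X nb i ω))
    have h6 : ‖-((X i ω : ℂ) * e t ω * Complex.I)‖ = |X i ω| := by simp [hen]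
    rw [h6]
    calc _ ≤ |X i ω| * (2 * (-(t * nbSum X nb i ω)) ^ 2) := by gcongr
      _ = _ := by ring
  · rw [norm_mul, Complex.norm_real, Real.norm_eq_abs]
    gcongr
    refine (norm_integral_le_integral_norm _).trans ?_
    refine le_trans (le_of_eq ?_) (integral_abs_sub_integral_le_sqrt_variance hQ)
    refine integral_congr_ae (ae_of_all _ fun ω => ?_)
    simp only
    rw [norm_mul, hen, mul_one, Complex.norm_real, Real.norm_eq_abs]

end LocalDependence

/-! ### Fields with finite range dependence -/

/-- The indices at distance less than `k` from `i`. -/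
def rangeNb (M k : ℕ) (i : Fin M) : Finset (Fin M) :=
  Finset.univ.filter fun j => (i : ℕ) < j + k ∧ (j : ℕ) < i + k

lemma card_filter_dist_lt_le (M k : ℕ) (i : Fin M) : (rangeNb M k i).card ≤ 2 * k := by
  have h : (rangeNb M k i).card ≤ (Finset.Ico ((i : ℕ) + 1 - k) (i + k)).card := by
    refine Finset.card_le_card_of_injOn Fin.val (fun j hj => ?_) fun a _ b _ hab => Fin.ext hab
    simp only [rangeNb, Finset.coe_filter, Finset.mem_univ, true_and, mem_ofPred_eq] at hj
    simp only [Finset.coe_Ico, mem_Ico]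
    omega
  rw [Nat.card_Ico] at h
  omega

lemma covariance_le_half_add {Ω : Type*} {mΩ : MeasurableSpace Ω} {P : Measure Ω}
    [IsProbabilityMeasure P] {A B : Ω → ℝ} (hA : MemLp A 2 P) (hB : MemLp B 2 P) :
    cov[A, B; P] ≤ (Var[A; P] + Var[B; P]) / 2 := by
  have h := variance_nonneg (A - B) P
  rw [variance_sub hA hB] at h
  linarith

lemma integrable_pow_four {Ω : Type*} {mΩ : MeasurableSpace Ω} {P : Measure Ω}
    {f : Ω → ℝ} (hf : MemLp f 4 P) : Integrable (fun ω => f ω ^ 4) P := by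
  have := hf.integrable_norm_pow (p := 4) (by norm_num)
  refine this.congr (ae_of_all _ fun ω => ?_)
  simp only [Real.norm_eq_abs]
  exact Even.pow_abs (by decide) _

section FiniteRange

variable {Ω : Type*} {mΩ : MeasurableSpace Ω} {P : Measure Ω} [IsProbabilityMeasure P] {M k : ℕ}
  {Y : Fin M → Ω → ℝ} {κ : ℝ}

lemma integral_abs_mul_nbSum_sq_le (hY : ∀ i, MemLp (Y i) 4 P) (hκ : ∀ i, ∫ ω, Y i ω ^ 4 ∂P ≤ κ)
    (i : Fin M) :
    ∫ ω, |Y i ω| * nbSum Y (rangeNb M k) i ω ^ 2 ∂P ≤ (2 * k) ^ 2 * (1 + 2 * κ) := by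
  have h4 := fun j => integrable_pow_four (hY j)
  have hκ0 : 0 ≤ κ := (integral_nonneg fun ω => by positivity).trans (hκ i)
  set s := rangeNb M k i with hs
  have hcard : (s.card : ℝ) ≤ 2 * k := by exact_mod_cast card_filter_dist_lt_le M k i
  have hpt : ∀ ω, |Y i ω| * nbSum Y (rangeNb M k) i ω ^ 2 ≤
      (2 * k) * ∑ j ∈ s, (1 + Y i ω ^ 4 + Y j ω ^ 4) := fun ω => by
    have h1 : nbSum Y (rangeNb M k) i ω ^ 2 ≤ s.card * ∑ j ∈ s, Y j ω ^ 2 :=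
      sq_sum_le_card_mul_sum_sq
    calc _ ≤ |Y i ω| * (s.card * ∑ j ∈ s, Y j ω ^ 2) := by gcongr
      _ = s.card * ∑ j ∈ s, |Y i ω| * Y j ω ^ 2 := by
        rw [mul_left_comm, Finset.mul_sum]
      _ ≤ (2 * k) * ∑ j ∈ s, (1 + Y i ω ^ 4 + Y j ω ^ 4) := by
        gcongr with j hj
        have h2 : Y i ω ^ 4 = (|Y i ω| ^ 2) ^ 2 := by rw [sq_abs]; ring
        rw [h2]
        nlinarith [sq_nonneg (|Y i ω| - Y j ω ^ 2), sq_nonneg (|Y i ω| ^ 2 - 1), abs_nonneg (Y i ω),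
          sq_nonneg (Y j ω ^ 2)]
  have hint : ∀ j, Integrable (fun ω => 1 + Y i ω ^ 4 + Y j ω ^ 4) P := fun j =>
    ((integrable_const _).add (h4 i)).add (h4 j)
  refine (integral_mono_of_nonneg (ae_of_all _ fun ω => by positivity)
    ((integrable_finsetSum _ fun j _ => hint j).const_mul _) (ae_of_all _ hpt)).trans ?_
  rw [integral_const_mul, integral_finsetSum _ fun j _ => hint j]
  have hj : ∀ j ∈ s, ∫ ω, (1 + Y i ω ^ 4 + Y j ω ^ 4) ∂P ≤ 1 + 2 * κ := fun j _ => by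
    have hA : Integrable (fun ω => 1 + Y i ω ^ 4) P := (integrable_const _).add (h4 i)
    rw [integral_add hA (h4 j), integral_add (integrable_const _) (h4 i)]
    simp
    linarith [hκ i, hκ j]
  calc _ ≤ (2 * k) * ∑ j ∈ s, (1 + 2 * κ) := by
        gcongr with j hj'
        exact hj j hj'
    _ ≤ (2 * k) * ((2 * k) * (1 + 2 * κ)) := by
        rw [Finset.sum_const, nsmul_eq_mul]; gcongr
    _ = _ := by ring

lemma variance_mul_nbSum_le (hY : ∀ i, MemLp (Y i) 4 P) (hκ : ∀ i, ∫ ω, Y i ω ^ 4 ∂P ≤ κ)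
    (i : Fin M) :
    Var[fun ω => Y i ω * nbSum Y (rangeNb M k) i ω; P] ≤ (2 * k) ^ 2 * κ := by
  have h4 := fun j => integrable_pow_four (hY j)
  have hκ0 : 0 ≤ κ := (integral_nonneg fun ω => by positivity).trans (hκ i)
  set s := rangeNb M k i with hs
  have hcard : (s.card : ℝ) ≤ 2 * k := by exact_mod_cast card_filter_dist_lt_le M k i
  refine (variance_le_expectation_sq (memLp_mul_nbSum hY i).1).trans ?_
  have hpt : ∀ ω, (Y i ω * nbSum Y (rangeNb M k) i ω) ^ 2 ≤
      k * ∑ j ∈ s, (Y i ω ^ 4 + Y j ω ^ 4) := fun ω => by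
    have h1 : nbSum Y (rangeNb M k) i ω ^ 2 ≤ s.card * ∑ j ∈ s, Y j ω ^ 2 :=
      sq_sum_le_card_mul_sum_sq
    calc _ = Y i ω ^ 2 * nbSum Y (rangeNb M k) i ω ^ 2 := by ring
      _ ≤ Y i ω ^ 2 * (s.card * ∑ j ∈ s, Y j ω ^ 2) := by gcongr
      _ = s.card * ∑ j ∈ s, Y i ω ^ 2 * Y j ω ^ 2 := by
        rw [mul_left_comm, Finset.mul_sum]
      _ ≤ (2 * k) * ∑ j ∈ s, (Y i ω ^ 4 + Y j ω ^ 4) / 2 := by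
        gcongr with j hj
        nlinarith [sq_nonneg (Y i ω ^ 2 - Y j ω ^ 2)]
      _ = _ := by rw [← Finset.sum_div]; ring
  have hint : ∀ j, Integrable (fun ω => Y i ω ^ 4 + Y j ω ^ 4) P := fun j => (h4 i).add (h4 j)
  refine (integral_mono_of_nonneg (ae_of_all _ fun ω => by simp only [Pi.zero_apply]; positivity)
    ((integrable_finsetSum _ fun j _ => hint j).const_mul _) (ae_of_all _ hpt)).trans ?_
  rw [integral_const_mul, integral_finsetSum _ fun j _ => hint j]
  have hj : ∀ j ∈ s, ∫ ω, (Y i ω ^ 4 + Y j ω ^ 4) ∂P ≤ 2 * κ := fun j _ => by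
    rw [integral_add (h4 i) (h4 j)]
    linarith [hκ i, hκ j]
  calc _ ≤ (k : ℝ) * ∑ j ∈ s, (2 * κ) := by
        gcongr with j hj'
        exact hj j hj'
    _ ≤ k * ((2 * k) * (2 * κ)) := by
        rw [Finset.sum_const, nsmul_eq_mul]; gcongr
    _ = _ := by ring

/-- The summands `Y i * nbSum i` are uncorrelated at distance `3 k` and beyond, so the variance grows only
linearly in the number of terms. -/
lemma variance_localSquare_le (hY : ∀ i, MemLp (Y i) 4 P) (hκ : ∀ i, ∫ ω, Y i ω ^ 4 ∂P ≤ κ)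
    (hκ0 : 0 ≤ κ)
    (hcov : ∀ i j : Fin M, (i : ℕ) + 3 * k ≤ j ∨ (j : ℕ) + 3 * k ≤ i →
      cov[fun ω => Y i ω * nbSum Y (rangeNb M k) i ω,
        fun ω => Y j ω * nbSum Y (rangeNb M k) j ω; P] = 0) :
    Var[localSquare Y (rangeNb M k); P] ≤ M * ((6 * k) * ((2 * k) ^ 2 * κ)) := by
  have hm := fun i => memLp_mul_nbSum (nb := rangeNb M k) hY i
  have h : Var[localSquare Y (rangeNb M k); P] =
      ∑ i, ∑ j, cov[fun ω => Y i ω * nbSum Y (rangeNb M k) i ω,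
        fun ω => Y j ω * nbSum Y (rangeNb M k) j ω; P] := by
    rw [← variance_sum hm]
    congr 1
    funext ω
    simp [localSquare]
  rw [h]
  have hrow : ∀ i, ∑ j, cov[fun ω => Y i ω * nbSum Y (rangeNb M k) i ω,
        fun ω => Y j ω * nbSum Y (rangeNb M k) j ω; P] ≤ (6 * k) * ((2 * k) ^ 2 * κ) := fun i => by
    rw [← Finset.sum_subset (Finset.subset_univ (rangeNb M (3 * k) i)) fun j _ hj => hcov i j (by
      simp only [rangeNb, Finset.mem_filter, Finset.mem_univ, true_and] at hj; omega)]
    have hcard : ((rangeNb M (3 * k) i).card : ℝ) ≤ 6 * k := by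
      have := card_filter_dist_lt_le M (3 * k) i
      have h' : (rangeNb M (3 * k) i).card ≤ 6 * k := by omega
      exact_mod_cast h'
    refine (Finset.sum_le_card_nsmul _ _ ((2 * k) ^ 2 * κ) fun j _ => ?_).trans ?_
    · refine (covariance_le_half_add (hm i) (hm j)).trans ?_
      linarith [variance_mul_nbSum_le (k := k) hY hκ i, variance_mul_nbSum_le (k := k) hY hκ j]
    · rw [nsmul_eq_mul]; gcongr
  refine (Finset.sum_le_card_nsmul _ _ _ fun i _ => hrow i).trans ?_
  simp

/-- The quantitative central limit theorem under finite range dependence: at most `2 N` terms, each with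
bounded fourth moment, dependence of range `k`, normalization `N^{-1/2}`. -/
lemma norm_integral_cexp_sub_le_of_finite_range (hY : ∀ i, MemLp (Y i) 4 P)
    (hκ : ∀ i, ∫ ω, Y i ω ^ 4 ∂P ≤ κ) (hκ0 : 0 ≤ κ) (h0 : ∀ i, ∫ ω, Y i ω ∂P = 0)
    (hind : ∀ i, IndepFun (Y i) (fun ω => ∑ j ∈ (rangeNb M k i)ᶜ, Y j ω) P)
    (hcov : ∀ i j : Fin M, (i : ℕ) + 3 * k ≤ j ∨ (j : ℕ) + 3 * k ≤ i →
      cov[fun ω => Y i ω * nbSum Y (rangeNb M k) i ω,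
        fun ω => Y j ω * nbSum Y (rangeNb M k) j ω; P] = 0)
    {N : ℕ} (hN : 0 < N) (hMN : M ≤ 2 * N) (t : ℝ) :
    ‖∫ ω, Complex.exp ((t * ((√(N : ℝ))⁻¹ * ∑ i, Y i ω) : ℝ) * Complex.I) ∂P -
        (Real.exp (-(((N : ℝ)⁻¹ * ∫ ω, localSquare Y (rangeNb M k) ω ∂P) * t ^ 2 / 2)) : ℂ)‖ ≤
      (|t| ^ 3 * (4 * ((2 * k) ^ 2 * (1 + 2 * κ))) +
        t ^ 2 * √(2 * ((6 * k) * ((2 * k) ^ 2 * κ)))) * (√(N : ℝ))⁻¹ := by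
  set ε := (√(N : ℝ))⁻¹ with hε
  have hNpos : (0 : ℝ) < N := by exact_mod_cast hN
  have hε0 : 0 < ε := by positivity
  have hε2 : ε ^ 2 = (N : ℝ)⁻¹ := by rw [hε, inv_pow, Real.sq_sqrt hNpos.le]
  have hMN' : (M : ℝ) ≤ 2 * N := by exact_mod_cast hMN
  set X : Fin M → Ω → ℝ := fun i ω => ε * Y i ω with hXdef
  have hnb : ∀ i ω, nbSum X (rangeNb M k) i ω = ε * nbSum Y (rangeNb M k) i ω := fun i ω => by
    simp only [nbSum, hXdef, Finset.mul_sum]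
  have hls : localSquare X (rangeNb M k) = fun ω => ε ^ 2 * localSquare Y (rangeNb M k) ω := by
    funext ω
    simp only [localSquare, hnb, Finset.mul_sum]
    exact Finset.sum_congr rfl fun i _ => by simp only [hXdef]; ring
  have hX : ∀ i, MemLp (X i) 4 P := fun i => (hY i).const_mul ε
  have hX0 : ∀ i, ∫ ω, X i ω ∂P = 0 := fun i => by
    simp only [hXdef]; rw [integral_const_mul, h0 i, mul_zero]
  have hXind : ∀ i, IndepFun (X i) (fun ω => ∑ j ∈ (rangeNb M k i)ᶜ, X j ω) P := fun i => by
    have := (hind i).comp (φ := fun x => ε * x) (ψ := fun x => ε * x) (by fun_prop) (by fun_prop)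
    convert! this using 1
    funext ω
    simp [hXdef, Finset.mul_sum]
  have h := norm_integral_cexp_sum_sub_le hX hX0 hXind t
  have hsum : ∀ ω, ∑ i, X i ω = ε * ∑ i, Y i ω := fun ω => by simp [hXdef, Finset.mul_sum]
  simp_rw [hsum] at h
  rw [hls, integral_const_mul, hε2] at h
  have hNε : (N : ℝ) * ε ^ 2 = 1 := by rw [hε2]; exact mul_inv_cancel₀ hNpos.ne'
  have hA : 2 * ∑ i, ∫ ω, |X i ω| * nbSum X (rangeNb M k) i ω ^ 2 ∂P ≤
      4 * ((2 * k) ^ 2 * (1 + 2 * κ)) * ε := by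
    have h1 : ∀ i, ∫ ω, |X i ω| * nbSum X (rangeNb M k) i ω ^ 2 ∂P ≤
        ε ^ 3 * ((2 * k) ^ 2 * (1 + 2 * κ)) := fun i => by
      have e : ∀ ω, |X i ω| * nbSum X (rangeNb M k) i ω ^ 2 =
          ε ^ 3 * (|Y i ω| * nbSum Y (rangeNb M k) i ω ^ 2) := fun ω => by
        rw [hnb]; simp only [hXdef, abs_mul, abs_of_pos hε0]; ring
      simp_rw [e]
      rw [integral_const_mul]
      gcongr
      exact integral_abs_mul_nbSum_sq_le hY hκ i
    calc _ ≤ 2 * ∑ i : Fin M, ε ^ 3 * ((2 * k) ^ 2 * (1 + 2 * κ)) :=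
          mul_le_mul_of_nonneg_left (Finset.sum_le_sum fun i _ => h1 i) zero_le_two
      _ = 2 * (M * (ε ^ 3 * ((2 * k) ^ 2 * (1 + 2 * κ)))) := by
          rw [Finset.sum_const, Finset.card_univ, Fintype.card_fin, nsmul_eq_mul]
      _ ≤ 2 * (2 * N * (ε ^ 3 * ((2 * k) ^ 2 * (1 + 2 * κ)))) := by gcongr
      _ = _ := by linear_combination (4 * ((2 * k) ^ 2 * (1 + 2 * κ)) * ε) * hNε
  have hB : √(Var[fun ω => (N : ℝ)⁻¹ * localSquare Y (rangeNb M k) ω; P]) ≤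
      √(2 * ((6 * k) * ((2 * k) ^ 2 * κ))) * ε := by
    refine Real.sqrt_le_iff.2 ⟨by positivity, ?_⟩
    rw [variance_const_mul, mul_pow, Real.sq_sqrt (by positivity), ← hε2]
    calc _ ≤ (ε ^ 2) ^ 2 * (2 * N * ((6 * k) * ((2 * k) ^ 2 * κ))) := by
          gcongr
          exact (variance_localSquare_le hY hκ hκ0 hcov).trans (by gcongr)
      _ = _ := by linear_combination (2 * ((6 * k) * ((2 * k) ^ 2 * κ)) * ε ^ 2) * hNε
  calc _ ≤ _ := h
    _ ≤ |t| ^ 3 * (4 * ((2 * k) ^ 2 * (1 + 2 * κ)) * ε) +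
        t ^ 2 * (√(2 * ((6 * k) * ((2 * k) ^ 2 * κ))) * ε) := by gcongr
    _ = _ := by ring

end FiniteRange

/-! ### Independence in product measures -/

lemma indepFun_of_dependsOn {N : ℕ} {θ : Fin N → ℝ} {f g : (Fin N → ℕ) → ℝ} {S T : Finset (Fin N)}
    (hST : Disjoint S T) (hf : DependsOn f S) (hg : DependsOn g T) :
    IndepFun f g (geomProd θ) := by
  have hind : iIndepFun (fun (i : Fin N) (η : Fin N → ℕ) => η i) (geomProd θ) :=
    iIndepFun_pi (X := fun _ n => n) fun _ => measurable_id.aemeasurable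
  have h := hind.indepFun_finset S T hST fun i => measurable_pi_apply i
  -- a function depending on the sites in `S` factors through the restriction to `S`
  have key : ∀ {f : (Fin N → ℕ) → ℝ} {S : Finset (Fin N)}, DependsOn f S →
      f = (fun x : S → ℕ => f fun i => if hi : i ∈ S then x ⟨i, hi⟩ else 0) ∘
        fun (η : Fin N → ℕ) (i : S) => η i := fun {f S} hf => by
    funext η
    refine hf fun i hi => ?_
    rw [dif_pos (Finset.mem_coe.1 hi)]
  rw [key hf, key hg]
  exact h.comp (measurable_of_countable _) (measurable_of_countable _)

/-- The sites `i` with `a ≤ i + c` and `i < d`, i.e. `a - c ≤ i < d` without truncated subtraction. -/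
def siteRange (N a c d : ℕ) : Finset (Fin N) :=
  Finset.univ.filter fun i => a ≤ (i : ℕ) + c ∧ (i : ℕ) < d

lemma dependsOn_shift {K N : ℕ} (g : (Fin K → ℕ) → ℝ) (n : ℕ) (h : n + K ≤ N) :
    DependsOn (shift g n h) (siteRange N n 0 (n + K) : Set (Fin N)) := fun x y hxy => by
  unfold shift
  congr 1
  funext j
  refine hxy _ ?_
  simp only [siteRange, Finset.coe_filter, Finset.mem_univ, true_and, mem_ofPred_eq]
  omega

lemma dependsOn_finsetSum {N : ℕ} {ι : Type*} {s : Finset ι} {f : ι → (Fin N → ℕ) → ℝ}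
    {S : Set (Fin N)} (hf : ∀ i ∈ s, DependsOn (f i) S) : DependsOn (fun x => ∑ i ∈ s, f i x) S :=
  fun _ _ hxy => Finset.sum_congr rfl fun i hi => hf i hi hxy

/-- The centred local functions, multiplied by weights, for fixed parameters. -/
noncomputable def centred {k N : ℕ} (g : (Fin k → ℕ) → ℝ) (c : ℕ → ℝ) (θ : Fin N → ℝ)
    (n : Fin (N + 1 - k)) (η : Fin N → ℕ) : ℝ :=
  (shift g n (by omega) η - ∫ ξ, shift g n (by omega) ξ ∂geomProd θ) * c n

section Centred

variable {k N : ℕ} {g : (Fin k → ℕ) → ℝ} {c : ℕ → ℝ} {θ : Fin N → ℝ}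

lemma dependsOn_centred (n : Fin (N + 1 - k)) :
    DependsOn (centred g c θ n) (siteRange N n 0 (n + k) : Set (Fin N)) := fun x y hxy => by
  unfold centred
  rw [dependsOn_shift g n (by omega) hxy]

lemma indepFun_centred (n : Fin (N + 1 - k)) :
    IndepFun (centred g c θ n) (fun η => ∑ j ∈ (rangeNb (N + 1 - k) k n)ᶜ, centred g c θ j η)
      (geomProd θ) := by
  refine indepFun_of_dependsOn (S := siteRange N n 0 (n + k)) (T := (siteRange N n 0 (n + k))ᶜ)
    disjoint_compl_right (dependsOn_centred n) (dependsOn_finsetSum fun j hj => ?_)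
  refine (dependsOn_centred j).mono fun i hi => ?_
  simp only [rangeNb, Finset.mem_compl, Finset.mem_filter, Finset.mem_univ, true_and, siteRange,
    Finset.coe_filter, mem_ofPred_eq, Finset.coe_compl, mem_compl_iff] at hj hi ⊢
  omega

lemma dependsOn_centred_mul_nbSum (n : Fin (N + 1 - k)) :
    DependsOn (fun η => centred g c θ n η * nbSum (centred g c θ) (rangeNb (N + 1 - k) k) n η)
      (siteRange N n k (n + 2 * k) : Set (Fin N)) := fun x y hxy => by
  have h1 : centred g c θ n x = centred g c θ n y :=
    (dependsOn_centred n).mono (fun i hi => by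
      simp only [siteRange, Finset.coe_filter, Finset.mem_univ, true_and, mem_ofPred_eq] at hi ⊢
      omega) hxy
  have h2 : nbSum (centred g c θ) (rangeNb (N + 1 - k) k) n x =
      nbSum (centred g c θ) (rangeNb (N + 1 - k) k) n y := by
    refine dependsOn_finsetSum (fun j hj => (dependsOn_centred j).mono fun i hi => ?_) hxy
    simp only [rangeNb, Finset.mem_filter, siteRange, Finset.coe_filter, Finset.mem_univ, true_and,
      mem_ofPred_eq] at hj hi ⊢
    omega
  simp only [h1, h2]

lemma memLp_centred {b : ℝ} (hb : 0 < b) (hg : MemLp g 4 (geomRef b k)) (hθ : ∀ i, θ i ∈ Icc 0 b)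
    (n : Fin (N + 1 - k)) : MemLp (centred g c θ n) 4 (geomProd θ) := by
  have := memLp_geomProd hb (θ := window n (by omega) θ) (fun i => hθ _) hg
  exact (((memLp_shift this).sub (memLp_const _)).mul_const (c n))

lemma integral_centred {b : ℝ} (hb : 0 < b) (hg : MemLp g 4 (geomRef b k))
    (hθ : ∀ i, θ i ∈ Icc 0 b) (n : Fin (N + 1 - k)) :
    ∫ η, centred g c θ n η ∂geomProd θ = 0 := by
  have := memLp_geomProd hb (θ := window n (by omega) θ) (fun i => hθ _) hg
  have hi := (memLp_shift this).integrable (by norm_num)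
  simp only [centred]
  rw [integral_mul_const, integral_sub hi (integrable_const _)]
  simp

/-- The fourth moments of the centred local functions are bounded uniformly in the parameters. -/
lemma integral_centred_pow_four_le {b B : ℝ} (hb : 0 < b) (hg : MemLp g 4 (geomRef b k))
    (hθ : ∀ i, θ i ∈ Icc 0 b) (n : Fin (N + 1 - k)) (hc : |c n| ≤ B) :
    ∫ η, centred g c θ n η ^ 4 ∂geomProd θ ≤ (8 * ((1 + b) ^ k * ∫ η, g η ^ 4 ∂geomRef b k +
      ((1 + b) ^ k * ∫ η, |g η| ∂geomRef b k) ^ 4)) * B ^ 4 := by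
  have hn : (n : ℕ) + k ≤ N := by omega
  have hw : ∀ i, window n hn θ i ∈ Icc 0 b := fun i => hθ _
  have hgw := memLp_geomProd hb (θ := window n hn θ) hw hg
  have hs := memLp_shift hgw
  have h4 := integrable_pow_four hs
  set m := ∫ ξ, shift g n hn ξ ∂geomProd θ with hm
  have hm1 : |m| ≤ (1 + b) ^ k * ∫ η, |g η| ∂geomRef b k := by
    rw [hm, integral_shift]
    exact abs_integral_le_integral_abs.trans (integral_geomProd_le hb hw (fun _ => abs_nonneg _)
      (hg.integrable (by norm_num)).abs)
  have hm4 : m ^ 4 ≤ ((1 + b) ^ k * ∫ η, |g η| ∂geomRef b k) ^ 4 := by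
    rw [← Even.pow_abs (by decide : Even 4) m]; gcongr
  have hg4 : ∫ η, shift g n hn η ^ 4 ∂geomProd θ ≤ (1 + b) ^ k * ∫ η, g η ^ 4 ∂geomRef b k := by
    have e : ∀ η : Fin N → ℕ, shift g n hn η ^ 4 =
      shift (fun x => g x ^ 4) n hn η := fun η => rfl
    simp_rw [e]
    rw [integral_shift]
    exact integral_geomProd_le hb hw (fun _ => by simp only [Pi.zero_apply]; positivity) (integrable_pow_four hg)
  have hc4 : c n ^ 4 ≤ B ^ 4 := by
    rw [← Even.pow_abs (by decide : Even 4) (c n)]; gcongr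
  have hpt : ∀ η, centred g c θ n η ^ 4 ≤ (8 * (shift g n hn η ^ 4 + m ^ 4)) * B ^ 4 := fun η => by
    rw [centred, mul_pow]
    gcongr
    set x := shift g n hn η
    change (x - m) ^ 4 ≤ _
    nlinarith [sq_nonneg (x + m), sq_nonneg (x - m), sq_nonneg (x ^ 2 - m ^ 2), sq_nonneg (x * m),
      sq_nonneg ((x - m) ^ 2 - (x + m) ^ 2), sq_nonneg ((x + m) ^ 2)]
  refine (integral_mono_of_nonneg (ae_of_all _ fun η => by simp only [Pi.zero_apply]; positivity)
    (((h4.add (integrable_const _)).const_mul 8).mul_const _) (ae_of_all _ hpt)).trans ?_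
  simp only [Pi.add_apply]
  rw [integral_mul_const, integral_const_mul, integral_add h4 (integrable_const _)]
  simp only [integral_const, probReal_univ, one_smul]
  gcongr

end Centred

/-- The conditional central limit theorem, uniformly in the parameters. -/
lemma exists_norm_integral_cexp_centred_le {k : ℕ} {b B : ℝ} (hb : 0 < b)
    {g : (Fin k → ℕ) → ℝ} (hg : MemLp g 4 (geomRef b k)) (t : ℝ) :
    ∃ C : ℝ, ∀ (N : ℕ), 0 < N → ∀ c : ℕ → ℝ, (∀ n : ℕ, n ≤ N → |c n| ≤ B) →
      ∀ θ : Fin N → ℝ, (∀ i, θ i ∈ Icc 0 b) →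
      ‖∫ η, Complex.exp ((t * ((√(N : ℝ))⁻¹ * ∑ n, centred g c θ n η) : ℝ) * Complex.I) ∂geomProd θ -
        (Real.exp (-(((N : ℝ)⁻¹ * ∫ η, localSquare (centred g c θ) (rangeNb (N + 1 - k) k) η
          ∂geomProd θ) * t ^ 2 / 2)) : ℂ)‖ ≤ C * (√(N : ℝ))⁻¹ := by
  set κ := (8 * ((1 + b) ^ k * ∫ η, g η ^ 4 ∂geomRef b k +
      ((1 + b) ^ k * ∫ η, |g η| ∂geomRef b k) ^ 4)) * B ^ 4 with hκ
  have hκ0 : 0 ≤ κ := by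
    have h1 : 0 ≤ ∫ η, g η ^ 4 ∂geomRef b k := integral_nonneg fun _ => by positivity
    positivity
  refine ⟨_, fun N hN c hc θ hθ => norm_integral_cexp_sub_le_of_finite_range
    (fun i => memLp_centred hb hg hθ i)
    (fun i => integral_centred_pow_four_le hb hg hθ i (hc i (by omega))) hκ0
    (fun i => integral_centred hb hg hθ i) (fun i => indepFun_centred i) (fun i j hij => ?_) hN
    (by omega) t⟩
  refine IndepFun.covariance_eq_zero (indepFun_of_dependsOn ?_ (dependsOn_centred_mul_nbSum i)
    (dependsOn_centred_mul_nbSum j)) (memLp_mul_nbSum (fun i => memLp_centred hb hg hθ i) i)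
    (memLp_mul_nbSum (fun i => memLp_centred hb hg hθ i) j)
  rw [Finset.disjoint_left]
  intro s hs hs'
  simp only [siteRange, Finset.mem_filter, Finset.mem_univ, true_and] at hs hs'
  omega

/-! ### Linear statistics of ordered samples -/

/-- The affine map from `[0,1]` onto `[a,b]`; it is `profile a b` without the cut-off. -/
def ramp (a b s : ℝ) : ℝ := a + (b - a) * s

/-- The indicator of `x ≤ ramp a b s`. -/
noncomputable def stepFn (a b s x : ℝ) : ℝ := if x ≤ ramp a b s then 1 else 0

lemma stepFn_nonneg (a b s x : ℝ) : 0 ≤ stepFn a b s x := by unfold stepFn; split_ifs <;> simp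

lemma stepFn_le_one (a b s x : ℝ) : stepFn a b s x ≤ 1 := by unfold stepFn; split_ifs <;> simp

lemma measurable_stepFn (a b : ℝ) : Measurable fun p : ℝ × ℝ => stepFn a b p.1 p.2 := by
  unfold stepFn ramp
  refine Measurable.ite (measurableSet_le (by fun_prop) (by fun_prop)) measurable_const measurable_const

/-- The empirical distribution function of the sample `u`, in the variable `s ∈ [0,1]`. -/
noncomputable def empCdf (a b : ℝ) {N : ℕ} (u : Fin N → ℝ) (s : ℝ) : ℝ :=
  (N : ℝ)⁻¹ * ∑ i, stepFn a b s (u i)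

lemma empCdf_mem {a b : ℝ} {N : ℕ} (u : Fin N → ℝ) (s : ℝ) : empCdf a b u s ∈ Icc (0 : ℝ) 1 := by
  have h0 : 0 ≤ ∑ i, stepFn a b s (u i) := Finset.sum_nonneg fun i _ => stepFn_nonneg _ _ _ _
  have h1 : ∑ i, stepFn a b s (u i) ≤ N := by
    refine (Finset.sum_le_card_nsmul _ _ 1 fun i _ => stepFn_le_one _ _ _ _).trans ?_
    simp
  refine ⟨by unfold empCdf; positivity, ?_⟩
  unfold empCdf
  rcases Nat.eq_zero_or_pos N with rfl | hN
  · simp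
  · rw [inv_mul_le_one₀ (by exact_mod_cast hN)]; exact h1

lemma measurable_empCdf (a b : ℝ) {N : ℕ} :
    Measurable fun p : ℝ × (Fin N → ℝ) => empCdf a b p.2 p.1 := by
  unfold empCdf
  refine Measurable.const_mul (Finset.measurable_sum _ fun i _ => ?_) _
  exact (measurable_stepFn a b).comp (by fun_prop : Measurable fun p : ℝ × (Fin N → ℝ) => (p.1, p.2 i))

lemma orderStatistics_monotone {N : ℕ} (u : Fin N → ℝ) : Monotone (orderStatistics u) :=
  Tuple.monotone_sort u

lemma sum_stepFn_eq_card (a b : ℝ) {N : ℕ} (u : Fin N → ℝ) (s : ℝ) :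
    ∑ i, stepFn a b s (u i) =
      ((Finset.univ.filter fun i => orderStatistics u i ≤ ramp a b s).card : ℝ) := by
  rw [← Equiv.sum_comp (Tuple.sort u) fun i => stepFn a b s (u i)]
  simp only [stepFn, orderStatistics, Function.comp_apply, Finset.sum_boole]
  congr

/-- The order statistic of index `n` (counted from `0`) lies below `ramp a b s` precisely when more than
`n` sample points do, so that the weighted sum of step functions telescopes. -/
lemma sum_sub_mul_stepFn {a b : ℝ} {N : ℕ} (u : Fin N → ℝ) (s : ℝ) (Ψ : ℝ → ℝ) :
    ∑ n : Fin N, (Ψ (((n : ℝ) + 1) / N) - Ψ ((n : ℝ) / N)) * stepFn a b s (orderStatistics u n) =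
      Ψ (empCdf a b u s) - Ψ 0 := by
  set m := (Finset.univ.filter fun i => orderStatistics u i ≤ ramp a b s).card with hm
  have hmN : m ≤ N := by
    have := Finset.card_filter_le (Finset.univ : Finset (Fin N))
      fun i => orderStatistics u i ≤ ramp a b s
    simpa using this
  have h1 : ∀ n : Fin N, stepFn a b s (orderStatistics u n) = if (n : ℕ) < m then 1 else 0 := fun n => by
    unfold stepFn
    have := Tuple.lt_card_le_iff_apply_le_of_monotone (j := n) (a := ramp a b s) (orderStatistics_monotone u)
    simp only [← this, ← hm]
  have hE : empCdf a b u s = (m : ℝ) / N := by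
    rw [empCdf, sum_stepFn_eq_card, ← hm, div_eq_inv_mul]
  simp_rw [h1]
  rw [hE, Fin.sum_univ_eq_sum_range (fun n => (Ψ (((n : ℝ) + 1) / N) - Ψ ((n : ℝ) / N)) *
    if n < m then 1 else 0) N]
  simp only [mul_ite, mul_one, mul_zero]
  rw [← Finset.sum_filter]
  have h2 : (Finset.range N).filter (fun n => n < m) = Finset.range m := by
    ext n; simp; omega
  rw [h2]
  have := Finset.sum_range_sub (fun n : ℕ => Ψ ((n : ℝ) / N)) m
  simpa using this

lemma intervalIntegrable_mul_of_bounded {q f : ℝ → ℝ} (hq : Continuous q) {C : ℝ}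
    (hf : Measurable f) (hC : ∀ s, |f s| ≤ C) (c d : ℝ) :
    IntervalIntegrable (fun s => q s * f s) volume c d := by
  have h := hq.intervalIntegrable (μ := volume) c d
  rw [intervalIntegrable_iff] at h ⊢
  exact h.mul_bdd hf.aestronglyMeasurable (ae_of_all _ hC)

/-- A `C¹` function on `[a,b]`, read on `[0,1]`, is an integral of step functions. -/
lemma eq_sub_integral_stepFn {a b : ℝ} (hab : a < b) {H : ℝ → ℝ} (hH : ContDiff ℝ 1 H) {x : ℝ}
    (hx : x ∈ Icc a b) :
    H ((x - a) / (b - a)) = H 1 - ∫ s in (0 : ℝ)..1, deriv H s * stepFn a b s x := by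
  have hba : 0 < b - a := sub_pos.2 hab
  set r := (x - a) / (b - a) with hr
  have hr0 : 0 ≤ r := div_nonneg (by linarith [hx.1]) hba.le
  have hr1 : r ≤ 1 := by rw [hr, div_le_one hba]; linarith [hx.2]
  have hiff : ∀ s, x ≤ ramp a b s ↔ r ≤ s := fun s => by
    rw [hr, div_le_iff₀ hba, ramp]; constructor <;> intro h <;> linarith
  have hc := hH.continuous_deriv le_rfl
  have hi := fun c d => intervalIntegrable_mul_of_bounded hc (C := 1)
    ((measurable_stepFn a b).comp (by fun_prop : Measurable fun s : ℝ => (s, x)))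
    (fun s => by
      simp only [Function.comp_apply]
      rw [abs_of_nonneg (stepFn_nonneg _ _ _ _)]; exact stepFn_le_one _ _ _ _) c d
  simp only [Function.comp_apply] at hi
  have e1 : ∫ s in (0 : ℝ)..r, deriv H s * stepFn a b s x = 0 := by
    refine (intervalIntegral.integral_congr_ae (g := fun _ => 0) ?_).trans (by simp)
    filter_upwards [Measure.ae_ne volume r] with s hs hs'
    rw [uIoc_of_le hr0] at hs'
    have : ¬ r ≤ s := fun h => hs (le_antisymm hs'.2 h)
    simp [stepFn, hiff, this]
  have e2 : ∫ s in r..1, deriv H s * stepFn a b s x = ∫ s in r..1, deriv H s := by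
    refine intervalIntegral.integral_congr_ae (ae_of_all _ fun s hs => ?_)
    rw [uIoc_of_le hr1] at hs
    simp [stepFn, hiff, hs.1.le]
  rw [← intervalIntegral.integral_add_adjacent_intervals (hi 0 r) (hi r 1), e1, e2,
    intervalIntegral.integral_deriv_eq_sub (fun y _ => (hH.differentiable one_ne_zero) y)
      (hc.intervalIntegrable _ _)]
  ring

/-- The influence function: the first order effect of one sample point at `x` on the linear
statistic of the ordered sample with score `ψ` and (in the variable `s ∈ [0,1]`) summand `H`. -/
noncomputable def influence (a b : ℝ) (H ψ : ℝ → ℝ) (x : ℝ) : ℝ :=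
  -∫ s in (0 : ℝ)..1, deriv H s * ψ s * (stepFn a b s x - s)

lemma abs_primitive_sub_le {ψ : ℝ → ℝ} (hψ : Continuous ψ) {L : ℝ} (hL0 : 0 ≤ L)
    (hL : ∀ x ∈ Icc (0 : ℝ) 1, ∀ y ∈ Icc (0 : ℝ) 1, |ψ x - ψ y| ≤ L * |x - y|) {s y : ℝ}
    (hs : s ∈ Icc (0 : ℝ) 1) (hy : y ∈ Icc (0 : ℝ) 1) :
    |(∫ r in (0 : ℝ)..y, ψ r) - (∫ r in (0 : ℝ)..s, ψ r) - ψ s * (y - s)| ≤ L * (y - s) ^ 2 := by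
  rw [intervalIntegral.integral_interval_sub_left (hψ.intervalIntegrable _ _)
    (hψ.intervalIntegrable _ _)]
  have e : ∫ r in s..y, ψ s = ψ s * (y - s) := by simp [mul_comm]
  rw [← e, ← intervalIntegral.integral_sub (hψ.intervalIntegrable _ _) (by simp)]
  have h := intervalIntegral.norm_integral_le_of_norm_le_const (f := fun r => ψ r - ψ s)
    (C := L * |y - s|) (a := s) (b := y) fun r hr => by
      have hr' : r ∈ uIcc s y := uIoc_subset_uIcc hr
      have hr1 : r ∈ Icc (0 : ℝ) 1 := (convex_Icc (0 : ℝ) 1).ordConnected.uIcc_subset hs hy hr'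
      exact (hL r hr1 s hs).trans
        (mul_le_mul_of_nonneg_left (abs_sub_left_of_mem_uIcc hr') hL0)
  rw [Real.norm_eq_abs, mul_assoc, ← sq, sq_abs] at h
  exact h

/-- Second order expansion of a linear statistic of the ordered sample: up to the squared deviation of the
empirical distribution function, it is the sum of its mean and of the influence of the sample points. -/
lemma abs_linearStatistic_sub_le {a b : ℝ} (hab : a < b) {N : ℕ} (hN : 0 < N) {u : Fin N → ℝ}
    (hu : ∀ i, u i ∈ Icc a b) {H ψ : ℝ → ℝ} (hH : ContDiff ℝ 1 H) (hψ : Continuous ψ)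
    {L B : ℝ} (hL0 : 0 ≤ L) (hL : ∀ x ∈ Icc (0 : ℝ) 1, ∀ y ∈ Icc (0 : ℝ) 1, |ψ x - ψ y| ≤ L * |x - y|)
    (hB : ∀ x ∈ Icc (0 : ℝ) 1, |deriv H x| ≤ B) :
    |∑ n : Fin N, (∫ r in ((n : ℝ) / N)..(((n : ℝ) + 1) / N), ψ r) *
          H ((orderStatistics u n - a) / (b - a)) - (∫ s in (0 : ℝ)..1, H s * ψ s) -
        (N : ℝ)⁻¹ * ∑ i, influence a b H ψ (u i)| ≤
      B * L * ∫ s in (0 : ℝ)..1, (empCdf a b u s - s) ^ 2 := by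
  set Ψ : ℝ → ℝ := fun y => ∫ r in (0 : ℝ)..y, ψ r with hΨ
  have hΨd : ∀ x, HasDerivAt Ψ (ψ x) x := fun x =>
    intervalIntegral.integral_hasDerivAt_right (hψ.intervalIntegrable _ _)
      (hψ.stronglyMeasurableAtFilter _ _) hψ.continuousAt
  have hΨ0 : Ψ 0 = 0 := by simp [hΨ]
  have hΨc : Continuous Ψ := continuous_iff_continuousAt.2 fun x => (hΨd x).continuousAt
  have hdc := hH.continuous_deriv le_rfl
  have hN' : (N : ℝ) ≠ 0 := by exact_mod_cast hN.ne'
  have hB0 : 0 ≤ B := (abs_nonneg _).trans (hB 0 (by simp))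
  have hcn : ∀ n : Fin N, (∫ r in ((n : ℝ) / N)..(((n : ℝ) + 1) / N), ψ r) =
      Ψ (((n : ℝ) + 1) / N) - Ψ ((n : ℝ) / N) := fun n =>
    (intervalIntegral.integral_interval_sub_left (hψ.intervalIntegrable _ _)
      (hψ.intervalIntegrable _ _)).symm
  have hmeas1 : ∀ x, Measurable fun s => stepFn a b s x := fun x =>
    (measurable_stepFn a b).comp (by fun_prop : Measurable fun s : ℝ => (s, x))
  have hmeas2 : Measurable fun s => empCdf a b u s :=
    (measurable_empCdf a b).comp (by fun_prop : Measurable fun s : ℝ => (s, u))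
  have hint1 : ∀ {q : ℝ → ℝ} (hq : Continuous q) (x : ℝ),
      IntervalIntegrable (fun s => q s * stepFn a b s x) volume 0 1 := fun hq x =>
    intervalIntegrable_mul_of_bounded hq (C := 1) (hmeas1 x) (fun s => by
      rw [abs_of_nonneg (stepFn_nonneg _ _ _ _)]; exact stepFn_le_one _ _ _ _) _ _
  have hmemΘ : ∀ n, orderStatistics u n ∈ Icc a b := fun n => hu _
  -- the ordered sum, in terms of the empirical distribution function
  have h1 : ∑ n : Fin N, (∫ r in ((n : ℝ) / N)..(((n : ℝ) + 1) / N), ψ r) *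
        H ((orderStatistics u n - a) / (b - a)) =
      H 1 * Ψ 1 - ∫ s in (0 : ℝ)..1, deriv H s * Ψ (empCdf a b u s) := by
    have e1 : ∀ n : Fin N, (∫ r in ((n : ℝ) / N)..(((n : ℝ) + 1) / N), ψ r) *
        H ((orderStatistics u n - a) / (b - a)) =
        (Ψ (((n : ℝ) + 1) / N) - Ψ ((n : ℝ) / N)) * H 1 - ∫ s in (0 : ℝ)..1,
          (Ψ (((n : ℝ) + 1) / N) - Ψ ((n : ℝ) / N)) * (deriv H s * stepFn a b s (orderStatistics u n)) :=
      fun n => by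
        rw [hcn, eq_sub_integral_stepFn hab hH (hmemΘ n), mul_sub, intervalIntegral.integral_const_mul]
    simp_rw [e1]
    rw [Finset.sum_sub_distrib, ← Finset.sum_mul,
      ← intervalIntegral.integral_finsetSum fun n _ => (hint1 hdc _).const_mul _]
    have e2 : ∑ n : Fin N, (Ψ (((n : ℝ) + 1) / N) - Ψ ((n : ℝ) / N)) = Ψ 1 := by
      rw [Fin.sum_univ_eq_sum_range (fun n => Ψ (((n : ℝ) + 1) / N) - Ψ ((n : ℝ) / N)) N]
      have := Finset.sum_range_sub (fun n : ℕ => Ψ ((n : ℝ) / N)) N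
      simpa [hΨ0, hN'] using this
    rw [e2, mul_comm]
    congr 1
    refine intervalIntegral.integral_congr fun s _ => ?_
    have := sum_sub_mul_stepFn (a := a) (b := b) u s Ψ
    rw [hΨ0, sub_zero] at this
    rw [← this, Finset.mul_sum]
    exact Finset.sum_congr rfl fun n _ => by ring
  -- its mean, by integration by parts
  have h2 : ∫ s in (0 : ℝ)..1, H s * ψ s = H 1 * Ψ 1 - ∫ s in (0 : ℝ)..1, deriv H s * Ψ s := by
    rw [intervalIntegral.integral_mul_deriv_eq_deriv_mul (u := H) (v := Ψ) (u' := deriv H)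
      (fun x _ => ((hH.differentiable one_ne_zero) x).hasDerivAt) (fun x _ => hΨd x)
      (hdc.intervalIntegrable _ _) (hψ.intervalIntegrable _ _), hΨ0]
    ring
  -- the influence of the sample
  have h3 : (N : ℝ)⁻¹ * ∑ i, influence a b H ψ (u i) =
      -∫ s in (0 : ℝ)..1, deriv H s * (ψ s * (empCdf a b u s - s)) := by
    simp only [influence]
    rw [Finset.sum_neg_distrib, mul_neg, ← intervalIntegral.integral_finsetSum fun i _ => ?_,
      ← intervalIntegral.integral_const_mul]
    · congr 1
      refine intervalIntegral.integral_congr fun s _ => ?_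
      rw [← Finset.mul_sum, Finset.sum_sub_distrib, empCdf]
      simp only [Finset.sum_const, Finset.card_univ, Fintype.card_fin, nsmul_eq_mul]
      field_simp
    · simp only [mul_sub]
      exact (hint1 (hdc.mul hψ) _).sub (((hdc.mul hψ).mul continuous_id).intervalIntegrable _ _)
  have hi1 : IntervalIntegrable (fun s => deriv H s * Ψ (empCdf a b u s)) volume 0 1 := by
    obtain ⟨C, hC⟩ := isCompact_Icc.exists_bound_of_continuousOn (hΨc.continuousOn (s := Icc 0 1))
    exact intervalIntegrable_mul_of_bounded hdc (C := C) (hΨc.measurable.comp hmeas2)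
      (fun s => hC _ (empCdf_mem u s)) _ _
  have hi2 : IntervalIntegrable (fun s => deriv H s * Ψ s) volume 0 1 :=
    (hdc.mul hΨc).intervalIntegrable _ _
  have hi3 : IntervalIntegrable (fun s => deriv H s * (ψ s * (empCdf a b u s - s))) volume 0 1 := by
    have e : ∀ s, deriv H s * (ψ s * (empCdf a b u s - s)) =
        deriv H s * ψ s * empCdf a b u s - deriv H s * ψ s * s := fun s => by ring
    simp_rw [e]
    refine IntervalIntegrable.sub (intervalIntegrable_mul_of_bounded (hdc.mul hψ) (C := 1) hmeas2
      (fun s => ?_) _ _) (((hdc.mul hψ).mul continuous_id).intervalIntegrable _ _)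
    rw [abs_of_nonneg (empCdf_mem u s).1]; exact (empCdf_mem u s).2
  have hi4 : IntervalIntegrable (fun s => (empCdf a b u s - s) ^ 2) volume 0 1 := by
    have e : ∀ s, (empCdf a b u s - s) ^ 2 =
        (1 * empCdf a b u s ^ 2 - (2 * s) * empCdf a b u s) + s ^ 2 := fun s => by ring
    simp_rw [e]
    refine ((intervalIntegrable_mul_of_bounded continuous_const (C := 1) (hmeas2.pow_const 2)
      (fun s => ?_) _ _).sub (intervalIntegrable_mul_of_bounded (by fun_prop) (C := 1) hmeas2
      (fun s => ?_) _ _)).add ((by fun_prop : Continuous fun s : ℝ => s ^ 2).intervalIntegrable _ _)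
    · rw [abs_of_nonneg (by positivity)]
      exact pow_le_one₀ (empCdf_mem u s).1 (empCdf_mem u s).2
    · rw [abs_of_nonneg (empCdf_mem u s).1]; exact (empCdf_mem u s).2
  have h4 : ∑ n : Fin N, (∫ r in ((n : ℝ) / N)..(((n : ℝ) + 1) / N), ψ r) *
          H ((orderStatistics u n - a) / (b - a)) - (∫ s in (0 : ℝ)..1, H s * ψ s) -
        (N : ℝ)⁻¹ * ∑ i, influence a b H ψ (u i) = -∫ s in (0 : ℝ)..1, deriv H s *
          (Ψ (empCdf a b u s) - Ψ s - ψ s * (empCdf a b u s - s)) := by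
    rw [h1, h2, h3]
    have e : ∀ s, deriv H s * (Ψ (empCdf a b u s) - Ψ s - ψ s * (empCdf a b u s - s)) =
      deriv H s * Ψ (empCdf a b u s) - deriv H s * Ψ s - deriv H s * (ψ s * (empCdf a b u s - s)) :=
      fun s => by ring
    simp_rw [e]
    rw [intervalIntegral.integral_sub (hi1.sub hi2) hi3, intervalIntegral.integral_sub hi1 hi2]
    ring
  rw [h4, abs_neg, ← intervalIntegral.integral_const_mul]
  rw [← Real.norm_eq_abs]
  refine (intervalIntegral.norm_integral_le_of_norm_le zero_le_one (ae_of_all _ fun s hs => ?_)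
    (hi4.const_mul _))
  have hs' : s ∈ Icc (0 : ℝ) 1 := Ioc_subset_Icc_self hs
  rw [Real.norm_eq_abs, abs_mul, mul_assoc]
  gcongr
  · exact hB s hs'
  · exact abs_primitive_sub_le hψ hL0 hL hs' (empCdf_mem u s)

/-! ### Window sums over ordered configurations -/

lemma sum_range_shift_sub_le {y : ℕ → ℝ} {a b : ℝ} (hy : ∀ n, y n ∈ Icc a b) (M j : ℕ) :
    ∑ n ∈ Finset.range M, (y (n + j) - y n) ≤ j * (b - a) := by
  induction j with
  | zero => simp
  | succ j ih =>
    have e : ∀ n, y (n + (j + 1)) - y n = (y (n + j) - y n) + (y (n + 1 + j) - y (n + j)) := fun n => by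
      rw [show n + (j + 1) = n + 1 + j by ring]; ring
    simp_rw [e]
    rw [Finset.sum_add_distrib, Finset.sum_range_sub (fun n => y (n + j)) M]
    have h1 := (hy (M + j)).2
    have h2 := (hy (0 + j)).1
    push_cast
    linarith

/-- In a sum over the windows of a monotone configuration, a Lipschitz function may be evaluated on the
diagonal: the total error telescopes, hence is bounded. -/
lemma abs_sum_window_sub_le {a b : ℝ} {N K : ℕ} (hK : 1 ≤ K) (hN : 0 < N) {x : Fin N → ℝ}
    (hx : Monotone x) (hxm : ∀ i, x i ∈ Icc a b) {F : (Fin K → ℝ) → ℝ} {h : ℝ → ℝ} {Λ B B' A : ℝ}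
    (hΛ : 0 ≤ Λ)
    (hF : ∀ θ θ' : Fin K → ℝ, (∀ i, θ i ∈ Icc a b) → (∀ i, θ' i ∈ Icc a b) →
      |F θ - F θ'| ≤ Λ * ∑ i, |θ i - θ' i|)
    (hFh : ∀ y ∈ Icc a b, F (fun _ => y) = h y) (hB : ∀ y ∈ Icc a b, |h y| ≤ B) {w c : ℕ → ℝ}
    (hw : ∀ n < N, |w n| ≤ B') (hwc : ∀ n < N, |w n - c n| ≤ A / N) :
    |∑ n : Fin (N + 1 - K), w n * F (window n (by omega) x) - ∑ n : Fin N, c n * h (x n)| ≤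
      B' * Λ * (K * (K * (b - a))) + A * B + K * ((B' + A) * B) := by
  have hNpos : (0 : ℝ) < N := by exact_mod_cast hN
  have hN1 : (1 : ℝ) ≤ N := by exact_mod_cast hN
  have hB'0 : 0 ≤ B' := (abs_nonneg _).trans (hw 0 hN)
  have hA0 : 0 ≤ A := by
    have := (abs_nonneg _).trans (hwc 0 hN)
    by_contra hA
    exact absurd this (not_le.2 (div_neg_of_neg_of_pos (not_le.1 hA) hNpos))
  set y : ℕ → ℝ := fun m => x ⟨min m (N - 1), by omega⟩ with hy
  have hyx : ∀ m (hm : m < N), y m = x ⟨m, hm⟩ := fun m hm => by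
    simp only [hy]; congr; omega
  have hym : ∀ m, y m ∈ Icc a b := fun m => hxm _
  have hymono : Monotone y := fun m n hmn => hx (by
    simp only [Fin.mk_le_mk]; omega)
  have hba : 0 ≤ b - a := by have := hym 0; linarith [this.1, this.2]
  have hB0 : 0 ≤ B := (abs_nonneg _).trans (hB _ (hym 0))
  have hcb : ∀ n < N, |c n| ≤ B' + A := fun n hn => by
    have h1 := hwc n hn
    have h2 : A / N ≤ A := div_le_self hA0 hN1
    have h3 : |c n| ≤ |w n| + |w n - c n| := by
      have := abs_sub (w n) (w n - c n); simpa using this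
    linarith [hw n hn]
  have hcx : ∑ n : Fin N, c n * h (x n) = ∑ n ∈ Finset.range N, c n * h (y n) := by
    rw [← Fin.sum_univ_eq_sum_range (fun n => c n * h (y n)) N]
    exact Finset.sum_congr rfl fun n _ => by rw [hyx n n.2]
  rw [hcx]
  have hMN : N + 1 - K ≤ N := by omega
  rw [← Finset.sum_range_add_sum_Ico _ hMN,
    ← Fin.sum_univ_eq_sum_range (fun n => c n * h (y n)) (N + 1 - K), ← sub_sub,
    ← Finset.sum_sub_distrib]
  have hterm : ∀ n : Fin (N + 1 - K), |w n * F (window n (by omega) x) - c n * h (y n)| ≤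
      B' * Λ * (∑ j : Fin K, (y (n + j) - y n)) + A / N * B := fun n => by
    have hnN : (n : ℕ) < N := by omega
    have h1 : |F (window n (by omega) x) - h (y n)| ≤ Λ * ∑ j : Fin K, (y (n + j) - y n) := by
      rw [← hFh _ (hym n)]
      refine (hF _ _ (fun j => hxm _) fun _ => hym n).trans (le_of_eq ?_)
      congr 1
      refine Finset.sum_congr rfl fun j _ => ?_
      change |x ⟨n + j, by omega⟩ - y n| = y (n + j) - y n
      rw [← hyx (n + j) (by omega), abs_of_nonneg (sub_nonneg.2 (hymono (by omega)))]
    have e : w n * F (window n (by omega) x) - c n * h (y n) =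
        w n * (F (window n (by omega) x) - h (y n)) + (w n - c n) * h (y n) := by ring
    rw [e]
    calc _ ≤ |w n| * |F (window n (by omega) x) - h (y n)| + |w n - c n| * |h (y n)| := by
          rw [← abs_mul, ← abs_mul]; exact abs_add_le _ _
      _ ≤ B' * (Λ * ∑ j : Fin K, (y (n + j) - y n)) + A / N * B := by
          gcongr
          · exact hw n hnN
          · exact hwc n hnN
          · exact hB _ (hym n)
      _ = _ := by ring
  have hmain : ∑ n : Fin (N + 1 - K), (B' * Λ * (∑ j : Fin K, (y (n + j) - y n)) + A / N * B) ≤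
      B' * Λ * (K * (K * (b - a))) + A * B := by
    rw [Finset.sum_add_distrib, ← Finset.mul_sum, Finset.sum_comm]
    gcongr ?_ + ?_
    · gcongr
      refine (Finset.sum_le_card_nsmul _ _ (K * (b - a)) fun j _ => ?_).trans (by simp)
      rw [Fin.sum_univ_eq_sum_range (fun n => y (n + j) - y n) (N + 1 - K)]
      refine (sum_range_shift_sub_le hym _ _).trans ?_
      gcongr
      exact j.2.le
    · rw [Finset.sum_const, Finset.card_univ, Fintype.card_fin, nsmul_eq_mul]
      have : ((N + 1 - K : ℕ) : ℝ) ≤ N := by exact_mod_cast hMN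
      calc _ ≤ (N : ℝ) * (A / N * B) := by gcongr
        _ = A * B := by field_simp
  have hrest : |∑ n ∈ Finset.Ico (N + 1 - K) N, c n * h (y n)| ≤ K * ((B' + A) * B) := by
    refine (Finset.abs_sum_le_sum_abs _ _).trans ?_
    refine (Finset.sum_le_card_nsmul _ _ ((B' + A) * B) fun n hn => ?_).trans ?_
    · rw [abs_mul]
      gcongr
      · exact hcb n (Finset.mem_Ico.1 hn).2
      · exact hB _ (hym n)
    · rw [Nat.card_Ico, nsmul_eq_mul]
      have : ((N - (N + 1 - K) : ℕ) : ℝ) ≤ K := by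
        have : N - (N + 1 - K) ≤ K := by omega
        exact_mod_cast this
      gcongr
  refine (abs_sub _ _).trans (add_le_add ?_ hrest)
  exact ((Finset.abs_sum_le_sum_abs _ _).trans (Finset.sum_le_sum fun n _ => hterm n)).trans hmain

lemma abs_integral_cell_sub_le {ψ : ℝ → ℝ} (hψ : Continuous ψ) {L : ℝ} (hL0 : 0 ≤ L)
    (hL : ∀ x ∈ Icc (0 : ℝ) 1, ∀ y ∈ Icc (0 : ℝ) 1, |ψ x - ψ y| ≤ L * |x - y|) {N n : ℕ}
    (hn : n < N) :
    |N * (∫ r in ((n : ℝ) / N)..(((n : ℝ) + 1) / N), ψ r) - ψ ((n : ℝ) / (N + 1))| ≤ 2 * L / N := by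
  have hN : (0 : ℝ) < N := by exact_mod_cast (Nat.zero_le n).trans_lt hn
  have hn' : (n : ℝ) + 1 ≤ N := by exact_mod_cast hn
  have hn0 : (0 : ℝ) ≤ n := Nat.cast_nonneg n
  have m1 : (n : ℝ) / N ∈ Icc (0 : ℝ) 1 := ⟨by positivity, by rw [div_le_one hN]; linarith⟩
  have m2 : ((n : ℝ) + 1) / N ∈ Icc (0 : ℝ) 1 := ⟨by positivity, by rw [div_le_one hN]; linarith⟩
  have m3 : (n : ℝ) / (N + 1) ∈ Icc (0 : ℝ) 1 :=
    ⟨by positivity, by rw [div_le_one (by positivity)]; linarith⟩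
  have h1 := abs_primitive_sub_le hψ hL0 hL m1 m2
  rw [intervalIntegral.integral_interval_sub_left (hψ.intervalIntegrable _ _)
    (hψ.intervalIntegrable _ _)] at h1
  have e1 : ((n : ℝ) + 1) / N - n / N = 1 / N := by field_simp; ring
  rw [e1] at h1
  have h2 := hL _ m1 _ m3
  have e2 : |(n : ℝ) / N - n / (N + 1)| ≤ 1 / N := by
    have : (n : ℝ) / N - n / (N + 1) = n / (N + 1) * (1 / N) := by field_simp; ring
    rw [this, abs_of_nonneg (by positivity)]
    exact mul_le_of_le_one_left (by positivity) m3.2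
  set I := ∫ r in ((n : ℝ) / N)..(((n : ℝ) + 1) / N), ψ r
  have e3 : (N : ℝ) * I - ψ ((n : ℝ) / (N + 1)) =
      N * (I - ψ (n / N) * (1 / N)) + (ψ (n / N) - ψ (n / (N + 1))) := by field_simp; ring
  rw [e3]
  calc _ ≤ N * |I - ψ (n / N) * (1 / N)| + |ψ (n / N) - ψ (n / (N + 1))| := by
        refine (abs_add_le _ _).trans ?_
        rw [abs_mul, abs_of_pos hN]
    _ ≤ N * (L * (1 / N) ^ 2) + L * (1 / N) := by
        gcongr
        exact h2.trans (by gcongr)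
    _ = _ := by field_simp; norm_num

/-- The expansion of `abs_linearStatistic_sub_le` for weighted averages over the windows of the ordered sample. -/
lemma exists_abs_windowAverage_sub_le {a b : ℝ} (hab : a < b) {K : ℕ} (hK : 1 ≤ K)
    {F : (Fin K → ℝ) → ℝ} {H ψ : ℝ → ℝ} (hH : ContDiff ℝ 1 H) (hψ : ContDiff ℝ 1 ψ) {Λ A : ℝ}
    (hΛ : 0 ≤ Λ) (hA : 0 ≤ A)
    (hF : ∀ θ θ' : Fin K → ℝ, (∀ i, θ i ∈ Icc a b) → (∀ i, θ' i ∈ Icc a b) →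
      |F θ - F θ'| ≤ Λ * ∑ i, |θ i - θ' i|)
    (hFH : ∀ y ∈ Icc a b, F (fun _ => y) = H ((y - a) / (b - a))) :
    ∃ C : ℝ, 0 ≤ C ∧ ∀ N : ℕ, 0 < N → ∀ w : ℕ → ℝ,
      (∀ n < N, |w n - ψ ((n : ℝ) / (N + 1))| ≤ A / N) →
      ∀ u : Fin N → ℝ, (∀ i, u i ∈ Icc a b) →
      |(N : ℝ)⁻¹ * ∑ n : Fin (N + 1 - K), w n * F (window n (by omega) (orderStatistics u)) -
          (∫ s in (0 : ℝ)..1, H s * ψ s) - (N : ℝ)⁻¹ * ∑ i, influence a b H ψ (u i)| ≤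
        C * ((N : ℝ)⁻¹ + ∫ s in (0 : ℝ)..1, (empCdf a b u s - s) ^ 2) := by
  obtain ⟨L, hL0, hLb, -, hLL⟩ := exists_bound_lipschitz hψ 0 1
  obtain ⟨B, hB0, hBb, hBd, -⟩ := exists_bound_lipschitz hH 0 1
  have hba : 0 < b - a := sub_pos.2 hab
  have hr : ∀ y ∈ Icc a b, (y - a) / (b - a) ∈ Icc (0 : ℝ) 1 := fun y hy =>
    ⟨div_nonneg (by linarith [hy.1]) hba.le, by rw [div_le_one hba]; linarith [hy.2]⟩
  set A' := A + 2 * L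
  set C₁ := (L + A) * Λ * (K * (K * (b - a))) + A' * B + K * ((L + A + A') * B)
  have hC₁ : 0 ≤ C₁ := by positivity
  refine ⟨C₁ + B * L, by positivity, fun N hN w hw u hu => ?_⟩
  have hNpos : (0 : ℝ) < N := by exact_mod_cast hN
  have hN1 : (1 : ℝ) ≤ N := by exact_mod_cast hN
  set c : ℕ → ℝ := fun n => N * ∫ r in ((n : ℝ) / N)..(((n : ℝ) + 1) / N), ψ r with hc
  have hψm : ∀ n < N, (n : ℝ) / (N + 1) ∈ Icc (0 : ℝ) 1 := fun n hn => by
    have : (n : ℝ) ≤ N := by exact_mod_cast hn.le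
    exact ⟨by positivity, by rw [div_le_one (by positivity)]; linarith⟩
  have h1 := abs_sum_window_sub_le (a := a) (b := b) hK hN (orderStatistics_monotone u)
    (fun i => hu _) hΛ hF (h := fun y => H ((y - a) / (b - a))) hFH (fun y hy => hBb _ (hr y hy))
    (w := w) (c := c) (B' := L + A) (A := A') (fun n hn => by
      have h3 := hw n hn
      have h4 := hLb _ (hψm n hn)
      have h5 : A / N ≤ A := div_le_self hA hN1
      have h6 : |w n| ≤ |w n - ψ ((n : ℝ) / (N + 1))| + |ψ ((n : ℝ) / (N + 1))| := by
        have := abs_add_le (w n - ψ ((n : ℝ) / (N + 1))) (ψ ((n : ℝ) / (N + 1)))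
        simpa using this
      linarith)
    (fun n hn => by
      have h3 := hw n hn
      have h4 := abs_integral_cell_sub_le hψ.continuous hL0 hLL hn
      rw [abs_sub_comm] at h4
      have := abs_sub_le (w n) (ψ ((n : ℝ) / (N + 1))) (c n)
      calc _ ≤ _ := this
        _ ≤ A / N + 2 * L / N := add_le_add h3 h4
        _ = A' / N := by simp only [A']; ring)
  have h2 := abs_linearStatistic_sub_le hab hN hu hH hψ.continuous hL0 hLL hBd
  have e : ∑ n : Fin N, (∫ r in ((n : ℝ) / N)..(((n : ℝ) + 1) / N), ψ r) *
          H ((orderStatistics u n - a) / (b - a)) =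
      (N : ℝ)⁻¹ * ∑ n : Fin N, c n * H ((orderStatistics u n - a) / (b - a)) := by
    rw [Finset.mul_sum]
    refine Finset.sum_congr rfl fun n _ => ?_
    simp only [hc]; field_simp
  rw [e] at h2
  set S₁ := ∑ n : Fin (N + 1 - K), w n * F (window n (by omega) (orderStatistics u))
  set S₂ := ∑ n : Fin N, c n * H ((orderStatistics u n - a) / (b - a))
  set I := ∫ s in (0 : ℝ)..1, H s * ψ s
  set Z := (N : ℝ)⁻¹ * ∑ i, influence a b H ψ (u i)
  set Q := ∫ s in (0 : ℝ)..1, (empCdf a b u s - s) ^ 2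
  have hQ : 0 ≤ Q := intervalIntegral.integral_nonneg zero_le_one fun _ _ => sq_nonneg _
  have e2 : (N : ℝ)⁻¹ * S₁ - I - Z = (N : ℝ)⁻¹ * (S₁ - S₂) + ((N : ℝ)⁻¹ * S₂ - I - Z) := by ring
  rw [e2]
  calc _ ≤ (N : ℝ)⁻¹ * |S₁ - S₂| + |(N : ℝ)⁻¹ * S₂ - I - Z| := by
        refine (abs_add_le _ _).trans ?_
        rw [abs_mul, abs_of_pos (by positivity : 0 < (N : ℝ)⁻¹)]
    _ ≤ (N : ℝ)⁻¹ * C₁ + B * L * Q := by gcongr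
    _ ≤ (C₁ + B * L) * ((N : ℝ)⁻¹ + Q) := by
        have : 0 ≤ (N : ℝ)⁻¹ := by positivity
        nlinarith [mul_nonneg hC₁ hQ, mul_nonneg (mul_nonneg hB0 hL0) this]

/-! ### Uniform samples -/

/-- The uniform distribution on `[a,b]`. -/
noncomputable abbrev uniformIcc (a b : ℝ) : Measure ℝ := cond (volume : Measure ℝ) (Icc a b)

/-- The law of a sample of `N` independent uniform variables on `[a,b]`. -/
noncomputable abbrev sampleMeasure (a b : ℝ) (N : ℕ) : Measure (Fin N → ℝ) :=
  Measure.pi fun _ : Fin N => uniformIcc a b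

lemma isProbabilityMeasure_uniformIcc {a b : ℝ} (hab : a < b) :
    IsProbabilityMeasure (uniformIcc a b) :=
  cond_isProbabilityMeasure_of_finite (by simp [hab]) (by simp)

lemma ae_mem_Icc_sampleMeasure {a b : ℝ} (hab : a < b) (N : ℕ) :
    ∀ᵐ u ∂sampleMeasure a b N, ∀ i, u i ∈ Icc a b := by
  have := isProbabilityMeasure_uniformIcc hab
  refine ae_all_iff.2 fun i => ?_
  have h : ∀ᵐ x ∂uniformIcc a b, x ∈ Icc a b := ae_cond_mem measurableSet_Icc
  exact (measurePreserving_eval (fun _ : Fin N => uniformIcc a b) i).quasiMeasurePreserving.ae h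

lemma measurable_stepFn_right (a b s : ℝ) : Measurable fun x => stepFn a b s x :=
  (measurable_stepFn a b).comp (by fun_prop : Measurable fun x : ℝ => (s, x))

lemma abs_stepFn_le (a b s x : ℝ) : |stepFn a b s x| ≤ 1 := by
  rw [abs_of_nonneg (stepFn_nonneg _ _ _ _)]; exact stepFn_le_one _ _ _ _

lemma integral_stepFn {a b : ℝ} (hab : a < b) {s : ℝ} (hs : s ∈ Icc (0 : ℝ) 1) :
    ∫ x, stepFn a b s x ∂uniformIcc a b = s := by
  have hba : 0 < b - a := sub_pos.2 hab
  have e : (fun x => stepFn a b s x) = (Iic (ramp a b s)).indicator 1 := by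
    funext x; simp [stepFn, indicator_apply]
  rw [e, integral_indicator_one measurableSet_Iic, measureReal_def, cond_apply measurableSet_Icc]
  have h1 : Icc a b ∩ Iic (ramp a b s) = Icc a (ramp a b s) := by
    ext x
    simp only [mem_inter_iff, mem_Icc, mem_Iic, ramp]
    constructor
    · rintro ⟨⟨h1, _⟩, h3⟩; exact ⟨h1, h3⟩
    · rintro ⟨h1, h3⟩; exact ⟨⟨h1, by nlinarith [hs.2]⟩, h3⟩
  rw [h1, Real.volume_Icc, Real.volume_Icc, ENNReal.toReal_mul, ENNReal.toReal_inv,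
    ENNReal.toReal_ofReal hba.le, ENNReal.toReal_ofReal (by
      simp only [ramp]; nlinarith [mul_nonneg hba.le hs.1])]
  simp only [ramp]
  field_simp
  ring

lemma integral_sq_empCdf_sub_le {a b : ℝ} (hab : a < b) {N : ℕ} (hN : 0 < N) {s : ℝ}
    (hs : s ∈ Icc (0 : ℝ) 1) :
    ∫ u, (empCdf a b u s - s) ^ 2 ∂sampleMeasure a b N ≤ (N : ℝ)⁻¹ := by
  have := isProbabilityMeasure_uniformIcc hab
  have hNpos : (0 : ℝ) < N := by exact_mod_cast hN
  have hm : MemLp (fun x => stepFn a b s x) 2 (uniformIcc a b) :=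
    MemLp.of_bound (measurable_stepFn_right a b s).aestronglyMeasurable 1
      (ae_of_all _ fun x => abs_stepFn_le a b s x)
  have hev := fun i => measurePreserving_eval (fun _ : Fin N => uniformIcc a b) i
  have hsum := variance_sum_pi (μ := fun _ : Fin N => uniformIcc a b)
    (X := fun _ x => stepFn a b s x) fun _ => hm
  have hvar : Var[fun x => stepFn a b s x; uniformIcc a b] ≤ 1 := by
    refine (variance_le_expectation_sq hm.1).trans ?_
    calc _ ≤ ∫ _, (1 : ℝ) ∂uniformIcc a b := by
          refine integral_mono_of_nonneg (ae_of_all _ fun x => by simp only [Pi.zero_apply, Pi.pow_apply]; positivity)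
            (integrable_const _) (ae_of_all _ fun x => ?_)
          exact pow_le_one₀ (stepFn_nonneg _ _ _ _) (stepFn_le_one _ _ _ _)
      _ = 1 := by simp
  have hmean : ∫ u, empCdf a b u s ∂sampleMeasure a b N = s := by
    simp only [empCdf]
    have hi : ∀ i : Fin N, Integrable (fun u : Fin N → ℝ => stepFn a b s (u i))
        (sampleMeasure a b N) := fun i =>
      (hev i).integrable_comp_of_integrable (hm.integrable one_le_two)
    rw [integral_const_mul, integral_finsetSum _ fun i _ => hi i]
    have h1 : ∀ i : Fin N, ∫ u, stepFn a b s (u i) ∂sampleMeasure a b N = s := fun i => by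
      have := integral_map (μ := sampleMeasure a b N) (hev i).measurable.aemeasurable
        (f := fun x => stepFn a b s x) (measurable_stepFn_right a b s).aestronglyMeasurable
      rw [(hev i).map_eq, integral_stepFn hab hs] at this
      exact this.symm
    simp only [h1]
    simp; field_simp
  have hmE : Measurable fun u : Fin N → ℝ => empCdf a b u s :=
    (measurable_empCdf a b).comp (by fun_prop : Measurable fun u : Fin N → ℝ => (s, u))
  have h2 : ∫ u, (empCdf a b u s - s) ^ 2 ∂sampleMeasure a b N =
      Var[fun u => empCdf a b u s; sampleMeasure a b N] := by
    rw [variance_eq_integral hmE.aemeasurable, hmean]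
  have h3 : (fun u : Fin N → ℝ => empCdf a b u s) =
      fun u => (N : ℝ)⁻¹ * (∑ i, fun u : Fin N → ℝ => stepFn a b s (u i)) u := by
    funext u; simp [empCdf]
  rw [h2, h3, variance_const_mul, hsum, Finset.sum_const, Finset.card_univ, Fintype.card_fin,
    nsmul_eq_mul]
  calc _ ≤ ((N : ℝ)⁻¹) ^ 2 * (N * 1) := by gcongr
    _ = _ := by field_simp

/-- The mean integrated squared error of the empirical distribution function. -/
lemma integral_empCdf_error_le {a b : ℝ} (hab : a < b) {N : ℕ} (hN : 0 < N) :
    Integrable (fun u => ∫ s in (0 : ℝ)..1, (empCdf a b u s - s) ^ 2) (sampleMeasure a b N) ∧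
    ∫ u, (∫ s in (0 : ℝ)..1, (empCdf a b u s - s) ^ 2) ∂sampleMeasure a b N ≤ (N : ℝ)⁻¹ := by
  have := isProbabilityMeasure_uniformIcc hab
  set lam : Measure ℝ := volume.restrict (Ioc 0 1) with hlam
  have hmeas : Measurable fun p : (Fin N → ℝ) × ℝ => (empCdf a b p.1 p.2 - p.2) ^ 2 :=
    (((measurable_empCdf a b).comp measurable_swap).sub measurable_snd).pow_const 2
  have hint : Integrable (Function.uncurry fun (u : Fin N → ℝ) s => (empCdf a b u s - s) ^ 2)
      ((sampleMeasure a b N).prod lam) := by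
    have h0 : Integrable (fun s : ℝ => (1 + |s|) ^ 2) lam :=
      (by fun_prop : Continuous fun s : ℝ => (1 + |s|) ^ 2).integrableOn_Ioc
    refine (h0.comp_snd (sampleMeasure a b N)).mono hmeas.aestronglyMeasurable
      (ae_of_all _ fun p => ?_)
    simp only [Function.uncurry, Real.norm_eq_abs, abs_pow]
    refine pow_le_pow_left₀ (abs_nonneg _) ?_ 2
    rw [abs_of_nonneg (by positivity : 0 ≤ 1 + |p.2|)]
    refine (abs_sub _ _).trans (add_le_add ?_ le_rfl)
    rw [abs_of_nonneg (empCdf_mem _ _).1]; exact (empCdf_mem _ _).2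
  simp only [intervalIntegral.integral_of_le zero_le_one]
  refine ⟨hint.integral_prod_left, ?_⟩
  rw [integral_integral_swap hint]
  calc _ ≤ ∫ _ in Ioc (0 : ℝ) 1, (N : ℝ)⁻¹ := by
        refine setIntegral_mono_on hint.integral_prod_right (integrable_const _)
          measurableSet_Ioc fun s hs => ?_
        exact integral_sq_empCdf_sub_le hab hN (Ioc_subset_Icc_self hs)
    _ = _ := by simp

section Influence

variable {a b : ℝ} {H ψ : ℝ → ℝ}

lemma integrable_influence_kernel (hH : ContDiff ℝ 1 H) (hψ : Continuous ψ)
    (μ : Measure ℝ) [IsFiniteMeasure μ] :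
    Integrable (fun p : ℝ × ℝ => deriv H p.2 * ψ p.2 * (stepFn a b p.2 p.1 - p.2))
      (μ.prod (volume.restrict (Ioc 0 1))) := by
  have hq : Continuous fun s => deriv H s * ψ s := (hH.continuous_deriv le_rfl).mul hψ
  have h1 : Integrable (fun s => deriv H s * ψ s) (volume.restrict (Ioc 0 1)) := hq.integrableOn_Ioc
  have h2 : Integrable (fun s => deriv H s * ψ s * s) (volume.restrict (Ioc 0 1)) :=
    (hq.mul continuous_id).integrableOn_Ioc
  have h3 : Integrable (fun p : ℝ × ℝ => deriv H p.2 * ψ p.2 * stepFn a b p.2 p.1)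
      (μ.prod (volume.restrict (Ioc 0 1))) :=
    (h1.comp_snd μ).mul_bdd (c := 1)
      ((measurable_stepFn a b).comp measurable_swap).aestronglyMeasurable
      (ae_of_all _ fun p => abs_stepFn_le _ _ _ _)
  refine (h3.sub (h2.comp_snd μ)).congr (ae_of_all _ fun p => ?_)
  simp only [Pi.sub_apply]; ring

lemma influence_eq (x : ℝ) : influence a b H ψ x =
    -∫ s in Ioc (0 : ℝ) 1, deriv H s * ψ s * (stepFn a b s x - s) := by
  rw [influence, intervalIntegral.integral_of_le zero_le_one]

lemma measurable_influence (hH : ContDiff ℝ 1 H) (hψ : Continuous ψ) :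
    Measurable (influence a b H ψ) := by
  have hq : Continuous fun s => deriv H s * ψ s := (hH.continuous_deriv le_rfl).mul hψ
  have h : Measurable fun p : ℝ × ℝ => deriv H p.2 * ψ p.2 * (stepFn a b p.2 p.1 - p.2) :=
    (hq.measurable.comp measurable_snd).mul
      (((measurable_stepFn a b).comp measurable_swap).sub measurable_snd)
  have h2 := (h.stronglyMeasurable.integral_prod_right' (ν := volume.restrict (Ioc (0 : ℝ) 1))).measurable
  simp only [funext (influence_eq (a := a) (b := b) (H := H) (ψ := ψ))]
  exact h2.neg

lemma exists_abs_influence_le (hH : ContDiff ℝ 1 H) (hψ : Continuous ψ) :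
    ∃ C : ℝ, 0 ≤ C ∧ ∀ x, |influence a b H ψ x| ≤ C := by
  have hq : Continuous fun s => |deriv H s * ψ s| * (1 + |s|) :=
    ((hH.continuous_deriv le_rfl).mul hψ).abs.mul (by fun_prop)
  refine ⟨∫ s in Ioc (0 : ℝ) 1, |deriv H s * ψ s| * (1 + |s|), integral_nonneg fun _ => by positivity,
    fun x => ?_⟩
  rw [influence_eq, abs_neg]
  have hqi : Integrable (fun s => |deriv H s * ψ s| * (1 + |s|)) (volume.restrict (Ioc (0 : ℝ) 1)) :=
    hq.integrableOn_Ioc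
  rw [← Real.norm_eq_abs]
  refine norm_integral_le_of_norm_le hqi (ae_of_all _ fun s => ?_)
  rw [Real.norm_eq_abs, abs_mul]
  gcongr
  exact (abs_sub _ _).trans (add_le_add (abs_stepFn_le _ _ _ _) le_rfl)

lemma memLp_influence (hH : ContDiff ℝ 1 H) (hψ : Continuous ψ) (p : ℝ≥0∞) (μ : Measure ℝ)
    [IsFiniteMeasure μ] : MemLp (influence a b H ψ) p μ := by
  obtain ⟨C, -, hC⟩ := exists_abs_influence_le (a := a) (b := b) hH hψ
  exact MemLp.of_bound (measurable_influence hH hψ).aestronglyMeasurable C (ae_of_all _ hC)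

lemma integral_influence (hab : a < b) (hH : ContDiff ℝ 1 H) (hψ : Continuous ψ) :
    ∫ x, influence a b H ψ x ∂uniformIcc a b = 0 := by
  have := isProbabilityMeasure_uniformIcc hab
  simp only [influence_eq]
  rw [integral_neg, integral_integral_swap (integrable_influence_kernel hH hψ _), neg_eq_zero]
  refine setIntegral_eq_zero_of_forall_eq_zero fun s hs => ?_
  have hi : Integrable (fun x => stepFn a b s x) (uniformIcc a b) :=
    (integrable_const (1 : ℝ)).mono (measurable_stepFn_right a b s).aestronglyMeasurable
      (ae_of_all _ fun x => by simpa using abs_stepFn_le a b s x)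
  rw [integral_const_mul, integral_sub hi (integrable_const _),
    integral_stepFn hab (Ioc_subset_Icc_self hs)]
  simp

/-- The variance of the influence function, in terms of the covariance `s ∧ t - s t` of the Brownian bridge. -/
lemma integral_influence_sq (hab : a < b) (hH : ContDiff ℝ 1 H) (hψ : Continuous ψ) :
    ∫ x, influence a b H ψ x ^ 2 ∂uniformIcc a b = ∫ s in (0 : ℝ)..1, ∫ t in (0 : ℝ)..1,
      (deriv H s * ψ s) * (deriv H t * ψ t) * (min s t - s * t) := by
  have := isProbabilityMeasure_uniformIcc hab
  set q : ℝ → ℝ := fun s => deriv H s * ψ s with hq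
  set J : ℝ → ℝ := fun x => ∫ s in Ioc (0 : ℝ) 1, q s * (stepFn a b s x - s) with hJ
  have hk := integrable_influence_kernel (a := a) (b := b) hH hψ (uniformIcc a b)
  have hJi : ∀ x, influence a b H ψ x = -J x := fun x => influence_eq x
  have hJm : Measurable J := by
    have := (measurable_influence (a := a) (b := b) hH hψ).neg
    convert! this using 1
    funext x; simp [hJi]
  obtain ⟨C, -, hC⟩ := exists_abs_influence_le (a := a) (b := b) hH hψ
  have hJb : ∀ x, |J x| ≤ C := fun x => by have := hC x; rwa [hJi, abs_neg] at this
  have h1 : ∀ x, influence a b H ψ x ^ 2 =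
      ∫ s in Ioc (0 : ℝ) 1, q s * (stepFn a b s x - s) * J x := fun x => by
    rw [hJi, neg_sq, sq, integral_mul_const]
  simp_rw [h1]
  rw [integral_integral_swap (f := fun x s => q s * (stepFn a b s x - s) * J x)
    (hk.mul_bdd (c := C) (hJm.comp measurable_fst).aestronglyMeasurable
      (ae_of_all _ fun p => hJb p.1)), intervalIntegral.integral_of_le zero_le_one]
  refine setIntegral_congr_fun measurableSet_Ioc fun s hs => ?_
  have h2 : ∀ x, q s * (stepFn a b s x - s) * J x =
      ∫ t in Ioc (0 : ℝ) 1, q t * (stepFn a b t x - t) * (q s * (stepFn a b s x - s)) := fun x => by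
    rw [integral_mul_const]; ring
  simp_rw [h2]
  rw [integral_integral_swap (f := fun x t => q t * (stepFn a b t x - t) * (q s * (stepFn a b s x - s)))
    (hk.mul_bdd (c := |q s| * (1 + |s|))
      (((measurable_stepFn_right a b s).comp measurable_fst).sub measurable_const |>.const_mul
        (q s)).aestronglyMeasurable
      (ae_of_all _ fun p => by
        rw [Real.norm_eq_abs, abs_mul]
        gcongr
        exact (abs_sub _ _).trans (add_le_add (abs_stepFn_le _ _ _ _) le_rfl))),
    intervalIntegral.integral_of_le zero_le_one]
  refine setIntegral_congr_fun measurableSet_Ioc fun t ht => ?_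
  have hs' := Ioc_subset_Icc_self hs
  have ht' := Ioc_subset_Icc_self ht
  have hi : ∀ r, Integrable (fun x => stepFn a b r x) (uniformIcc a b) := fun r =>
    (integrable_const (1 : ℝ)).mono (measurable_stepFn_right a b r).aestronglyMeasurable
      (ae_of_all _ fun x => by simpa using abs_stepFn_le a b r x)
  have hmin : ∀ x, stepFn a b s x * stepFn a b t x = stepFn a b (min s t) x := fun x => by
    have hba : 0 < b - a := sub_pos.2 hab
    have hr : ramp a b (min s t) = min (ramp a b s) (ramp a b t) := by
      have hmono : Monotone (ramp a b) := fun x y h => by unfold ramp; nlinarith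
      exact hmono.map_min
    unfold stepFn
    rw [hr]
    by_cases h1 : x ≤ ramp a b s <;> by_cases h2 : x ≤ ramp a b t <;> simp [h1, h2]
  have h3 : ∀ x, q t * (stepFn a b t x - t) * (q s * (stepFn a b s x - s)) =
      q s * q t * (stepFn a b (min s t) x - t * stepFn a b s x - s * stepFn a b t x + s * t) := fun x => by
    rw [← hmin]; ring
  simp_rw [h3]
  have hA : Integrable (fun x => stepFn a b (min s t) x - t * stepFn a b s x) (uniformIcc a b) :=
    (hi _).sub ((hi s).const_mul t)
  have hB : Integrable (fun x => stepFn a b (min s t) x - t * stepFn a b s x - s * stepFn a b t x)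
    (uniformIcc a b) := hA.sub ((hi t).const_mul s)
  rw [integral_const_mul, integral_add hB (integrable_const _), integral_sub hA ((hi t).const_mul s),
    integral_sub (hi _) ((hi s).const_mul t), integral_const_mul, integral_const_mul,
    integral_stepFn hab hs', integral_stepFn hab ht',
    integral_stepFn hab ⟨le_min hs'.1 ht'.1, (min_le_left _ _).trans hs'.2⟩]
  simp only [integral_const, probReal_univ, one_smul]
  ring

end Influence

/-- The characteristic function form of the central limit theorem for samples. -/
lemma tendsto_integral_cexp_sample {μ : Measure ℝ} [IsProbabilityMeasure μ] {Z : ℝ → ℝ}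
    (hZ : MemLp Z 2 μ) (hZm : Measurable Z) (h0 : ∫ x, Z x ∂μ = 0) (t : ℝ) :
    Tendsto (fun N : ℕ => ∫ u, Complex.exp ((t * ((√(N : ℝ))⁻¹ * ∑ i, Z (u i)) : ℝ) * Complex.I)
      ∂Measure.pi fun _ : Fin N => μ) atTop
      (𝓝 (Real.exp (-((∫ x, Z x ^ 2 ∂μ) * t ^ 2 / 2)) : ℂ)) := by
  have hprod : ∀ N : ℕ, ∫ u, Complex.exp ((t * ((√(N : ℝ))⁻¹ * ∑ i, Z (u i)) : ℝ) * Complex.I)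
      ∂(Measure.pi fun _ : Fin N => μ) = charFun (μ.map Z) ((√(N : ℝ))⁻¹ * t) ^ N := fun N => by
    rw [charFun_apply_real, integral_map hZm.aemeasurable (by fun_prop)]
    have := integral_fintype_prod_eq_pow (μ := μ) (ι := Fin N)
      fun x => Complex.exp (((√(N : ℝ))⁻¹ * t : ℝ) * Z x * Complex.I)
    rw [Fintype.card_fin] at this
    rw [← this]
    refine integral_congr_ae (ae_of_all _ fun u => ?_)
    beta_reduce
    rw [← Complex.exp_sum]
    congr 1
    push_cast
    rw [Finset.mul_sum, Finset.mul_sum, Finset.sum_mul]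
    exact Finset.sum_congr rfl fun i _ => by ring
  simp_rw [hprod]
  set v := ∫ x, Z x ^ 2 ∂μ with hv
  have hv0 : 0 ≤ v := integral_nonneg fun _ => sq_nonneg _
  rcases hv0.eq_or_lt with h | h
  · have hZ0 : Z =ᵐ[μ] 0 := by
      have := (integral_eq_zero_iff_of_nonneg (fun _ => sq_nonneg _) hZ.integrable_sq).1 (hv ▸ h.symm)
      filter_upwards [this] with x hx
      simpa using hx
    have h1 : ∀ r, charFun (μ.map Z) r = 1 := fun r => by
      rw [Measure.map_congr hZ0, Pi.zero_def, Measure.map_const, measure_univ, one_smul, charFun_dirac]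
      simp
    simp [h1, ← h]
  · set c := √v with hc
    have hc0 : 0 < c := Real.sqrt_pos.2 h
    have hcc : c ^ 2 = v := Real.sq_sqrt hv0
    have hm : AEMeasurable (fun x => c⁻¹ * Z x) μ := (hZm.const_mul _).aemeasurable
    have := tendsto_charFun_inv_sqrt_mul_pow (P := μ) (X := fun x => c⁻¹ * Z x) hm
      (by rw [integral_const_mul, h0, mul_zero])
      (by
        simp only [Pi.pow_apply, mul_pow]
        rw [integral_const_mul, ← hv, ← hcc]
        field_simp) (c * t)
    have e1 : ∀ n : ℕ, charFun (μ.map fun x => c⁻¹ * Z x) ((√(n : ℝ))⁻¹ * (c * t)) =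
        charFun (μ.map Z) ((√(n : ℝ))⁻¹ * t) := fun n => by
      rw [charFun_map_mul_comp hZm.aemeasurable]
      congr 1
      field_simp
    simp_rw [e1] at this
    convert! this using 2
    push_cast
    rw [← hcc]
    push_cast
    congr 1
    ring

/-! ### Window averages over the order statistics of a uniform sample -/

/-- The weighted average of `F` over the windows of length `K` of `θ`. -/
noncomputable def windowAverage {K N : ℕ} (F : (Fin K → ℝ) → ℝ) (w : ℕ → ℝ) (θ : Fin N → ℝ) : ℝ :=
  (N : ℝ)⁻¹ * ∑ n : Fin (N + 1 - K), w n * F (window n (by omega) θ)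

lemma measurable_window {K N : ℕ} (n : ℕ) (h : n + K ≤ N) :
    Measurable (window (α := ℝ) (K := K) (N := N) n h) :=
  measurable_pi_lambda _ fun _ => measurable_pi_apply _

lemma measurable_windowAverage {K N : ℕ} {F : (Fin K → ℝ) → ℝ} (hF : Measurable F) (w : ℕ → ℝ) :
    Measurable (windowAverage (N := N) F w) := by
  refine (Finset.measurable_sum _ fun (n : Fin (N + 1 - K)) _ => ?_).const_mul _
  exact (hF.comp (measurable_window n (by omega))).const_mul _

/-- The average influence of a sample. -/
noncomputable def meanInfluence (a b : ℝ) (H ψ : ℝ → ℝ) {N : ℕ} (u : Fin N → ℝ) : ℝ :=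
  (N : ℝ)⁻¹ * ∑ i, influence a b H ψ (u i)

section Sample

variable {a b : ℝ} {H ψ : ℝ → ℝ}

lemma memLp_meanInfluence (hab : a < b) (hH : ContDiff ℝ 1 H) (hψ : Continuous ψ) (N : ℕ) :
    MemLp (meanInfluence a b H ψ) 2 (sampleMeasure a b N) := by
  have := isProbabilityMeasure_uniformIcc hab
  have h : ∀ i, MemLp (fun u : Fin N → ℝ => influence a b H ψ (u i)) 2 (sampleMeasure a b N) :=
    fun i => (memLp_influence hH hψ 2 (uniformIcc a b)).comp_measurePreserving
      (measurePreserving_eval (fun _ : Fin N => uniformIcc a b) i)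
  exact (memLp_finsetSum Finset.univ fun i _ => h i).const_mul _

lemma integral_meanInfluence (hab : a < b) (hH : ContDiff ℝ 1 H) (hψ : Continuous ψ) (N : ℕ) :
    ∫ u, meanInfluence a b H ψ u ∂sampleMeasure a b N = 0 := by
  have := isProbabilityMeasure_uniformIcc hab
  have hev := fun i => measurePreserving_eval (fun _ : Fin N => uniformIcc a b) i
  have hi : ∀ i : Fin N, Integrable (fun u : Fin N → ℝ => influence a b H ψ (u i))
      (sampleMeasure a b N) := fun i =>
    (hev i).integrable_comp_of_integrable ((memLp_influence hH hψ 2 _).integrable one_le_two)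
  simp only [meanInfluence]
  rw [integral_const_mul, integral_finsetSum _ fun i _ => hi i, Finset.sum_eq_zero fun i _ => ?_,
    mul_zero]
  have := integral_map (μ := sampleMeasure a b N) (hev i).measurable.aemeasurable
    (f := influence a b H ψ) (measurable_influence hH hψ).aestronglyMeasurable
  rw [(hev i).map_eq, integral_influence hab hH hψ] at this
  exact this.symm

lemma exists_integral_abs_meanInfluence_le (hab : a < b) (hH : ContDiff ℝ 1 H) (hψ : Continuous ψ) :
    ∃ C : ℝ, 0 ≤ C ∧ ∀ N : ℕ, 0 < N →
      ∫ u, |meanInfluence a b H ψ u| ∂sampleMeasure a b N ≤ C * (√(N : ℝ))⁻¹ := by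
  have := isProbabilityMeasure_uniformIcc hab
  refine ⟨√(Var[influence a b H ψ; uniformIcc a b]), Real.sqrt_nonneg _, fun N hN => ?_⟩
  have hNpos : (0 : ℝ) < N := by exact_mod_cast hN
  have h := integral_abs_sub_integral_le_sqrt_variance (memLp_meanInfluence hab hH hψ N)
  rw [integral_meanInfluence hab hH hψ] at h
  simp only [sub_zero] at h
  refine h.trans (le_of_eq ?_)
  have hsum := variance_sum_pi (μ := fun _ : Fin N => uniformIcc a b)
    (X := fun _ => influence a b H ψ) fun _ => memLp_influence hH hψ 2 _
  have e : meanInfluence a b H ψ = fun u : Fin N → ℝ =>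
      (N : ℝ)⁻¹ * (∑ i, fun u : Fin N → ℝ => influence a b H ψ (u i)) u := by
    funext u; simp [meanInfluence]
  rw [e, variance_const_mul, hsum, Finset.sum_const, Finset.card_univ, Fintype.card_fin, nsmul_eq_mul,
    ← Real.sqrt_inv, ← Real.sqrt_mul (variance_nonneg _ _)]
  congr 1
  field_simp

/-- Expansion of window averages of the order statistics in mean. -/
lemma exists_integral_abs_windowAverage_sub_le (hab : a < b) {K : ℕ} (hK : 1 ≤ K)
    {F : (Fin K → ℝ) → ℝ} (hFm : Measurable F) (hH : ContDiff ℝ 1 H) (hψ : ContDiff ℝ 1 ψ) {Λ A : ℝ}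
    (hΛ : 0 ≤ Λ) (hA : 0 ≤ A)
    (hF : ∀ θ θ' : Fin K → ℝ, (∀ i, θ i ∈ Icc a b) → (∀ i, θ' i ∈ Icc a b) →
      |F θ - F θ'| ≤ Λ * ∑ i, |θ i - θ' i|)
    (hFH : ∀ y ∈ Icc a b, F (fun _ => y) = H ((y - a) / (b - a))) :
    ∃ C : ℝ, 0 ≤ C ∧ ∀ N : ℕ, 0 < N → ∀ w : ℕ → ℝ,
      (∀ n < N, |w n - ψ ((n : ℝ) / (N + 1))| ≤ A / N) →
      Integrable (fun u : Fin N → ℝ => windowAverage F w (orderStatistics u)) (sampleMeasure a b N) ∧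
      ∫ u, |windowAverage F w (orderStatistics u) - (∫ s in (0 : ℝ)..1, H s * ψ s) -
        meanInfluence a b H ψ u| ∂sampleMeasure a b N ≤ C * (N : ℝ)⁻¹ := by
  have := isProbabilityMeasure_uniformIcc hab
  obtain ⟨C, hC0, hC⟩ := exists_abs_windowAverage_sub_le hab hK hH hψ hΛ hA hF hFH
  refine ⟨C * 2, by positivity, fun N hN w hw => ?_⟩
  obtain ⟨hQi, hQ⟩ := integral_empCdf_error_le hab hN
  have hae : ∀ᵐ u ∂sampleMeasure a b N, |windowAverage F w (orderStatistics u) -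
      (∫ s in (0 : ℝ)..1, H s * ψ s) - meanInfluence a b H ψ u| ≤
      C * ((N : ℝ)⁻¹ + ∫ s in (0 : ℝ)..1, (empCdf a b u s - s) ^ 2) := by
    filter_upwards [ae_mem_Icc_sampleMeasure hab N] with u hu
    exact hC N hN w hw u hu
  have hdom : Integrable (fun u => C * ((N : ℝ)⁻¹ + ∫ s in (0 : ℝ)..1, (empCdf a b u s - s) ^ 2))
      (sampleMeasure a b N) := ((integrable_const _).add hQi).const_mul _
  have hM := memLp_meanInfluence hab hH hψ.continuous N
  have hm : Measurable fun u : Fin N → ℝ => windowAverage F w (orderStatistics u) :=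
    (measurable_windowAverage hFm w).comp measurable_orderStatistics
  constructor
  · have h1 : Integrable (fun u : Fin N → ℝ => windowAverage F w (orderStatistics u) -
        (∫ s in (0 : ℝ)..1, H s * ψ s) - meanInfluence a b H ψ u) (sampleMeasure a b N) :=
      hdom.mono' ((hm.sub_const _).aestronglyMeasurable.sub hM.1) hae
    have h2 := (h1.add (hM.integrable one_le_two)).add (integrable_const (∫ s in (0 : ℝ)..1, H s * ψ s))
    refine h2.congr (ae_of_all _ fun u => ?_)
    simp
  · refine (integral_mono_of_nonneg (ae_of_all _ fun _ => abs_nonneg _) hdom hae).trans ?_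
    rw [integral_const_mul, integral_add (integrable_const _) hQi]
    simp only [integral_const, probReal_univ, one_smul]
    rw [mul_assoc]
    gcongr
    linarith

lemma ae_mem_Icc_mixtureMeasure (hab : a < b) (N : ℕ) :
    ∀ᵐ θ ∂mixtureMeasure a b N, ∀ i, θ i ∈ Icc a b := by
  refine (ae_map_iff measurable_orderStatistics.aemeasurable ?_).2 ?_
  · simp only [ofPred_forall]
    exact MeasurableSet.iInter fun i => measurable_pi_apply i measurableSet_Icc
  · filter_upwards [ae_mem_Icc_sampleMeasure hab N] with u hu i
    exact hu _

lemma isProbabilityMeasure_mixtureMeasure (hab : a < b) (N : ℕ) :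
    IsProbabilityMeasure (mixtureMeasure a b N) := by
  have := isProbabilityMeasure_uniformIcc hab
  exact Measure.isProbabilityMeasure_map measurable_orderStatistics.aemeasurable

/-- Law of large numbers and linearization of the centred fluctuations, for window averages under the mixture
measure. -/
lemma exists_windowAverage_bounds (hab : a < b) {K : ℕ} (hK : 1 ≤ K)
    {F : (Fin K → ℝ) → ℝ} (hFm : Measurable F) (hH : ContDiff ℝ 1 H) (hψ : ContDiff ℝ 1 ψ) {Λ A : ℝ}
    (hΛ : 0 ≤ Λ) (hA : 0 ≤ A)
    (hF : ∀ θ θ' : Fin K → ℝ, (∀ i, θ i ∈ Icc a b) → (∀ i, θ' i ∈ Icc a b) →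
      |F θ - F θ'| ≤ Λ * ∑ i, |θ i - θ' i|)
    (hFH : ∀ y ∈ Icc a b, F (fun _ => y) = H ((y - a) / (b - a))) :
    ∃ C : ℝ, 0 ≤ C ∧ ∀ N : ℕ, 0 < N → ∀ w : ℕ → ℝ,
      (∀ n < N, |w n - ψ ((n : ℝ) / (N + 1))| ≤ A / N) →
      Integrable (windowAverage (N := N) F w) (mixtureMeasure a b N) ∧
      ∫ θ, |windowAverage F w θ - ∫ s in (0 : ℝ)..1, H s * ψ s| ∂mixtureMeasure a b N ≤
        C * (√(N : ℝ))⁻¹ ∧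
      ∫ u, |√(N : ℝ) * (windowAverage F w (orderStatistics u) -
          ∫ θ, windowAverage F w θ ∂mixtureMeasure a b N) -
        (√(N : ℝ))⁻¹ * ∑ i, influence a b H ψ (u i)| ∂sampleMeasure a b N ≤ C * (√(N : ℝ))⁻¹ := by
  have := isProbabilityMeasure_uniformIcc hab
  obtain ⟨C₁, hC₁, h₁⟩ := exists_integral_abs_windowAverage_sub_le hab hK hFm hH hψ hΛ hA hF hFH
  obtain ⟨C₂, hC₂, h₂⟩ := exists_integral_abs_meanInfluence_le hab hH hψ.continuous
  refine ⟨2 * C₁ + C₂, by positivity, fun N hN w hw => ?_⟩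
  have hNpos : (0 : ℝ) < N := by exact_mod_cast hN
  have hN1 : (1 : ℝ) ≤ N := by exact_mod_cast hN
  have hs : 0 < √(N : ℝ) := Real.sqrt_pos.2 hNpos
  have hss : √(N : ℝ) * √(N : ℝ) = N := Real.mul_self_sqrt hNpos.le
  have hs1 : 1 ≤ √(N : ℝ) := Real.one_le_sqrt.2 hN1
  have hle : (N : ℝ)⁻¹ ≤ (√(N : ℝ))⁻¹ := by
    rw [show (N : ℝ)⁻¹ = (√(N : ℝ))⁻¹ * (√(N : ℝ))⁻¹ by rw [← mul_inv, hss]]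
    exact mul_le_of_le_one_right (inv_nonneg.2 hs.le) (inv_le_one_of_one_le₀ hs1)
  obtain ⟨hi, hb⟩ := h₁ N hN w hw
  have hM := memLp_meanInfluence hab hH hψ.continuous N
  have hMi := hM.integrable one_le_two
  set I := ∫ s in (0 : ℝ)..1, H s * ψ s with hI
  have hm := measurable_windowAverage (N := N) hFm w
  have hR : Integrable (fun u : Fin N → ℝ => windowAverage F w (orderStatistics u) - I -
      meanInfluence a b H ψ u) (sampleMeasure a b N) := (hi.sub (integrable_const _)).sub hMi
  have hmean : ∫ θ, windowAverage F w θ ∂mixtureMeasure a b N =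
      ∫ u, windowAverage F w (orderStatistics u) ∂sampleMeasure a b N :=
    integral_map measurable_orderStatistics.aemeasurable hm.aestronglyMeasurable
  refine ⟨(integrable_map_measure hm.aestronglyMeasurable
    measurable_orderStatistics.aemeasurable).2 hi, ?_, ?_⟩
  · have e : ∫ θ, |windowAverage F w θ - I| ∂mixtureMeasure a b N =
        ∫ u, |windowAverage F w (orderStatistics u) - I| ∂sampleMeasure a b N :=
      integral_map measurable_orderStatistics.aemeasurable
        (hm.sub_const I).abs.aestronglyMeasurable
    rw [e]
    calc _ ≤ ∫ u, (|windowAverage F w (orderStatistics u) - I - meanInfluence a b H ψ u| +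
          |meanInfluence a b H ψ u|) ∂sampleMeasure a b N := by
          refine integral_mono (hi.sub (integrable_const _)).abs (hR.abs.add hMi.abs) fun u => ?_
          have := abs_add_le (windowAverage F w (orderStatistics u) - I - meanInfluence a b H ψ u)
            (meanInfluence a b H ψ u)
          simpa using this
      _ ≤ C₁ * (N : ℝ)⁻¹ + C₂ * (√(N : ℝ))⁻¹ := by
          rw [integral_add hR.abs hMi.abs]
          exact add_le_add hb (h₂ N hN)
      _ ≤ C₁ * (√(N : ℝ))⁻¹ + C₂ * (√(N : ℝ))⁻¹ := by gcongr
      _ ≤ _ := by nlinarith [mul_nonneg hC₁ (inv_nonneg.2 hs.le)]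
  · -- the mean of the linear statistic is `I`, up to the mean of the remainder
    have hRm : ∫ u, (windowAverage F w (orderStatistics u) - I - meanInfluence a b H ψ u)
        ∂sampleMeasure a b N = (∫ θ, windowAverage F w θ ∂mixtureMeasure a b N) - I := by
      have hA : Integrable (fun u : Fin N → ℝ => windowAverage F w (orderStatistics u) - I)
          (sampleMeasure a b N) := hi.sub (integrable_const _)
      rw [integral_sub hA hMi, integral_sub hi (integrable_const _),
        integral_meanInfluence hab hH hψ.continuous, hmean]
      simp
    set m := ∫ θ, windowAverage F w θ ∂mixtureMeasure a b N with hmdef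
    have hmI : |m - I| ≤ C₁ * (N : ℝ)⁻¹ := by
      rw [← hRm]; exact abs_integral_le_integral_abs.trans hb
    have hpt : ∀ u : Fin N → ℝ, |√(N : ℝ) * (windowAverage F w (orderStatistics u) - m) -
        (√(N : ℝ))⁻¹ * ∑ i, influence a b H ψ (u i)| ≤
        √(N : ℝ) * (|windowAverage F w (orderStatistics u) - I - meanInfluence a b H ψ u| +
          |m - I|) := fun u => by
      have e1 : (√(N : ℝ))⁻¹ * ∑ i, influence a b H ψ (u i) = √(N : ℝ) * meanInfluence a b H ψ u := by
        rw [meanInfluence]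
        nth_rewrite 3 [← hss]
        field_simp
      rw [e1, ← mul_sub, abs_mul, abs_of_pos hs]
      gcongr
      have := abs_sub (windowAverage F w (orderStatistics u) - I - meanInfluence a b H ψ u) (m - I)
      refine le_trans (le_of_eq ?_) this
      congr 1; ring
    refine (integral_mono_of_nonneg (ae_of_all _ fun _ => abs_nonneg _)
      ((hR.abs.add (integrable_const _)).const_mul _) (ae_of_all _ hpt)).trans ?_
    rw [integral_const_mul]
    simp only [Pi.add_apply]
    rw [integral_add hR.abs (integrable_const _)]
    simp only [integral_const, probReal_univ, one_smul]
    calc _ ≤ √(N : ℝ) * (C₁ * (N : ℝ)⁻¹ + C₁ * (N : ℝ)⁻¹) := by gcongr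
      _ = 2 * C₁ * (√(N : ℝ))⁻¹ := by
          nth_rewrite 2 3 [← hss]
          field_simp; ring
      _ ≤ _ := by
          gcongr; linarith

end Sample

/-! ### Covariances of shifted local functions -/

/-- The product measures as a Markov kernel in the parameters. -/
noncomputable def geomKernel (N : ℕ) : Kernel (Fin N → ℝ) (Fin N → ℕ) :=
  ⟨geomProd, measurable_geomProd⟩

instance (N : ℕ) : IsMarkovKernel (geomKernel N) :=
  ⟨fun θ => inferInstanceAs (IsProbabilityMeasure (geomProd θ))⟩

lemma stronglyMeasurable_integral_geomProd {E : Type*} [NormedAddCommGroup E] [NormedSpace ℝ E]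
    {K : ℕ} {f : (Fin K → ℕ) → E} (hf : StronglyMeasurable f) :
    StronglyMeasurable fun θ : Fin K → ℝ => ∫ η, f η ∂geomProd θ :=
  hf.integral_kernel (κ := geomKernel K)

lemma measurable_integral_geomProd {K : ℕ} (f : (Fin K → ℕ) → ℝ) :
    Measurable fun θ : Fin K → ℝ => ∫ η, f η ∂geomProd θ :=
  (stronglyMeasurable_integral_geomProd (measurable_of_countable f).stronglyMeasurable).measurable

/-- The covariance of `g` and of its translate by `d`, as a function of the parameters. -/
noncomputable def pairCov {k : ℕ} (g : (Fin k → ℕ) → ℝ) (d : ℕ) (θ : Fin (k + d) → ℝ) : ℝ :=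
  (∫ η, shift g 0 (by omega) η * shift g d (by omega) η ∂geomProd θ) -
    (∫ η, shift g 0 (by omega) η ∂geomProd θ) * ∫ η, shift g d (by omega) η ∂geomProd θ

section PairCov

variable {k : ℕ} {g : (Fin k → ℕ) → ℝ} {b : ℝ}

lemma measurable_pairCov (d : ℕ) : Measurable (pairCov g d) :=
  (measurable_integral_geomProd _).sub
    ((measurable_integral_geomProd _).mul (measurable_integral_geomProd _))

lemma memLp_shift_geomProd (hb : 0 < b) (hg : MemLp g 4 (geomRef b k)) {N n : ℕ} {θ : Fin N → ℝ}
    (hθ : ∀ i, θ i ∈ Icc 0 b) (h : n + k ≤ N) : MemLp (shift g n h) 4 (geomProd θ) :=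
  memLp_shift (memLp_geomProd hb (fun _ => hθ _) hg)

lemma memLp_shift_mul_shift (hb : 0 < b) (hg : MemLp g 4 (geomRef b k)) {N n m : ℕ} {θ : Fin N → ℝ}
    (hθ : ∀ i, θ i ∈ Icc 0 b) (h : n + k ≤ N) (h' : m + k ≤ N) :
    MemLp (fun η => shift g n h η * shift g m h' η) 2 (geomProd θ) := by
  have : ENNReal.HolderTriple 4 4 2 := ⟨by
    rw [← two_mul, show (4 : ℝ≥0∞) = 2 * 2 by norm_num,
      ENNReal.mul_inv (Or.inl (by simp)) (Or.inl (by simp)), ← mul_assoc,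
      ENNReal.mul_inv_cancel (by simp) (by simp), one_mul]⟩
  exact MemLp.mul (memLp_shift_geomProd hb hg hθ h') (memLp_shift_geomProd hb hg hθ h)

lemma covariance_shift_eq_pairCov (hb : 0 < b) (hg : MemLp g 4 (geomRef b k)) {N n d : ℕ}
    {θ : Fin N → ℝ} (hθ : ∀ i, θ i ∈ Icc 0 b) (h : n + k ≤ N) (h' : n + d + k ≤ N) :
    cov[shift g n h, shift g (n + d) h'; geomProd θ] =
      pairCov g d (window n (by omega) θ) := by
  have hw : n + (k + d) ≤ N := by omega
  have hθ' : ∀ i, window n hw θ i ∈ Icc 0 b := fun i => hθ _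
  have h1 : shift g n h = shift g 0 (by omega : 0 + k ≤ k + d) ∘ window n hw := by
    funext η
    simp only [shift, Function.comp_apply, window, zero_add]
  have h2 : shift g (n + d) h' = shift g d (by omega : d + k ≤ k + d) ∘ window n hw := by
    funext η
    simp only [shift, Function.comp_apply, window, add_assoc]
  have hm : AEMeasurable (window n hw : (Fin N → ℕ) → _) (geomProd θ) :=
    (measurable_of_countable _).aemeasurable
  rw [h1, h2, ← covariance_map (measurable_of_countable _).aestronglyMeasurable
    (measurable_of_countable _).aestronglyMeasurable hm, geomProd_map_window,
    covariance_eq_sub ((memLp_shift_geomProd hb hg hθ' _).mono_exponent (by norm_num))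
      ((memLp_shift_geomProd hb hg hθ' _).mono_exponent (by norm_num))]
  rfl

lemma exists_lipschitz_pairCov (hb : 0 < b) (hg : MemLp g 4 (geomRef b k)) (d : ℕ) :
    ∃ L : ℝ, 0 ≤ L ∧ ∀ θ θ' : Fin (k + d) → ℝ, (∀ i, θ i ∈ Icc 0 b) → (∀ i, θ' i ∈ Icc 0 b) →
      |pairCov g d θ - pairCov g d θ'| ≤ L * ∑ i, |θ i - θ' i| := by
  have hbb : ∀ _ : Fin (k + d), b ∈ Icc 0 b := fun _ => right_mem_Icc.2 hb.le
  have h0 : 0 + k ≤ k + d := by omega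
  have hd : d + k ≤ k + d := by omega
  have hm0 := memLp_shift_geomProd hb hg hbb h0
  have hmd := memLp_shift_geomProd hb hg hbb hd
  obtain ⟨L₁, hL₁, h₁⟩ := exists_lipschitz_integral_geomProd hb (memLp_shift_mul_shift hb hg hbb h0 hd)
  obtain ⟨L₂, hL₂, h₂⟩ := exists_lipschitz_integral_geomProd hb (hm0.mono_exponent (q := 4) (p := 2) (by norm_num))
  obtain ⟨L₃, hL₃, h₃⟩ := exists_lipschitz_integral_geomProd hb (hmd.mono_exponent (q := 4) (p := 2) (by norm_num))
  have hbd : ∀ f : (Fin (k + d) → ℕ) → ℝ, Integrable f (geomRef b (k + d)) →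
      ∀ θ : Fin (k + d) → ℝ, (∀ i, θ i ∈ Icc 0 b) →
      |∫ η, f η ∂geomProd θ| ≤ (1 + b) ^ (k + d) * ∫ η, |f η| ∂geomRef b (k + d) :=
    fun f hf θ hθ => abs_integral_le_integral_abs.trans
      (integral_geomProd_le hb hθ (fun _ => abs_nonneg _) hf.abs)
  have hb0 := hbd _ (hm0.integrable (by norm_num))
  have hbd' := hbd _ (hmd.integrable (by norm_num))
  set B₀ := (1 + b) ^ (k + d) * ∫ η, |shift g 0 h0 η| ∂geomRef b (k + d)
  set B₁ := (1 + b) ^ (k + d) * ∫ η, |shift g d hd η| ∂geomRef b (k + d)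
  have hB₀ : 0 ≤ B₀ := (abs_nonneg _).trans (hb0 _ hbb)
  have hB₁ : 0 ≤ B₁ := (abs_nonneg _).trans (hbd' _ hbb)
  refine ⟨L₁ + (L₂ * B₁ + B₀ * L₃), by positivity, fun θ θ' hθ hθ' => ?_⟩
  unfold pairCov
  have i1 := h₁ θ θ' hθ hθ'
  have i2 := h₂ θ θ' hθ hθ'
  have i3 := h₃ θ θ' hθ hθ'
  have j2 := hb0 θ' hθ'
  have j3 := hbd' θ hθ
  set x := ∫ η, shift g 0 h0 η ∂geomProd θ
  set x' := ∫ η, shift g 0 h0 η ∂geomProd θ'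
  set y := ∫ η, shift g d hd η ∂geomProd θ
  set y' := ∫ η, shift g d hd η ∂geomProd θ'
  set z := ∫ η, shift g 0 h0 η * shift g d hd η ∂geomProd θ
  set z' := ∫ η, shift g 0 h0 η * shift g d hd η ∂geomProd θ'
  set D := ∑ i, |θ i - θ' i|
  calc |z - x * y - (z' - x' * y')| = |(z - z') - ((x - x') * y + x' * (y - y'))| := by
        congr 1; ring
    _ ≤ |z - z'| + (|x - x'| * |y| + |x'| * |y - y'|) := by
        rw [← abs_mul, ← abs_mul]
        exact (abs_sub _ _).trans (add_le_add_right (abs_add_le _ _) _)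
    _ ≤ L₁ * D + (L₂ * D * B₁ + B₀ * (L₃ * D)) := by gcongr
    _ = _ := by ring

/-- For equal parameters, the covariances are continuously differentiable in the parameter. -/
lemma exists_contDiff_pairCov {a : ℝ} (ha : 0 ≤ a) (hab : a < b) (hg : MemLp g 4 (geomRef b k))
    (d : ℕ) : ∃ F : ℝ → ℝ, ContDiff ℝ 1 F ∧ EqOn (fun y => pairCov g d fun _ => y) F (Icc a b) := by
  have hb : 0 < b := ha.trans_lt hab
  have hbb : ∀ _ : Fin (k + d), b ∈ Icc 0 b := fun _ => right_mem_Icc.2 hb.le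
  have h0 : 0 + k ≤ k + d := by omega
  have hd : d + k ≤ k + d := by omega
  obtain ⟨F₁, hF₁, e₁⟩ := exists_contDiff_localMean ha hab (memLp_shift_mul_shift hb hg hbb h0 hd)
  obtain ⟨F₂, hF₂, e₂⟩ := exists_contDiff_localMean ha hab
    ((memLp_shift_geomProd hb hg hbb h0).mono_exponent (q := 4) (p := 2) (by norm_num))
  obtain ⟨F₃, hF₃, e₃⟩ := exists_contDiff_localMean ha hab
    ((memLp_shift_geomProd hb hg hbb hd).mono_exponent (q := 4) (p := 2) (by norm_num))
  refine ⟨fun y => F₁ y - F₂ y * F₃ y, hF₁.sub (hF₂.mul hF₃), fun y hy => ?_⟩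
  simp only [← e₁ hy, ← e₂ hy, ← e₃ hy]
  rfl

end PairCov

/-! ### The conditional variance -/

/-- The distance of `e` from the midpoint `k - 1` of `{0, …, 2k - 2}`. -/
def offset (k e : ℕ) : ℕ := (e - (k - 1)) + ((k - 1) - e)

/-- Summation over pairs at distance less than `k`, arranged by the signed difference. -/
lemma sum_rangeNb_eq {M k : ℕ} {A : ℕ → ℕ → ℝ} (hA : ∀ i j, A i j = A j i) :
    ∑ i : Fin M, ∑ j ∈ rangeNb M k i, A i j =
      ∑ e : Fin (2 * k - 1), ∑ n : Fin (M - offset k e), A n (n + offset k e) := by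
  have h1 : ∀ i : Fin M, ∑ j ∈ rangeNb M k i, A i j =
      ∑ j ∈ Finset.range M with ((i : ℕ) < j + k ∧ j < i + k), A i j := fun i => by
    rw [rangeNb, Finset.sum_filter, Finset.sum_filter]
    exact Fin.sum_univ_eq_sum_range (fun j => if (i : ℕ) < j + k ∧ j < i + k then A i j else 0) M
  have h2 : ∀ e : Fin (2 * k - 1), ∑ n : Fin (M - offset k e), A n (n + offset k e) =
      ∑ n ∈ Finset.range (M - offset k e), A n (n + offset k e) := fun e =>
    Fin.sum_univ_eq_sum_range (fun n => A n (n + offset k e)) _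
  simp_rw [h1, h2]
  rw [Fin.sum_univ_eq_sum_range (fun i => ∑ j ∈ Finset.range M with (i < j + k ∧ j < i + k), A i j),
    Fin.sum_univ_eq_sum_range (fun e => ∑ n ∈ Finset.range (M - offset k e), A n (n + offset k e)),
    Finset.sum_sigma', Finset.sum_sigma']
  refine Finset.sum_bij' (fun p _ => ⟨p.2 + (k - 1) - p.1, min p.1 p.2⟩)
    (fun q _ => if k - 1 ≤ q.1 then ⟨q.2, q.2 + offset k q.1⟩ else ⟨q.2 + offset k q.1, q.2⟩)
    ?_ ?_ ?_ ?_ ?_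
  · rintro ⟨i, j⟩ h
    simp only [Finset.mem_sigma, Finset.mem_range, Finset.mem_filter, offset] at h ⊢
    omega
  · rintro ⟨e, n⟩ h
    simp only [Finset.mem_sigma, Finset.mem_range, offset] at h ⊢
    split_ifs <;> simp only [Finset.mem_range, Finset.mem_filter] <;> omega
  · rintro ⟨i, j⟩ h
    simp only [Finset.mem_sigma, Finset.mem_range, Finset.mem_filter, offset] at h ⊢
    split_ifs <;> simp only [Sigma.mk.injEq, heq_eq_eq] <;> omega
  · rintro ⟨e, n⟩ h
    simp only [Finset.mem_sigma, Finset.mem_range, offset] at h ⊢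
    split_ifs <;> simp only [Sigma.mk.injEq, heq_eq_eq] <;> omega
  · rintro ⟨i, j⟩ h
    simp only [Finset.mem_sigma, Finset.mem_range, Finset.mem_filter, offset] at h ⊢
    rcases le_total i j with hij | hij
    · congr 1 <;> omega
    · rw [hA]
      congr 1 <;> omega

section CondVariance

variable {k : ℕ} {g : (Fin k → ℕ) → ℝ} {b : ℝ}

lemma covariance_shift_shift_eq (hb : 0 < b) (hg : MemLp g 4 (geomRef b k)) {N : ℕ}
    {θ : Fin N → ℝ} (hθ : ∀ i, θ i ∈ Icc 0 b) {m n d : ℕ} (hm : m + k ≤ N) (hn : n + k ≤ N)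
    (h : min m n + d = max m n) :
    cov[shift g m hm, shift g n hn; geomProd θ] = pairCov g d (window (min m n) (by omega) θ) := by
  rcases le_total m n with hmn | hmn
  · obtain rfl : m + d = n := by omega
    rw [covariance_shift_eq_pairCov hb hg hθ]
    congr 1; funext i; unfold window; congr 2; omega
  · obtain rfl : n + d = m := by omega
    rw [covariance_comm, covariance_shift_eq_pairCov hb hg hθ]
    congr 1; funext i; unfold window; congr 2; omega

lemma localVariance_eq_sum {θ : ℝ} (hb : 0 < b) (hg : MemLp g 4 (geomRef b k)) (hθ : θ ∈ Icc 0 b) :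
    localVariance g θ = ∑ e : Fin (2 * k - 1), pairCov g (offset k e) fun _ => θ := by
  refine Finset.sum_congr rfl fun m _ => ?_
  rw [covariance_shift_shift_eq hb hg (fun _ => hθ) (d := offset k m) _ _
    (by simp only [offset]; omega)]
  rfl

/-- The conditional variance of the field as a sum of window averages of covariances. -/
lemma integral_localSquare_centred_eq (hb : 0 < b) (hg : MemLp g 4 (geomRef b k)) {N : ℕ} (c : ℕ → ℝ)
    {θ : Fin N → ℝ} (hθ : ∀ i, θ i ∈ Icc 0 b) :
    (N : ℝ)⁻¹ * ∫ η, localSquare (centred g c θ) (rangeNb (N + 1 - k) k) η ∂geomProd θ =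
      ∑ e : Fin (2 * k - 1), windowAverage (pairCov g (offset k e))
        (fun n => c n * c (n + offset k e)) θ := by
  let A : ℕ → ℕ → ℝ := fun i j => if h : i + k ≤ N ∧ j + k ≤ N then
    c i * c j * cov[shift g i h.1, shift g j h.2; geomProd θ] else 0
  have hA : ∀ i j, A i j = A j i := fun i j => by
    simp only [A]
    by_cases h : i + k ≤ N ∧ j + k ≤ N
    · rw [dif_pos h, dif_pos h.symm, covariance_comm, mul_comm (c i)]
    · rw [dif_neg h, dif_neg fun h' => h h'.symm]
  have hmem := fun n => memLp_centred (c := c) hb hg hθ n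
  have hint : ∀ i j, Integrable (fun η => centred g c θ i η * centred g c θ j η) (geomProd θ) :=
    fun i j => ((hmem i).mono_exponent (p := 2) (by norm_num)).integrable_mul
      ((hmem j).mono_exponent (p := 2) (by norm_num))
  have hAij : ∀ i j : Fin (N + 1 - k),
      ∫ η, centred g c θ i η * centred g c θ j η ∂geomProd θ = A i j := fun i j => by
    have hi : (i : ℕ) + k ≤ N := by omega
    have hj : (j : ℕ) + k ≤ N := by omega
    simp only [A]
    rw [dif_pos ⟨hi, hj⟩, covariance, ← integral_const_mul]
    congr 1
    funext η
    simp only [centred]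
    ring
  have h1 : ∫ η, localSquare (centred g c θ) (rangeNb (N + 1 - k) k) η ∂geomProd θ =
      ∑ i : Fin (N + 1 - k), ∑ j ∈ rangeNb (N + 1 - k) k i, A i j := by
    simp only [localSquare, nbSum, Finset.mul_sum]
    rw [integral_finsetSum _ fun i _ => integrable_finsetSum _ fun j _ => hint i j]
    refine Finset.sum_congr rfl fun i _ => ?_
    rw [integral_finsetSum _ fun j _ => hint i j]
    exact Finset.sum_congr rfl fun j _ => hAij i j
  rw [h1, sum_rangeNb_eq hA, Finset.mul_sum]
  refine Finset.sum_congr rfl fun e _ => ?_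
  rw [windowAverage]
  congr 1
  have hsub : N + 1 - k - offset k e = N + 1 - (k + offset k e) := by omega
  refine Fintype.sum_equiv (finCongr hsub) _ _ fun n => ?_
  have hn : (n : ℕ) + k ≤ N ∧ n + offset k e + k ≤ N := by omega
  simp only [A]
  rw [dif_pos hn, covariance_shift_eq_pairCov hb hg hθ]
  rfl

end CondVariance

/-! ### Integration with respect to the mixed product state -/

lemma integrable_cexp {α : Type*} {mα : MeasurableSpace α} {μ : Measure α} [IsFiniteMeasure μ]
    {f : α → ℝ} (hf : AEMeasurable f μ) (t : ℝ) :
    Integrable (fun x => Complex.exp ((t * f x : ℝ) * Complex.I)) μ :=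
  Integrable.of_bound (by fun_prop) 1 (ae_of_all _ fun _ => (Complex.norm_exp_ofReal_mul_I _).le)

lemma integral_comp_measure {α β E : Type*} {mα : MeasurableSpace α} {mβ : MeasurableSpace β}
    [NormedAddCommGroup E] [NormedSpace ℝ E] {μ : Measure α} [SFinite μ] {κ : Kernel α β}
    [IsSFiniteKernel κ] {f : β → E} (hf : Integrable f (μ.bind κ)) :
    ∫ y, f y ∂μ.bind κ = ∫ x, ∫ y, f y ∂κ x ∂μ := by
  have h := Measure.integral_compProd ((Measure.integrable_compProd_snd_iff hf.1).2 hf)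
  rw [← Measure.snd_compProd] at hf ⊢
  exact (integral_map measurable_snd.aemeasurable hf.1).trans h

section Ness

variable {a b : ℝ} {N : ℕ}

lemma integrable_ness (ha : 0 ≤ a) (hab : a < b) {f : (Fin N → ℕ) → ℝ}
    (hf : Integrable f (geomRef b N)) : Integrable f (ness a b N) := by
  have := isProbabilityMeasure_mixtureMeasure hab N
  have hb : 0 < b := ha.trans_lt hab
  have hbox : ∀ᵐ θ ∂mixtureMeasure a b N, ∀ i, θ i ∈ Icc 0 b := by
    filter_upwards [ae_mem_Icc_mixtureMeasure hab N] with θ hθ i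
    exact Icc_subset_Icc_left ha (hθ i)
  refine (Measure.integrable_comp_iff (κ := geomKernel N)
    (measurable_of_countable f).aestronglyMeasurable).2 ⟨?_, ?_⟩
  · filter_upwards [hbox] with θ hθ
    exact memLp_one_iff_integrable.1 (memLp_geomProd hb hθ (memLp_one_iff_integrable.2 hf))
  · refine Integrable.of_bound
      (measurable_integral_geomProd fun η => ‖f η‖).aestronglyMeasurable
      ((1 + b) ^ N * ∫ η, ‖f η‖ ∂geomRef b N) ?_
    filter_upwards [hbox] with θ hθ
    rw [Real.norm_of_nonneg (integral_nonneg fun _ => norm_nonneg _)]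
    exact integral_geomProd_le hb hθ (fun _ => norm_nonneg _) hf.norm

lemma integral_ness (hab : a < b) {E : Type*} [NormedAddCommGroup E] [NormedSpace ℝ E]
    {f : (Fin N → ℕ) → E} (hf : Integrable f (ness a b N)) :
    ∫ η, f η ∂ness a b N = ∫ θ, ∫ η, f η ∂geomProd θ ∂mixtureMeasure a b N := by
  have := isProbabilityMeasure_mixtureMeasure hab N
  exact integral_comp_measure (κ := geomKernel N) hf

end Ness

lemma ramp_inv {a b : ℝ} (hab : a < b) (y : ℝ) : ramp a b ((y - a) / (b - a)) = y := by
  have := (sub_pos.2 hab).ne'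
  unfold ramp
  field_simp
  ring

lemma ramp_mem {a b s : ℝ} (hab : a < b) (hs : s ∈ Icc (0 : ℝ) 1) : ramp a b s ∈ Icc a b := by
  unfold ramp
  constructor <;> nlinarith [hs.1, hs.2]

lemma profile_eq_ramp {a b s : ℝ} (hs : s ∈ Icc (0 : ℝ) 1) : profile a b s = ramp a b s := by
  rw [profile, indicator_of_mem hs, ramp]

lemma contDiff_ramp (a b : ℝ) : ContDiff ℝ 1 (ramp a b) := by
  unfold ramp; fun_prop

/-! ### The law of large numbers for the conditional variance -/

/-- The values of `ψ` at the sites of the lattice with mesh `1/(N+1)`. -/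
noncomputable def siteValue (ψ : ℝ → ℝ) (N n : ℕ) : ℝ := ψ ((n : ℝ) / (N + 1))

lemma exists_abs_siteValue_mul_sub_le {ψ : ℝ → ℝ} (hψ : ContDiff ℝ 1 ψ) (k : ℕ) :
    ∃ A : ℝ, 0 ≤ A ∧ ∀ d ≤ k, ∀ N : ℕ, 0 < N → ∀ n < N,
      |siteValue ψ N n * siteValue ψ N (n + d) - ψ ((n : ℝ) / (N + 1)) * ψ ((n : ℝ) / (N + 1))| ≤
        A / N := by
  obtain ⟨L, hL0, hLb, -, hLL⟩ := exists_bound_lipschitz hψ 0 (k + 1)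
  refine ⟨L * (L * k), by positivity, fun d hd N hN n hn => ?_⟩
  have hNpos : (0 : ℝ) < N := by exact_mod_cast hN
  have hnN : (n : ℝ) ≤ N := by exact_mod_cast hn.le
  have hdk : (d : ℝ) ≤ k := by exact_mod_cast hd
  have hx : (n : ℝ) / (N + 1) ∈ Icc (0 : ℝ) (k + 1) :=
    ⟨by positivity, by rw [div_le_iff₀ (by positivity)]; nlinarith⟩
  have hy : ((n + d : ℕ) : ℝ) / (N + 1) ∈ Icc (0 : ℝ) (k + 1) :=
    ⟨by positivity, by rw [div_le_iff₀ (by positivity)]; push_cast; nlinarith⟩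
  unfold siteValue
  rw [← mul_sub, abs_mul, mul_div_assoc]
  refine mul_le_mul (hLb _ hx) ((hLL _ hy _ hx).trans ?_) (abs_nonneg _) hL0
  have e : ((n + d : ℕ) : ℝ) / (N + 1) - n / (N + 1) = d / (N + 1) := by push_cast; ring
  rw [e, abs_of_nonneg (by positivity), mul_div_assoc]
  gcongr
  linarith

/-- The conditional variance of the fluctuation field given the parameters, expressed by window
averages (see `integral_localSquare_centred_eq`). -/
noncomputable def condVariance {k N : ℕ} (g : (Fin k → ℕ) → ℝ) (ψ : ℝ → ℝ) (θ : Fin N → ℝ) : ℝ :=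
  ∑ e : Fin (2 * k - 1), windowAverage (pairCov g (offset k e))
    (fun n => siteValue ψ N n * siteValue ψ N (n + offset k e)) θ

section Field

variable {a b : ℝ} {k : ℕ} {g : (Fin k → ℕ) → ℝ} {ψ : ℝ → ℝ}

lemma exists_condVariance_bounds (ha : 0 ≤ a) (hab : a < b) (hk : 1 ≤ k)
    (hg : MemLp g 4 (geomRef b k)) (hψ : ContDiff ℝ 1 ψ) :
    ∃ C : ℝ, 0 ≤ C ∧ ∀ N : ℕ, 0 < N →
      Integrable (condVariance (N := N) g ψ) (mixtureMeasure a b N) ∧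
      ∫ θ, |condVariance g ψ θ - sigmaESq a b g ψ| ∂mixtureMeasure a b N ≤ C * (√(N : ℝ))⁻¹ := by
  have hb : 0 < b := ha.trans_lt hab
  have hsub : Icc a b ⊆ Icc 0 b := Icc_subset_Icc_left ha
  obtain ⟨A, hA0, hA⟩ := exists_abs_siteValue_mul_sub_le hψ k
  choose F hF he using fun e : Fin (2 * k - 1) => exists_contDiff_pairCov ha hab hg (offset k e)
  choose L hL0 hL using fun e : Fin (2 * k - 1) => exists_lipschitz_pairCov hb hg (offset k e)
  choose C hC0 hC using fun e : Fin (2 * k - 1) =>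
    exists_windowAverage_bounds hab (K := k + offset k e) (by omega) (measurable_pairCov (g := g) _)
      (H := fun s => F e (ramp a b s)) ((hF e).comp (contDiff_ramp a b))
      (ψ := fun x => ψ x * ψ x) (hψ.mul hψ) (hL0 e) hA0
      (fun θ θ' h h' => hL e θ θ' (fun i => hsub (h i)) fun i => hsub (h' i))
      (fun y hy => by rw [ramp_inv hab]; exact he e hy)
  refine ⟨∑ e, C e, Finset.sum_nonneg fun e _ => hC0 e, fun N hN => ?_⟩
  have := isProbabilityMeasure_mixtureMeasure hab N
  have hoff : ∀ e : Fin (2 * k - 1), offset k e ≤ k := fun e => by unfold offset; omega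
  have hall := fun e => hC e N hN (fun n => siteValue ψ N n * siteValue ψ N (n + offset k e))
    (hA _ (hoff e) N hN)
  have hi := fun e => (hall e).1
  refine ⟨integrable_finsetSum _ fun e _ => hi e, ?_⟩
  set J : Fin (2 * k - 1) → ℝ := fun e => ∫ s in (0 : ℝ)..1, F e (ramp a b s) * (ψ s * ψ s) with hJ
  set G : Fin (2 * k - 1) → (Fin N → ℝ) → ℝ := fun e => windowAverage (pairCov g (offset k e))
    (fun n => siteValue ψ N n * siteValue ψ N (n + offset k e)) with hG
  have hσ : sigmaESq a b g ψ = ∑ e, J e := by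
    have hJi : ∀ e, IntervalIntegrable (fun s => F e (ramp a b s) * (ψ s * ψ s)) volume 0 1 :=
      fun e => (((hF e).continuous.comp (contDiff_ramp a b).continuous).mul
        (hψ.continuous.mul hψ.continuous)).intervalIntegrable _ _
    rw [hJ, ← intervalIntegral.integral_finsetSum fun e _ => hJi e]
    refine intervalIntegral.integral_congr fun s hs => ?_
    rw [uIcc_of_le zero_le_one] at hs
    have hm := ramp_mem hab hs
    simp only [profile_eq_ramp hs]
    rw [localVariance_eq_sum hb hg (hsub hm), Finset.sum_mul]
    refine Finset.sum_congr rfl fun e _ => ?_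
    rw [sq]
    congr 1
    exact he e hm
  have hd : ∀ e, Integrable (fun θ => |G e θ - J e|) (mixtureMeasure a b N) := fun e =>
    ((hi e).sub (integrable_const _)).abs
  calc _ ≤ ∫ θ, ∑ e, |G e θ - J e| ∂mixtureMeasure a b N := by
        refine integral_mono_of_nonneg (ae_of_all _ fun _ => abs_nonneg _)
          (integrable_finsetSum _ fun e _ => hd e) (ae_of_all _ fun θ => ?_)
        beta_reduce
        rw [hσ, condVariance, ← Finset.sum_sub_distrib]
        exact Finset.abs_sum_le_sum_abs _ _
    _ = ∑ e, ∫ θ, |G e θ - J e| ∂mixtureMeasure a b N := integral_finsetSum _ fun e _ => hd e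
    _ ≤ ∑ e, C e * (√(N : ℝ))⁻¹ := Finset.sum_le_sum fun e _ => (hall e).2.1
    _ = _ := (Finset.sum_mul _ _ _).symm

lemma condVariance_eq (hb : 0 < b) (hg : MemLp g 4 (geomRef b k)) {N : ℕ}
    {θ : Fin N → ℝ} (hθ : ∀ i, θ i ∈ Icc 0 b) :
    (N : ℝ)⁻¹ * ∫ η, localSquare (centred g (siteValue ψ N) θ) (rangeNb (N + 1 - k) k) η ∂geomProd θ =
      condVariance g ψ θ := integral_localSquare_centred_eq hb hg _ hθ

lemma condVariance_nonneg (hb : 0 < b) (hg : MemLp g 4 (geomRef b k)) {N : ℕ}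
    {θ : Fin N → ℝ} (hθ : ∀ i, θ i ∈ Icc 0 b) : 0 ≤ condVariance g ψ θ := by
  rw [← condVariance_eq hb hg hθ]
  exact mul_nonneg (by positivity) (integral_localSquare_nonneg
    (fun i => memLp_centred hb hg hθ i) (fun i => integral_centred hb hg hθ i)
    fun i => indepFun_centred i)

lemma sigmaESq_nonneg (ha : 0 ≤ a) (hab : a < b) (hk : 1 ≤ k)
    (hg : MemLp g 4 (geomRef b k)) (hψ : ContDiff ℝ 1 ψ) : 0 ≤ sigmaESq a b g ψ := by
  have hb : 0 < b := ha.trans_lt hab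
  obtain ⟨C, -, hC⟩ := exists_condVariance_bounds ha hab hk hg hψ
  have hlim : Tendsto (fun N : ℕ => C * (√(N : ℝ))⁻¹) atTop (𝓝 (C * 0)) :=
    ((tendsto_inv_atTop_zero.comp (Real.tendsto_sqrt_atTop.comp
      tendsto_natCast_atTop_atTop))).const_mul C
  rw [mul_zero] at hlim
  have : -sigmaESq a b g ψ ≤ 0 := by
    refine ge_of_tendsto hlim ((eventually_gt_atTop 0).mono fun N hN => ?_)
    have := isProbabilityMeasure_mixtureMeasure hab N
    obtain ⟨hi, hN'⟩ := hC N hN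
    refine le_trans ?_ hN'
    have h0 : 0 ≤ ∫ θ : Fin N → ℝ, condVariance g ψ θ ∂mixtureMeasure a b N := by
      refine integral_nonneg_of_ae ?_
      filter_upwards [ae_mem_Icc_mixtureMeasure hab N] with θ hθ
      exact condVariance_nonneg hb hg fun i => Icc_subset_Icc_left ha (hθ i)
    have h1 : ∫ θ : Fin N → ℝ, (condVariance g ψ θ - sigmaESq a b g ψ) ∂mixtureMeasure a b N =
        (∫ θ : Fin N → ℝ, condVariance g ψ θ ∂mixtureMeasure a b N) - sigmaESq a b g ψ := by
      rw [integral_sub hi (integrable_const _)]; simp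
    have h2 : ∫ θ : Fin N → ℝ, (condVariance g ψ θ - sigmaESq a b g ψ) ∂mixtureMeasure a b N ≤
        ∫ θ : Fin N → ℝ, |condVariance g ψ θ - sigmaESq a b g ψ| ∂mixtureMeasure a b N :=
      integral_mono (hi.sub (integrable_const _)) (hi.sub (integrable_const _)).abs
        fun θ => le_abs_self _
    linarith
  linarith

lemma continuousOn_localVariance (ha : 0 ≤ a) (hab : a < b) (hg : MemLp g 4 (geomRef b k)) :
    ContinuousOn (localVariance g) (Icc a b) := by
  choose F hF he using fun e : Fin (2 * k - 1) => exists_contDiff_pairCov ha hab hg (offset k e)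
  have hc : Continuous fun y => ∑ e, F e y := continuous_finsetSum _ fun e _ => (hF e).continuous
  refine hc.continuousOn.congr fun y hy => ?_
  rw [localVariance_eq_sum (ha.trans_lt hab) hg (Icc_subset_Icc_left ha hy)]
  exact Finset.sum_congr rfl fun e _ => he e hy

/-! ### The fluctuations of the conditional mean -/

/-- The limiting variance of the conditional mean is the variance of the influence function. -/
lemma integral_influence_sq_eq_sigmaTSq (hab : a < b) {F : ℝ → ℝ} (hF : ContDiff ℝ 1 F)
    (hFg : EqOn (localMean g) F (Icc a b)) (hψ : Continuous ψ) :
    ∫ x, influence a b (fun s => F (ramp a b s)) ψ x ^ 2 ∂uniformIcc a b = sigmaTSq a b g ψ := by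
  have hd : ∀ s ∈ Icc (0 : ℝ) 1, deriv (fun s => F (ramp a b s)) s =
      (b - a) * derivWithin (localMean g) (Icc a b) (profile a b s) := fun s hs => by
    have hm := ramp_mem hab hs
    have h1 : HasDerivAt (ramp a b) (b - a) s := by
      have := ((hasDerivAt_id' s).const_mul (b - a)).const_add a
      rwa [mul_one] at this
    have h2 := (hF.differentiable one_ne_zero (ramp a b s)).hasDerivAt
    have h3 : HasDerivAt (fun s => F (ramp a b s)) (deriv F (ramp a b s) * (b - a)) s := h2.comp s h1
    rw [h3.deriv, profile_eq_ramp hs, mul_comm,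
      derivWithin_congr hFg (hFg hm), h2.hasDerivWithinAt.derivWithin (uniqueDiffOn_Icc hab _ hm)]
  rw [integral_influence_sq (H := fun s => F (ramp a b s)) hab (hF.comp (contDiff_ramp a b)) hψ, sigmaTSq,
    ← intervalIntegral.integral_const_mul]
  refine intervalIntegral.integral_congr fun s hs => ?_
  rw [← intervalIntegral.integral_const_mul]
  refine intervalIntegral.integral_congr fun t ht => ?_
  rw [uIcc_of_le zero_le_one] at hs ht
  rw [hd s hs, hd t ht]
  ring

lemma sigmaTSq_nonneg (ha : 0 ≤ a) (hab : a < b) (hg : MemLp g 2 (geomRef b k)) (hψ : Continuous ψ) :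
    0 ≤ sigmaTSq a b g ψ := by
  obtain ⟨F, hF, hFg⟩ := exists_contDiff_localMean ha hab hg
  rw [← integral_influence_sq_eq_sigmaTSq hab hF hFg hψ]
  exact integral_nonneg fun _ => sq_nonneg _

/-- The centred conditional mean of the fluctuation field. -/
noncomputable def meanFluctuation (a b : ℝ) {k N : ℕ} (g : (Fin k → ℕ) → ℝ) (ψ : ℝ → ℝ)
    (θ : Fin N → ℝ) : ℝ :=
  √(N : ℝ) * (windowAverage (fun θ => ∫ η, g η ∂geomProd θ) (siteValue ψ N) θ -
    ∫ θ : Fin N → ℝ, windowAverage (fun θ => ∫ η, g η ∂geomProd θ) (siteValue ψ N) θ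
      ∂mixtureMeasure a b N)

/-- Decomposition of the field into the part driven by the parameters and the conditionally centred part. -/
lemma fluctuationField_eq (ha : 0 ≤ a) (hab : a < b) (hg : MemLp g 2 (geomRef b k)) {N : ℕ}
    (hN : 0 < N) (θ : Fin N → ℝ) (η : Fin N → ℕ) :
    fluctuationField g ψ N (ness a b N) η = meanFluctuation a b g ψ θ +
      (√(N : ℝ))⁻¹ * ∑ n, centred g (siteValue ψ N) θ n η := by
  have hb : 0 < b := ha.trans_lt hab
  have := isProbabilityMeasure_mixtureMeasure hab N
  have hNpos : (0 : ℝ) < N := by exact_mod_cast hN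
  have hs : 0 < √(N : ℝ) := Real.sqrt_pos.2 hNpos
  have hsN : √(N : ℝ) * (N : ℝ)⁻¹ = (√(N : ℝ))⁻¹ := by
    nth_rewrite 2 [← Real.mul_self_sqrt hNpos.le]
    field_simp
  have hi : ∀ (n : ℕ) (h : n + k ≤ N), Integrable (shift g n h) (ness a b N) := fun n h =>
    integrable_ness ha hab ((memLp_shift (θ := fun _ => b) hg).integrable one_le_two)
  have hmean : ∀ (n : ℕ) (h : n + k ≤ N), ∫ ξ, shift g n h ξ ∂ness a b N =
      ∫ θ, ∫ η, g η ∂geomProd (window n h θ) ∂mixtureMeasure a b N := fun n h => by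
    rw [integral_ness hab (hi n h)]
    simp only [integral_shift]
  have hii : ∀ (n : ℕ) (h : n + k ≤ N),
      Integrable (fun θ => ∫ η, g η ∂geomProd (window n h θ)) (mixtureMeasure a b N) := fun n h => by
    refine Integrable.of_bound ((measurable_integral_geomProd g).comp
      (measurable_window n h)).aestronglyMeasurable ((1 + b) ^ k * ∫ η, |g η| ∂geomRef b k) ?_
    filter_upwards [ae_mem_Icc_mixtureMeasure hab N] with θ hθ
    exact (abs_integral_le_integral_abs).trans (integral_geomProd_le hb
      (fun i => Icc_subset_Icc_left ha (hθ _)) (fun _ => abs_nonneg _) (hg.integrable one_le_two).abs)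
  have hI : ∫ θ : Fin N → ℝ, windowAverage (fun θ => ∫ η, g η ∂geomProd θ) (siteValue ψ N) θ
      ∂mixtureMeasure a b N = (N : ℝ)⁻¹ * ∑ n : Fin (N + 1 - k),
        siteValue ψ N n * ∫ ξ, shift g n (by omega) ξ ∂ness a b N := by
    simp only [windowAverage]
    rw [integral_const_mul, integral_finsetSum _ fun n _ => (hii _ _).const_mul _]
    congr 1
    refine Finset.sum_congr rfl fun n _ => ?_
    rw [integral_const_mul, hmean]
  rw [meanFluctuation, hI, windowAverage, fluctuationField, ← mul_sub, ← mul_assoc, hsN, ← mul_add,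
    ← Finset.sum_sub_distrib, ← Finset.sum_add_distrib]
  congr 1
  refine Finset.sum_congr rfl fun n _ => ?_
  rw [centred, integral_shift g n _ θ, siteValue]
  ring

/-- The characteristic functions of the fluctuation field converge. Given the parameters, the field
is a constant, the fluctuation of the conditional mean, plus a sum of locally dependent variables
which is nearly Gaussian with a nearly deterministic variance. -/
theorem tendsto_integral_cexp_fluctuationField (ha : 0 ≤ a) (hab : a < b) (hk : 1 ≤ k)
    (hg : MemLp g 4 (geomRef b k)) (hψ : ContDiff ℝ 1 ψ) (t : ℝ) :
    Tendsto (fun N : ℕ => ∫ η, Complex.exp ((t * fluctuationField g ψ N (ness a b N) η : ℝ) *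
        Complex.I) ∂ness a b N) atTop
      (𝓝 (Real.exp (-((sigmaTSq a b g ψ + sigmaESq a b g ψ) * t ^ 2 / 2)) : ℂ)) := by
  have hb : 0 < b := ha.trans_lt hab
  have hsub : Icc a b ⊆ Icc 0 b := Icc_subset_Icc_left ha
  have hg2 : MemLp g 2 (geomRef b k) := hg.mono_exponent (by norm_num)
  have := isProbabilityMeasure_uniformIcc hab
  obtain ⟨F, hF, hFg⟩ := exists_contDiff_localMean ha hab hg2
  obtain ⟨L, hL0, hL⟩ := exists_lipschitz_integral_geomProd hb hg2
  obtain ⟨B, -, hB, -, -⟩ := exists_bound_lipschitz hψ 0 1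
  obtain ⟨C₁, hC₁, h₁⟩ := exists_windowAverage_bounds hab hk (measurable_integral_geomProd g)
    (H := fun s => F (ramp a b s)) (hF.comp (contDiff_ramp a b)) hψ hL0 le_rfl
    (fun θ θ' h h' => hL θ θ' (fun i => hsub (h i)) fun i => hsub (h' i))
    (fun y hy => by rw [ramp_inv hab]; exact hFg hy)
  obtain ⟨C₂, hC₂, h₂⟩ := exists_condVariance_bounds ha hab hk hg hψ
  obtain ⟨C₃, h₃⟩ := exists_norm_integral_cexp_centred_le (B := B) hb hg t
  have hE0 := sigmaESq_nonneg ha hab hk hg hψ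
  set σE := sigmaESq a b g ψ with hσE
  set Z := influence a b (fun s => F (ramp a b s)) ψ with hZ
  have hclt := tendsto_integral_cexp_sample (memLp_influence (hF.comp (contDiff_ramp a b))
    hψ.continuous 2 (uniformIcc a b)) (measurable_influence (hF.comp (contDiff_ramp a b)) hψ.continuous)
    (integral_influence hab (hF.comp (contDiff_ramp a b)) hψ.continuous) t
  rw [show (∫ x, influence a b (F ∘ ramp a b) ψ x ^ 2 ∂uniformIcc a b) = sigmaTSq a b g ψ from
    integral_influence_sq_eq_sigmaTSq hab hF hFg hψ.continuous] at hclt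
  set q : ℂ := (Real.exp (-(σE * t ^ 2 / 2)) : ℂ) with hq
  have hqn : ‖q‖ ≤ 1 := by
    rw [hq, Complex.norm_real, Real.norm_eq_abs, Real.abs_exp, Real.exp_le_one_iff]
    have := mul_nonneg hE0 (sq_nonneg t)
    linarith
  have hlim := hclt.mul_const q
  rw [show (Real.exp (-(sigmaTSq a b g ψ * t ^ 2 / 2)) : ℂ) * q =
      (Real.exp (-((sigmaTSq a b g ψ + σE) * t ^ 2 / 2)) : ℂ) by
    rw [hq, ← Complex.ofReal_mul, ← Real.exp_add]; congr 2; ring] at hlim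
  refine (tendsto_iff_of_dist ?_).1 hlim
  refine squeeze_zero' (Eventually.of_forall fun _ => dist_nonneg)
    ((eventually_gt_atTop 0).mono fun N hN => ?_)
    (g := fun N : ℕ => (C₃ + C₂ * (t ^ 2 / 2) + |t| * C₁) * (√(N : ℝ))⁻¹) ?_
  swap
  · have : Tendsto (fun N : ℕ => (C₃ + C₂ * (t ^ 2 / 2) + |t| * C₁) * (√(N : ℝ))⁻¹) atTop
        (𝓝 ((C₃ + C₂ * (t ^ 2 / 2) + |t| * C₁) * 0)) :=
      ((tendsto_inv_atTop_zero.comp (Real.tendsto_sqrt_atTop.comp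
        tendsto_natCast_atTop_atTop))).const_mul _
    rwa [mul_zero] at this
  have := isProbabilityMeasure_mixtureMeasure hab N
  have := isProbabilityMeasure_ness hab N
  set Λ := mixtureMeasure a b N with hΛ
  set T : (Fin N → ℝ) → ℝ := meanFluctuation a b g ψ with hT
  have hTm : Measurable T :=
    ((measurable_windowAverage (measurable_integral_geomProd g) _).sub_const _).const_mul _
  set Y : (Fin N → ℝ) → (Fin N → ℕ) → ℝ := fun θ η =>
    (√(N : ℝ))⁻¹ * ∑ n, centred g (siteValue ψ N) θ n η with hY
  set X : (Fin N → ℕ) → ℝ := fluctuationField g ψ N (ness a b N) with hX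
  have hXi : Integrable (fun η => Complex.exp ((t * X η : ℝ) * Complex.I)) (ness a b N) :=
    integrable_cexp (measurable_of_countable X).aemeasurable t
  set f : (Fin N → ℝ) → ℂ := fun θ => ∫ η, Complex.exp ((t * X η : ℝ) * Complex.I) ∂geomProd θ with hf
  have hfm : StronglyMeasurable f := stronglyMeasurable_integral_geomProd
    (measurable_of_countable _).stronglyMeasurable
  have hfi : Integrable f Λ := Integrable.of_bound hfm.aestronglyMeasurable 1
    (ae_of_all _ fun θ => (norm_integral_le_of_norm_le_const (ae_of_all _ fun η =>
      (Complex.norm_exp_ofReal_mul_I _).le)).trans (by simp))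
  have hTi : Integrable (fun θ => Complex.exp ((t * T θ : ℝ) * Complex.I)) Λ :=
    integrable_cexp hTm.aemeasurable t
  obtain ⟨hvi, hv⟩ := h₂ N hN
  -- given the parameters, the field is nearly Gaussian with variance `σE`
  have step1 : ‖∫ θ, f θ ∂Λ - ∫ θ, Complex.exp ((t * T θ : ℝ) * Complex.I) * q ∂Λ‖ ≤
      (C₃ + C₂ * (t ^ 2 / 2)) * (√(N : ℝ))⁻¹ := by
    rw [← integral_sub hfi (hTi.mul_const q)]
    have hae : ∀ᵐ θ ∂Λ, ‖f θ - Complex.exp ((t * T θ : ℝ) * Complex.I) * q‖ ≤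
        C₃ * (√(N : ℝ))⁻¹ + |condVariance g ψ θ - σE| * (t ^ 2 / 2) := by
      filter_upwards [ae_mem_Icc_mixtureMeasure hab N] with θ hθ
      have hθ' : ∀ i, θ i ∈ Icc 0 b := fun i => hsub (hθ i)
      have e1 : f θ = Complex.exp ((t * T θ : ℝ) * Complex.I) *
          ∫ η, Complex.exp ((t * Y θ η : ℝ) * Complex.I) ∂geomProd θ := by
        rw [← integral_const_mul]
        refine integral_congr_ae (ae_of_all _ fun η => ?_)
        beta_reduce
        rw [← Complex.exp_add, hX, fluctuationField_eq ha hab hg2 hN θ η]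
        simp only [hT, hY]
        congr 1
        push_cast
        ring
      rw [e1, ← mul_sub, norm_mul, Complex.norm_exp_ofReal_mul_I, one_mul]
      have h3 := h₃ N hN (siteValue ψ N) (fun n hn => hB _ ⟨by positivity, by
        rw [div_le_one (by positivity)]
        have : (n : ℝ) ≤ N := by exact_mod_cast hn
        linarith⟩) θ hθ'
      rw [condVariance_eq hb hg hθ'] at h3
      have hv0 := condVariance_nonneg (ψ := ψ) hb hg hθ'
      have h4 : ‖(Real.exp (-(condVariance g ψ θ * t ^ 2 / 2)) : ℂ) - q‖ ≤
          |condVariance g ψ θ - σE| * (t ^ 2 / 2) := by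
        rw [hq, ← Complex.ofReal_sub, Complex.norm_real, Real.norm_eq_abs]
        refine (abs_exp_neg_sub_exp_neg_le (by positivity) (by positivity)).trans (le_of_eq ?_)
        rw [show condVariance g ψ θ * t ^ 2 / 2 - σE * t ^ 2 / 2 =
          (condVariance g ψ θ - σE) * (t ^ 2 / 2) by ring, abs_mul,
          abs_of_nonneg (by positivity : 0 ≤ t ^ 2 / 2)]
      exact (norm_sub_le_norm_sub_add_norm_sub _ _ _).trans (add_le_add h3 h4)
    have hdi : Integrable (fun θ => |condVariance g ψ θ - σE|) Λ :=
      (hvi.sub (integrable_const _)).abs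
    refine (norm_integral_le_of_norm_le
      ((integrable_const _).add (hdi.mul_const _)) hae).trans ?_
    have e2 : ∫ θ, (C₃ * (√(N : ℝ))⁻¹ + |condVariance g ψ θ - σE| * (t ^ 2 / 2)) ∂Λ =
        C₃ * (√(N : ℝ))⁻¹ + (∫ θ, |condVariance g ψ θ - σE| ∂Λ) * (t ^ 2 / 2) := by
      rw [integral_add (integrable_const _) (hdi.mul_const _), integral_const, integral_mul_const]
      simp
    refine (le_of_eq e2).trans ?_
    have := mul_le_mul_of_nonneg_right hv (by positivity : 0 ≤ t ^ 2 / 2)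
    linarith
  -- the conditional mean is nearly a sum of independent variables
  obtain ⟨hwi, -, hw⟩ := h₁ N hN (siteValue ψ N) fun n _ => by simp [siteValue]
  have hmapT : ∫ θ, Complex.exp ((t * T θ : ℝ) * Complex.I) ∂Λ =
      ∫ u, Complex.exp ((t * T (orderStatistics u) : ℝ) * Complex.I) ∂sampleMeasure a b N :=
    integral_map measurable_orderStatistics.aemeasurable (by fun_prop)
  have hZm : Measurable Z := measurable_influence (hF.comp (contDiff_ramp a b)) hψ.continuous
  have hTo : Measurable fun u : Fin N → ℝ => T (orderStatistics u) := hTm.comp measurable_orderStatistics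
  have hSm : Measurable fun u : Fin N → ℝ => (√(N : ℝ))⁻¹ * ∑ i, Z (u i) := by fun_prop
  have step2 : ‖∫ θ, Complex.exp ((t * T θ : ℝ) * Complex.I) ∂Λ -
      ∫ u, Complex.exp ((t * ((√(N : ℝ))⁻¹ * ∑ i, Z (u i)) : ℝ) * Complex.I) ∂sampleMeasure a b N‖ ≤
      |t| * C₁ * (√(N : ℝ))⁻¹ := by
    rw [hmapT, ← integral_sub
      (integrable_cexp hTo.aemeasurable t) (integrable_cexp hSm.aemeasurable t)]
    have hint : Integrable (fun u : Fin N → ℝ => |T (orderStatistics u) -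
        (√(N : ℝ))⁻¹ * ∑ i, Z (u i)|) (sampleMeasure a b N) := by
      have i1 : Integrable (fun u : Fin N → ℝ => T (orderStatistics u)) (sampleMeasure a b N) := by
        have : Integrable T Λ := (hwi.sub (integrable_const _)).const_mul _
        exact (integrable_map_measure hTm.aestronglyMeasurable
          measurable_orderStatistics.aemeasurable).1 this
      have i2 : Integrable (fun u : Fin N → ℝ => (√(N : ℝ))⁻¹ * ∑ i, Z (u i)) (sampleMeasure a b N) :=
        (integrable_finsetSum Finset.univ fun i _ =>
          (measurePreserving_eval (fun _ : Fin N => uniformIcc a b) i).integrable_comp_of_integrable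
            ((memLp_influence (hF.comp (contDiff_ramp a b)) hψ.continuous 2 _).integrable
              one_le_two)).const_mul _
      exact (i1.sub i2).abs
    refine (norm_integral_le_of_norm_le (hint.const_mul |t|) (ae_of_all _ fun u => ?_)).trans ?_
    · refine (norm_cexp_sub_cexp_le _ _).trans (le_of_eq ?_)
      rw [← mul_sub, abs_mul]
    · rw [integral_const_mul, mul_assoc]
      exact mul_le_mul_of_nonneg_left hw (abs_nonneg t)
  rw [dist_comm, dist_eq_norm, integral_ness hab hXi]
  refine (norm_sub_le_norm_sub_add_norm_sub _
    (∫ θ, Complex.exp ((t * T θ : ℝ) * Complex.I) * q ∂Λ) _).trans ?_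
  rw [integral_mul_const, ← sub_mul, norm_mul, add_mul]
  rw [integral_mul_const] at step1
  refine add_le_add step1 ?_
  exact (mul_le_of_le_one_right (norm_nonneg _) hqn).trans step2

end Field

/-! ### Convergence in distribution of the field of a local function -/

lemma charFun_map_real {α : Type*} {mα : MeasurableSpace α} {μ : Measure α} {f : α → ℝ}
    (hf : AEMeasurable f μ) (t : ℝ) :
    charFun (μ.map f) t = ∫ x, Complex.exp ((t * f x : ℝ) * Complex.I) ∂μ := by
  rw [charFun_apply_real, integral_map hf (by fun_prop)]
  simp

lemma tendstoInDistribution_of_tendsto_integral_cexp {Ω : ℕ → Type*} {mΩ : ∀ N, MeasurableSpace (Ω N)}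
    {P : (N : ℕ) → Measure (Ω N)} [∀ N, IsProbabilityMeasure (P N)] {Ω' : Type*}
    {mΩ' : MeasurableSpace Ω'} {P' : Measure Ω'} [IsProbabilityMeasure P']
    {X : (N : ℕ) → Ω N → ℝ} {Z : Ω' → ℝ} (hX : ∀ N, AEMeasurable (X N) (P N)) (hZ : AEMeasurable Z P')
    (h : ∀ t : ℝ, Tendsto (fun N => ∫ ω, Complex.exp ((t * X N ω : ℝ) * Complex.I) ∂P N) atTop
      (𝓝 (∫ ω, Complex.exp ((t * Z ω : ℝ) * Complex.I) ∂P'))) :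
    TendstoInDistribution X atTop Z P P' := by
  refine ⟨hX, hZ, ProbabilityMeasure.tendsto_of_tendsto_charFun fun t => ?_⟩
  simp only [ProbabilityMeasure.coe_mk]
  simp_rw [charFun_map_real hZ, charFun_map_real (hX _)]
  exact h t

lemma integral_cexp_gaussianReal {v : ℝ} (hv : 0 ≤ v) (t : ℝ) :
    ∫ x, Complex.exp ((t * x : ℝ) * Complex.I) ∂gaussianReal 0 v.toNNReal =
      (Real.exp (-(v * t ^ 2 / 2)) : ℂ) := by
  have h := charFun_gaussianReal (μ := 0) (v := v.toNNReal) t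
  rw [charFun_apply_real] at h
  simp only [Complex.ofReal_mul]
  rw [h]
  have : ((v.toNNReal : ℝ≥0) : ℂ) = (v : ℂ) := by
    exact congrArg Complex.ofReal (Real.coe_toNNReal v hv)
  rw [this]
  push_cast
  congr 1
  ring

lemma integral_cexp_of_hasLaw_ness {Ω : Type*} {mΩ : MeasurableSpace Ω} {P : Measure Ω} {a b : ℝ}
    {N : ℕ} {η : Ω → Fin N → ℕ} (hη : HasLaw η (ness a b N) P) (f : (Fin N → ℕ) → ℝ) (t : ℝ) :
    ∫ ω, Complex.exp ((t * f (η ω) : ℝ) * Complex.I) ∂P =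
      ∫ ξ, Complex.exp ((t * f ξ : ℝ) * Complex.I) ∂ness a b N :=
  hη.integral_comp (f := fun ξ => Complex.exp ((t * f ξ : ℝ) * Complex.I))
    (measurable_of_countable _).aestronglyMeasurable

section Congr

variable {a b : ℝ} {k : ℕ} {g : (Fin k → ℕ) → ℝ} {φ ψ : ℝ → ℝ}

lemma fluctuationField_congr (h : EqOn φ ψ (Icc 0 1)) {N : ℕ} (μ : Measure (Fin N → ℕ)) :
    fluctuationField g φ N μ = fluctuationField g ψ N μ := by
  funext η
  unfold fluctuationField
  congr 1
  refine Finset.sum_congr rfl fun n _ => ?_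
  rw [h ⟨by positivity, ?_⟩]
  have : (n : ℝ) ≤ N + 1 := by
    have : (n : ℕ) ≤ N + 1 := by omega
    exact_mod_cast this
  rwa [div_le_one (by positivity)]

lemma sigmaESq_congr (h : EqOn φ ψ (Icc 0 1)) : sigmaESq a b g φ = sigmaESq a b g ψ := by
  refine intervalIntegral.integral_congr fun x hx => ?_
  rw [uIcc_of_le zero_le_one] at hx
  simp only [h hx]

lemma sigmaTSq_congr (h : EqOn φ ψ (Icc 0 1)) : sigmaTSq a b g φ = sigmaTSq a b g ψ := by
  unfold sigmaTSq
  congr 1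
  refine intervalIntegral.integral_congr fun s hs => intervalIntegral.integral_congr fun t ht => ?_
  rw [uIcc_of_le zero_le_one] at hs ht
  simp only [h hs, h ht]

/-- A local function with empty dependence set is constant, and all terms of the field vanish. -/
lemma fluctuationField_of_isEmpty (hab : a < b) (hk : k = 0) {N : ℕ} (η : Fin N → ℕ) :
    fluctuationField g φ N (ness a b N) η = 0 := by
  subst hk
  have := isProbabilityMeasure_ness hab N
  have hc : ∀ (n : ℕ) (h : n + 0 ≤ N) (ξ : Fin N → ℕ), shift g n h ξ = g Fin.elim0 :=
    fun n h ξ => congrArg g (Subsingleton.elim _ _)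
  unfold fluctuationField
  rw [Finset.sum_eq_zero fun n _ => ?_, mul_zero]
  simp only [hc]
  simp

lemma sigmaTSq_of_isEmpty (hk : k = 0) : sigmaTSq a b g φ = 0 := by
  subst hk
  have hc : localMean g = fun _ => g Fin.elim0 := by
    funext θ
    have : ∀ η : Fin 0 → ℕ, g η = g Fin.elim0 := fun η => congrArg g (Subsingleton.elim _ _)
    simp [localMean, this]
  simp [sigmaTSq, hc]

lemma sigmaESq_of_isEmpty (hk : k = 0) : sigmaESq a b g φ = 0 := by
  subst hk
  have hc : localVariance g = fun _ => 0 := by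
    funext θ
    exact Finset.sum_eq_zero fun m _ => m.elim0
  simp [sigmaESq, hc]

end Congr

section LocalFunction

variable {a b : ℝ} {k : ℕ} {g : (Fin k → ℕ) → ℝ} {φ : ℝ → ℝ}

lemma contDiffOn_localMean (ha : 0 ≤ a) (hab : a < b) (hg : MemLp g 4 (geomRef b k)) :
    ContDiffOn ℝ 1 (localMean g) (Icc a b) := by
  obtain ⟨F, hF, hFg⟩ := exists_contDiff_localMean ha hab (hg.mono_exponent (p := 2) (by norm_num))
  exact hF.contDiffOn.congr hFg

lemma sigma_nonneg (ha : 0 ≤ a) (hab : a < b) (hg : MemLp g 4 (geomRef b k))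
    (hφ : ContDiffOn ℝ 1 φ (Icc 0 1)) : 0 ≤ sigmaTSq a b g φ ∧ 0 ≤ sigmaESq a b g φ := by
  obtain ⟨ψ, hψ, hφψ⟩ := exists_contDiff_eqOn zero_lt_one hφ
  rw [sigmaTSq_congr hφψ, sigmaESq_congr hφψ]
  refine ⟨sigmaTSq_nonneg ha hab (hg.mono_exponent (by norm_num)) hψ.continuous, ?_⟩
  rcases Nat.eq_zero_or_pos k with hk | hk
  · rw [sigmaESq_of_isEmpty hk]
  · exact sigmaESq_nonneg ha hab hk hg hψ

theorem tendsto_integral_cexp_field (ha : 0 ≤ a) (hab : a < b) (hg : MemLp g 4 (geomRef b k))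
    (hφ : ContDiffOn ℝ 1 φ (Icc 0 1)) (t : ℝ) :
    Tendsto (fun N : ℕ => ∫ η, Complex.exp ((t * fluctuationField g φ N (ness a b N) η : ℝ) *
        Complex.I) ∂ness a b N) atTop
      (𝓝 (Real.exp (-((sigmaTSq a b g φ + sigmaESq a b g φ) * t ^ 2 / 2)) : ℂ)) := by
  rcases Nat.eq_zero_or_pos k with hk | hk
  · simp only [fluctuationField_of_isEmpty hab hk, sigmaTSq_of_isEmpty hk, sigmaESq_of_isEmpty hk]
    have : ∀ N, IsProbabilityMeasure (ness a b N) := isProbabilityMeasure_ness hab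
    simp
  · obtain ⟨ψ, hψ, hφψ⟩ := exists_contDiff_eqOn zero_lt_one hφ
    simp only [sigmaTSq_congr hφψ, sigmaESq_congr hφψ, fluctuationField_congr hφψ]
    exact tendsto_integral_cexp_fluctuationField ha hab hk hg hψ t

variable {Ω : ℕ → Type*} {mΩ : ∀ N, MeasurableSpace (Ω N)} {P : (N : ℕ) → Measure (Ω N)}
  [∀ N, IsProbabilityMeasure (P N)] {η : (N : ℕ) → Ω N → (Fin N → ℕ)}

theorem tendstoInDistribution_fluctuationField (hη : ∀ N, HasLaw (η N) (ness a b N) (P N))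
    (ha : 0 ≤ a) (hab : a < b) (hg : MemLp g 4 (geomRef b k)) (hφ : ContDiffOn ℝ 1 φ (Icc 0 1)) :
    TendstoInDistribution (fun N ω => fluctuationField g φ N (ness a b N) (η N ω)) atTop (id : ℝ → ℝ) P
      (gaussianReal 0 (sigmaTSq a b g φ + sigmaESq a b g φ).toNNReal) := by
  obtain ⟨h1, h2⟩ := sigma_nonneg ha hab hg hφ
  refine tendstoInDistribution_of_tendsto_integral_cexp
    (fun N => (measurable_of_countable (fluctuationField g φ N (ness a b N))).comp_aemeasurable
      (hη N).aemeasurable)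
    aemeasurable_id fun t => ?_
  change Tendsto _ _ (𝓝 (∫ x, Complex.exp ((t * x : ℝ) * Complex.I) ∂gaussianReal _ _))
  rw [integral_cexp_gaussianReal (add_nonneg h1 h2)]
  simp_rw [fun N => integral_cexp_of_hasLaw_ness (hη N) (fluctuationField g φ N (ness a b N)) t]
  exact tendsto_integral_cexp_field ha hab hg hφ t

end LocalFunction

/-! ### The density field -/

lemma exists_geom_eq_geometricMeasure {θ : ℝ} (hθ : 0 ≤ θ) :
    ∃ p : unitInterval, p ≠ 0 ∧ geom θ = geometricMeasure p ∧ (p : ℝ) = 1 / (1 + θ) := by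
  have h1 : 1 / (1 + θ) ≤ 1 := by rw [div_le_one (by positivity)]; linarith
  have h0 : (0 : ℝ) < 1 / (1 + θ) := by positivity
  refine ⟨⟨1 / (1 + θ), h0.le, h1⟩, fun h => h0.ne' (congrArg Subtype.val h), ?_, rfl⟩
  rw [geom, projIcc_of_mem zero_le_one ⟨h0.le, h1⟩]

lemma memLp_natCast_geom {θ : ℝ} (hθ : 0 ≤ θ) : MemLp (fun n : ℕ => (n : ℝ)) 4 (geom θ) := by
  obtain ⟨p, hp, hg, hpv⟩ := exists_geom_eq_geometricMeasure hθ
  rw [← integrable_norm_rpow_iff (measurable_of_countable _).aestronglyMeasurable (by simp)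
    (by simp), hg, integrable_geometricMeasure_iff hp]
  have hr : ‖1 - (p : ℝ)‖ < 1 := by
    rw [Real.norm_of_nonneg (sub_nonneg.2 p.2.2), hpv]
    have : (0 : ℝ) < 1 / (1 + θ) := by positivity
    linarith
  refine ((summable_pow_mul_geometric_of_norm_lt_one 4 hr).mul_left (p : ℝ)).congr fun n => ?_
  simp only [ENNReal.toReal_ofNat, Real.norm_natCast]
  rw [show (4 : ℝ) = ((4 : ℕ) : ℝ) by norm_num, Real.rpow_natCast, Real.norm_of_nonneg (by positivity)]
  ring

lemma integral_natCast_geom {θ : ℝ} (hθ : 0 ≤ θ) : ∫ n : ℕ, (n : ℝ) ∂geom θ = θ := by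
  obtain ⟨p, hp, hg, hpv⟩ := exists_geom_eq_geometricMeasure hθ
  have hr : ‖1 - (p : ℝ)‖ < 1 := by
    rw [Real.norm_of_nonneg (sub_nonneg.2 p.2.2), hpv]
    have : (0 : ℝ) < 1 / (1 + θ) := by positivity
    linarith
  rw [hg, integral_geometricMeasure hp]
  have e : ∀ n : ℕ, ((1 - p : ℝ) ^ n * p) • (n : ℝ) = p * (n * (1 - p : ℝ) ^ n) := fun n => by
    rw [smul_eq_mul]; ring
  simp_rw [e]
  rw [tsum_mul_left, tsum_coe_mul_geometric_of_norm_lt_one hr, hpv]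
  have : 1 + θ ≠ 0 := by positivity
  field_simp
  ring

lemma measurePreserving_eval_geomProd {N : ℕ} (θ : Fin N → ℝ) (i : Fin N) :
    MeasurePreserving (fun η : Fin N → ℕ => η i) (geomProd θ) (geom (θ i)) :=
  measurePreserving_eval (fun i => geom (θ i)) i

lemma memLp_coord_geomProd {N : ℕ} {θ : Fin N → ℝ} (i : Fin N) (hθ : 0 ≤ θ i) :
    MemLp (fun η : Fin N → ℕ => (η i : ℝ)) 4 (geomProd θ) :=
  (memLp_natCast_geom hθ).comp_measurePreserving (measurePreserving_eval_geomProd θ i)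

lemma integral_coord_geomProd {N : ℕ} {θ : Fin N → ℝ} (i : Fin N) (hθ : 0 ≤ θ i) :
    ∫ η, (η i : ℝ) ∂geomProd θ = θ i := by
  have h := measurePreserving_eval_geomProd θ i
  rw [← integral_natCast_geom hθ, ← h.map_eq, integral_map h.measurable.aemeasurable
    (measurable_of_countable _).aestronglyMeasurable]

/-- The local function `η ↦ η_1`. -/
def occupation (x : Fin 1 → ℕ) : ℝ := x 0

lemma localMean_occupation {θ : ℝ} (hθ : 0 ≤ θ) : localMean occupation θ = θ :=
  integral_coord_geomProd (θ := fun _ : Fin 1 => θ) 0 hθ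

lemma localVariance_occupation (θ : ℝ) :
    localVariance occupation θ = Var[fun n : ℕ => (n : ℝ); geom θ] := by
  change ∑ m : Fin 1, cov[shift occupation 0 _, shift occupation m _; geomProd fun _ : Fin 1 => θ] = _
  have h := measurePreserving_eval_geomProd (fun _ : Fin 1 => θ) 0
  rw [Fin.sum_univ_one, ← h.map_eq, variance_map (measurable_of_countable _).aemeasurable
    h.measurable.aemeasurable]
  exact covariance_self (measurable_of_countable _).aemeasurable

section Density

variable {a b : ℝ} {φ : ℝ → ℝ}

lemma sigmaTSq_occupation (ha : 0 ≤ a) (hab : a < b) :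
    sigmaTSq a b occupation φ = (b - a) ^ 2 * ∫ s in (0 : ℝ)..1, ∫ t in (0 : ℝ)..1,
      (min s t - s * t) * φ s * φ t := by
  have hd : ∀ s ∈ Icc (0 : ℝ) 1,
      derivWithin (localMean occupation) (Icc a b) (profile a b s) = 1 := fun s hs => by
    rw [profile_eq_ramp hs, derivWithin_congr (f := fun θ => θ) (fun θ hθ =>
      localMean_occupation (ha.trans hθ.1)) (localMean_occupation (ha.trans (ramp_mem hab hs).1))]
    exact derivWithin_id' _ _ (uniqueDiffOn_Icc hab _ (ramp_mem hab hs))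
  unfold sigmaTSq
  congr 1
  refine intervalIntegral.integral_congr fun s hs => intervalIntegral.integral_congr fun t ht => ?_
  rw [uIcc_of_le zero_le_one] at hs ht
  simp only [hd s hs, hd t ht, mul_one]

lemma sigmaESq_occupation : sigmaESq a b occupation φ = ∫ x in (0 : ℝ)..1,
    Var[fun n : ℕ => (n : ℝ); geom (profile a b x)] * φ x ^ 2 := by
  simp only [sigmaESq, localVariance_occupation]

lemma memLp_occupation (hb : 0 ≤ b) : MemLp occupation 4 (geomRef b 1) :=
  memLp_coord_geomProd (θ := fun _ : Fin 1 => b) 0 hb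

lemma integrable_coord_ness (ha : 0 ≤ a) (hab : a < b) {N : ℕ} (i : Fin N) :
    Integrable (fun η : Fin N → ℕ => (η i : ℝ)) (ness a b N) :=
  integrable_ness ha hab ((memLp_coord_geomProd i (ha.trans hab.le)).integrable (by norm_num))

lemma integral_abs_coord_sub_le (ha : 0 ≤ a) (hab : a < b) {N : ℕ} (i : Fin N) :
    ∫ η, |(η i : ℝ) - ∫ ξ, (ξ i : ℝ) ∂ness a b N| ∂ness a b N ≤ 2 * b := by
  have := isProbabilityMeasure_ness hab N
  have := isProbabilityMeasure_mixtureMeasure hab N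
  have hi := integrable_coord_ness ha hab i
  set m := ∫ ξ, (ξ i : ℝ) ∂ness a b N with hm
  have hm0 : 0 ≤ m := integral_nonneg fun _ => Nat.cast_nonneg _
  have hmb : m ≤ b := by
    rw [hm, integral_ness hab hi]
    refine (integral_mono_of_nonneg (ae_of_all _ fun θ => integral_nonneg fun _ => Nat.cast_nonneg _)
      (integrable_const b) ?_).trans (by simp)
    filter_upwards [ae_mem_Icc_mixtureMeasure hab N] with θ hθ
    rw [integral_coord_geomProd i (ha.trans (hθ i).1)]
    exact (hθ i).2
  have h : ∫ η, |(η i : ℝ) - m| ∂ness a b N ≤ ∫ η, ((η i : ℝ) + m) ∂ness a b N :=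
    integral_mono (hi.sub (integrable_const _)).abs (hi.add (integrable_const _)) fun η =>
      abs_le.2 ⟨by have : (0 : ℝ) ≤ η i := Nat.cast_nonneg _
                   beta_reduce; linarith, by beta_reduce; linarith⟩
  rw [integral_add hi (integrable_const _)] at h
  simp only [integral_const, probReal_univ, one_smul] at h
  linarith

lemma fluctuationField_occupation (N : ℕ) (μ : Measure (Fin N → ℕ)) (η : Fin N → ℕ) :
    fluctuationField occupation φ N μ η = (√(N : ℝ))⁻¹ * ∑ i : Fin N,
      ((η i : ℝ) - ∫ ξ, (ξ i : ℝ) ∂μ) * φ ((i : ℝ) / (N + 1)) := rfl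

/-- Evaluating the test function at the neighbouring lattice point has no effect in the limit. -/
lemma exists_integral_abs_densityField_sub_le (ha : 0 ≤ a) (hab : a < b)
    (hφ : ContDiffOn ℝ 1 φ (Icc 0 1)) : ∃ C : ℝ, ∀ N : ℕ, 0 < N →
    Integrable (fun η => |densityField φ N (ness a b N) η -
      fluctuationField occupation φ N (ness a b N) η|) (ness a b N) ∧
    ∫ η, |densityField φ N (ness a b N) η - fluctuationField occupation φ N (ness a b N) η|
      ∂ness a b N ≤ C * (√(N : ℝ))⁻¹ := by
  obtain ⟨ψ, hψ, hφψ⟩ := exists_contDiff_eqOn zero_lt_one hφ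
  obtain ⟨L, hL0, -, -, hL⟩ := exists_bound_lipschitz hψ 0 1
  refine ⟨2 * b * L, fun N hN => ?_⟩
  have := isProbabilityMeasure_ness hab N
  have hNpos : (0 : ℝ) < N := by exact_mod_cast hN
  have hincr : ∀ i : Fin N, |φ (((i : ℝ) + 1) / (N + 1)) - φ ((i : ℝ) / (N + 1))| ≤ L * (N : ℝ)⁻¹ :=
    fun i => by
      have hi : (i : ℝ) + 1 ≤ N := by exact_mod_cast i.2
      have h1 : ((i : ℝ) + 1) / (N + 1) ∈ Icc (0 : ℝ) 1 :=
        ⟨by positivity, by rw [div_le_one (by positivity)]; linarith⟩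
      have h2 : (i : ℝ) / (N + 1) ∈ Icc (0 : ℝ) 1 :=
        ⟨by positivity, by rw [div_le_one (by positivity)]; linarith⟩
      rw [hφψ h1, hφψ h2]
      refine (hL _ h1 _ h2).trans (mul_le_mul_of_nonneg_left ?_ hL0)
      rw [← sub_div, add_sub_cancel_left, abs_of_nonneg (by positivity), one_div]
      exact inv_anti₀ hNpos (by linarith)
  have hdiff : ∀ η, densityField φ N (ness a b N) η - fluctuationField occupation φ N (ness a b N) η =
      (√(N : ℝ))⁻¹ * ∑ i : Fin N, ((η i : ℝ) - ∫ ξ, (ξ i : ℝ) ∂ness a b N) *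
        (φ (((i : ℝ) + 1) / (N + 1)) - φ ((i : ℝ) / (N + 1))) := fun η => by
    rw [fluctuationField_occupation, densityField, ← mul_sub, ← Finset.sum_sub_distrib]
    congr 1
    exact Finset.sum_congr rfl fun i _ => by ring
  have habs : ∀ i : Fin N, Integrable (fun η : Fin N → ℕ =>
      |(η i : ℝ) - ∫ ξ, (ξ i : ℝ) ∂ness a b N|) (ness a b N) := fun i =>
    ((integrable_coord_ness ha hab i).sub (integrable_const _)).abs
  have hdom : Integrable (fun η : Fin N → ℕ => (√(N : ℝ))⁻¹ * ∑ i : Fin N,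
      |(η i : ℝ) - ∫ ξ, (ξ i : ℝ) ∂ness a b N| * (L * (N : ℝ)⁻¹)) (ness a b N) :=
    (integrable_finsetSum _ fun i _ => (habs i).mul_const _).const_mul _
  have hle : ∀ η, |densityField φ N (ness a b N) η - fluctuationField occupation φ N (ness a b N) η| ≤
      (√(N : ℝ))⁻¹ * ∑ i : Fin N, |(η i : ℝ) - ∫ ξ, (ξ i : ℝ) ∂ness a b N| * (L * (N : ℝ)⁻¹) :=
    fun η => by
      rw [hdiff, abs_mul, abs_of_nonneg (by positivity : 0 ≤ (√(N : ℝ))⁻¹)]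
      refine mul_le_mul_of_nonneg_left ((Finset.abs_sum_le_sum_abs _ _).trans
        (Finset.sum_le_sum fun i _ => ?_)) (by positivity)
      rw [abs_mul]
      exact mul_le_mul_of_nonneg_left (hincr i) (abs_nonneg _)
  refine ⟨hdom.mono' (measurable_of_countable _).aestronglyMeasurable (ae_of_all _ fun η => ?_),
    (integral_mono_of_nonneg (ae_of_all _ fun _ => abs_nonneg _) hdom (ae_of_all _ hle)).trans ?_⟩
  · rw [Real.norm_eq_abs, abs_abs]
    exact hle η
  rw [integral_const_mul, integral_finsetSum _ fun i _ => (habs i).mul_const _]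
  simp only [integral_mul_const]
  calc _ ≤ (√(N : ℝ))⁻¹ * ∑ _i : Fin N, 2 * b * (L * (N : ℝ)⁻¹) := by
        gcongr with i
        exact integral_abs_coord_sub_le ha hab i
    _ = 2 * b * L * (√(N : ℝ))⁻¹ := by
        rw [Finset.sum_const, Finset.card_univ, Fintype.card_fin, nsmul_eq_mul]
        field_simp

lemma tendsto_integral_cexp_densityField (ha : 0 ≤ a) (hab : a < b)
    (hφ : ContDiffOn ℝ 1 φ (Icc 0 1)) (t : ℝ) :
    Tendsto (fun N : ℕ => ∫ η, Complex.exp ((t * densityField φ N (ness a b N) η : ℝ) *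
        Complex.I) ∂ness a b N) atTop
      (𝓝 (Real.exp (-((sigmaTSq a b occupation φ + sigmaESq a b occupation φ) * t ^ 2 / 2)) : ℂ)) := by
  have h := tendsto_integral_cexp_field ha hab (memLp_occupation (ha.trans hab.le)) hφ t
  obtain ⟨C, hC⟩ := exists_integral_abs_densityField_sub_le ha hab hφ
  refine (tendsto_iff_of_dist ?_).1 h
  refine squeeze_zero' (Eventually.of_forall fun _ => dist_nonneg)
    ((eventually_gt_atTop 0).mono fun N hN => ?_)
    (g := fun N : ℕ => |t| * C * (√(N : ℝ))⁻¹) ?_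
  · have := isProbabilityMeasure_ness hab N
    obtain ⟨hi, hN'⟩ := hC N hN
    rw [dist_comm, dist_eq_norm, ← integral_sub
      (integrable_cexp (measurable_of_countable _).aemeasurable t)
      (integrable_cexp (measurable_of_countable _).aemeasurable t)]
    refine (norm_integral_le_of_norm_le (hi.const_mul |t|) (ae_of_all _ fun η => ?_)).trans ?_
    · refine (norm_cexp_sub_cexp_le _ _).trans (le_of_eq ?_)
      rw [← mul_sub, abs_mul]
    · rw [integral_const_mul, mul_assoc]
      exact mul_le_mul_of_nonneg_left hN' (abs_nonneg t)
  · have : Tendsto (fun N : ℕ => |t| * C * (√(N : ℝ))⁻¹) atTop (𝓝 (|t| * C * 0)) :=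
      ((tendsto_inv_atTop_zero.comp (Real.tendsto_sqrt_atTop.comp
        tendsto_natCast_atTop_atTop))).const_mul _
    rwa [mul_zero] at this

end Density

/-! ### Riemann sums -/

lemma div_mem_Icc {n j : ℕ} (hj : j ≤ n) : (j : ℝ) / n ∈ Icc (0 : ℝ) 1 :=
  ⟨by positivity, div_le_one_of_le₀ (by exact_mod_cast hj) (by positivity)⟩

lemma abs_riemannSum_sub_integral_le {f : ℝ → ℝ} (hf : ContinuousOn f (Icc 0 1)) {n : ℕ} (hn : 0 < n)
    {ε : ℝ} (h : ∀ x ∈ Icc (0 : ℝ) 1, ∀ y ∈ Icc (0 : ℝ) 1, |x - y| ≤ (n : ℝ)⁻¹ → |f x - f y| ≤ ε) :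
    |(n : ℝ)⁻¹ * ∑ j ∈ Finset.range n, f (j / n) - ∫ x in (0 : ℝ)..1, f x| ≤ ε := by
  have hnpos : (0 : ℝ) < n := by exact_mod_cast hn
  have hsub : ∀ j < n, uIcc ((j : ℝ) / n) ((j + 1 : ℕ) / n) ⊆ Icc 0 1 := fun j hj => by
    rw [uIcc_of_le (by gcongr; omega)]
    exact Icc_subset_Icc (div_mem_Icc hj.le).1 (div_mem_Icc hj).2
  have hint : ∀ j < n, IntervalIntegrable f volume ((j : ℝ) / n) ((j + 1 : ℕ) / n) := fun j hj =>
    (hf.mono (hsub j hj)).intervalIntegrable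
  have hsum := intervalIntegral.sum_integral_adjacent_intervals hint
  rw [Nat.cast_zero, zero_div, div_self hnpos.ne'] at hsum
  rw [← hsum, Finset.mul_sum, ← Finset.sum_sub_distrib]
  have hlen : ∀ j : ℕ, ((j + 1 : ℕ) : ℝ) / n - j / n = (n : ℝ)⁻¹ := fun j => by
    push_cast; field_simp; ring
  have hcell : ∀ j ∈ Finset.range n,
      |(n : ℝ)⁻¹ * f (j / n) - ∫ x in (j : ℝ) / n..((j + 1 : ℕ) : ℝ) / n, f x| ≤ ε * (n : ℝ)⁻¹ := by
    intro j hj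
    have hj' := Finset.mem_range.1 hj
    have e : (n : ℝ)⁻¹ * f (j / n) = ∫ _ in (j : ℝ) / n..((j + 1 : ℕ) : ℝ) / n, f (j / n) := by
      rw [intervalIntegral.integral_const, hlen, smul_eq_mul]
    rw [e, ← intervalIntegral.integral_sub intervalIntegrable_const (hint j hj'),
      ← Real.norm_eq_abs]
    refine (intervalIntegral.norm_integral_le_of_norm_le_const (C := ε) fun x hx => ?_).trans (le_of_eq ?_)
    · have hx' := uIoc_subset_uIcc hx
      refine h _ (div_mem_Icc hj'.le) _ (hsub j hj' hx') ?_
      rw [uIcc_of_le (by gcongr; omega)] at hx'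
      rw [abs_sub_comm, abs_of_nonneg (by linarith [hx'.1])]
      linarith [hx'.2, hlen j]
    · rw [hlen, abs_of_pos (inv_pos.2 hnpos)]
  refine (Finset.abs_sum_le_sum_abs _ _).trans ((Finset.sum_le_sum hcell).trans (le_of_eq ?_))
  rw [Finset.sum_const, Finset.card_range, nsmul_eq_mul]
  field_simp

lemma tendsto_riemannSum {f : ℝ → ℝ} (hf : ContinuousOn f (Icc 0 1)) :
    Tendsto (fun n : ℕ => (n : ℝ)⁻¹ * ∑ j ∈ Finset.range n, f (j / n)) atTop
      (𝓝 (∫ x in (0 : ℝ)..1, f x)) := by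
  have huc := Metric.uniformContinuousOn_iff_le.1 (isCompact_Icc.uniformContinuousOn_of_continuous hf)
  refine Metric.tendsto_atTop'.2 fun ε hε => ?_
  obtain ⟨δ, hδ, h⟩ := huc (ε / 2) (half_pos hε)
  obtain ⟨m, hm⟩ := exists_nat_gt δ⁻¹
  refine ⟨m, fun n hn => ?_⟩
  have hn0 : 0 < n := by omega
  have hnδ : (n : ℝ)⁻¹ ≤ δ := by
    rw [inv_le_comm₀ (by exact_mod_cast hn0) hδ]
    exact hm.le.trans (by exact_mod_cast hn.le)
  exact (abs_riemannSum_sub_integral_le hf hn0 fun x hx y hy hxy => h x hx y hy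
    (hxy.trans hnδ)).trans_lt (half_lt_self hε)

lemma tendsto_double_riemannSum {K : ℝ → ℝ → ℝ} (hK : Continuous (Function.uncurry K)) :
    Tendsto (fun n : ℕ => (n : ℝ)⁻¹ * ∑ i ∈ Finset.range n, (n : ℝ)⁻¹ *
      ∑ j ∈ Finset.range n, K (i / n) (j / n)) atTop
      (𝓝 (∫ s in (0 : ℝ)..1, ∫ t in (0 : ℝ)..1, K s t)) := by
  have hI : Continuous fun s => ∫ t in (0 : ℝ)..1, K s t :=
    intervalIntegral.continuous_parametric_intervalIntegral_of_continuous' hK 0 1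
  have h1 := tendsto_riemannSum hI.continuousOn
  have huc := Metric.uniformContinuousOn_iff_le.1
    ((isCompact_Icc.prod isCompact_Icc).uniformContinuousOn_of_continuous
      (hK.continuousOn (s := Icc (0 : ℝ) 1 ×ˢ Icc (0 : ℝ) 1)))
  refine (tendsto_iff_of_dist ?_).1 h1
  refine Metric.tendsto_atTop'.2 fun ε hε => ?_
  obtain ⟨δ, hδ, h⟩ := huc (ε / 2) (half_pos hε)
  obtain ⟨m, hm⟩ := exists_nat_gt δ⁻¹
  refine ⟨m, fun n hn => ?_⟩
  have hn0 : 0 < n := by omega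
  have hnpos : (0 : ℝ) < n := by exact_mod_cast hn0
  have hnδ : (n : ℝ)⁻¹ ≤ δ := by
    rw [inv_le_comm₀ hnpos hδ]
    exact hm.le.trans (by exact_mod_cast hn.le)
  have hin : ∀ i ∈ Finset.range n, |(∫ t in (0 : ℝ)..1, K (i / n) t) -
      (n : ℝ)⁻¹ * ∑ j ∈ Finset.range n, K (i / n) (j / n)| ≤ ε / 2 := fun i hi => by
    have hi' := div_mem_Icc (Finset.mem_range.1 hi).le
    rw [abs_sub_comm]
    refine abs_riemannSum_sub_integral_le (f := fun t => K (i / n) t)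
      (hK.comp (by fun_prop : Continuous fun t : ℝ => ((i : ℝ) / n, t))).continuousOn hn0
      fun x hx y hy hxy => h (i / n, x) ⟨hi', hx⟩ (i / n, y) ⟨hi', hy⟩ ?_
    rw [Prod.dist_eq, dist_self, Real.dist_eq]
    exact max_le hδ.le (hxy.trans hnδ)
  rw [Real.dist_0_eq_abs, abs_of_nonneg dist_nonneg, Real.dist_eq, ← mul_sub,
    ← Finset.sum_sub_distrib, abs_mul, abs_of_pos (inv_pos.2 hnpos)]
  calc _ ≤ (n : ℝ)⁻¹ * ∑ i ∈ Finset.range n, ε / 2 :=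
        mul_le_mul_of_nonneg_left ((Finset.abs_sum_le_sum_abs _ _).trans (Finset.sum_le_sum hin))
          (inv_nonneg.2 hnpos.le)
    _ = ε / 2 := by
        rw [Finset.sum_const, Finset.card_range, nsmul_eq_mul]
        field_simp
    _ < ε := half_lt_self hε

/-! ### The law of the limiting density field -/

section Bridge

variable {Ω : Type*} {mΩ : MeasurableSpace Ω} {P : Measure Ω} {B : unitInterval → Ω → ℝ}

/-- Riemann sums for the integral of `ψ` against the paths of `B`. -/
noncomputable def bridgeSum (ψ : ℝ → ℝ) (B : unitInterval → Ω → ℝ) (n : ℕ) (ω : Ω) : ℝ :=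
  ∑ j ∈ Finset.range n, ((n : ℝ)⁻¹ * ψ (j / n)) * B (projIcc 0 1 zero_le_one ((j : ℝ) / n)) ω

lemma tendsto_bridgeSum {ψ : ℝ → ℝ} (hψ : Continuous ψ) (hB : IsBrownianBridge B P) :
    ∀ᵐ ω ∂P, Tendsto (fun n => bridgeSum ψ B n ω) atTop
      (𝓝 (∫ s : unitInterval, ψ s * B s ω)) := by
  filter_upwards [hB.continuous_paths] with ω hω
  set f : ℝ → ℝ := fun s => ψ s * B (projIcc 0 1 zero_le_one s) ω with hf
  have hfc : Continuous f := hψ.mul (hω.comp continuous_projIcc)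
  have h := tendsto_riemannSum hfc.continuousOn
  have e : ∫ s : unitInterval, ψ s * B s ω = ∫ x in (0 : ℝ)..1, f x := by
    rw [intervalIntegral.integral_of_le zero_le_one, ← integral_Icc_eq_integral_Ioc,
      ← unitInterval.measurePreserving_coe.integral_comp unitInterval.measurableEmbedding_coe]
    refine integral_congr_ae (ae_of_all _ fun s => ?_)
    simp only [hf]
    rw [projIcc_val]
  rw [e]
  refine h.congr fun n => ?_
  rw [bridgeSum, Finset.mul_sum]
  refine Finset.sum_congr rfl fun j _ => ?_
  simp only [hf]
  ring

lemma hasGaussianLaw_bridgeSum (ψ : ℝ → ℝ) (hB : IsBrownianBridge B P) (n : ℕ) :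
    HasGaussianLaw (bridgeSum ψ B n) P :=
  ((hB.gaussian.comp_right fun j : ℕ => projIcc 0 1 zero_le_one ((j : ℝ) / n)).smul
    fun j : ℕ => (n : ℝ)⁻¹ * ψ (j / n)).hasGaussianLaw_fun_sum (I := Finset.range n)

lemma integral_bridgeSum (ψ : ℝ → ℝ) (hB : IsBrownianBridge B P) (n : ℕ) :
    ∫ ω, bridgeSum ψ B n ω ∂P = 0 := by
  have hi : ∀ j : ℕ, Integrable (fun ω => ((n : ℝ)⁻¹ * ψ (j / n)) *
      B (projIcc 0 1 zero_le_one ((j : ℝ) / n)) ω) P := fun j =>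
    ((hB.gaussian.hasGaussianLaw_eval _).integrable).const_mul _
  simp only [bridgeSum]
  rw [integral_finsetSum _ fun j _ => hi j]
  refine Finset.sum_eq_zero fun j _ => ?_
  rw [integral_const_mul, hB.mean_zero, mul_zero]

lemma variance_bridgeSum (ψ : ℝ → ℝ) (hB : IsBrownianBridge B P) (n : ℕ) :
    Var[bridgeSum ψ B n; P] = (n : ℝ)⁻¹ * ∑ i ∈ Finset.range n, (n : ℝ)⁻¹ *
      ∑ j ∈ Finset.range n, (min ((i : ℝ) / n) (j / n) - i / n * (j / n)) * ψ (i / n) * ψ (j / n) := by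
  have := hB.gaussian.isProbabilityMeasure
  have hm : ∀ s, MemLp (B s) 2 P := fun s => (hB.gaussian.hasGaussianLaw_eval s).memLp_two
  have hmj : ∀ j : ℕ, MemLp (fun ω => ((n : ℝ)⁻¹ * ψ (j / n)) *
      B (projIcc 0 1 zero_le_one ((j : ℝ) / n)) ω) 2 P := fun j => (hm _).const_mul _
  have hv := variance_fun_sum' (μ := P) (s := Finset.range n)
    (X := fun (j : ℕ) ω => ((n : ℝ)⁻¹ * ψ (j / n)) * B (projIcc 0 1 zero_le_one ((j : ℝ) / n)) ω)
    fun j _ => hmj j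
  refine hv.trans ?_
  rw [Finset.mul_sum]
  refine Finset.sum_congr rfl fun i hi => ?_
  rw [Finset.mul_sum, Finset.mul_sum]
  refine Finset.sum_congr rfl fun j hj => ?_
  have hi' := div_mem_Icc (Finset.mem_range.1 hi).le
  have hj' := div_mem_Icc (Finset.mem_range.1 hj).le
  rw [covariance_const_mul_left, covariance_const_mul_right, hB.covariance_eq,
    projIcc_of_mem zero_le_one hi', projIcc_of_mem zero_le_one hj']
  ring

lemma integral_cexp_of_hasGaussianLaw {X : Ω → ℝ} (hX : HasGaussianLaw X P) (h0 : ∫ ω, X ω ∂P = 0)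
    (t : ℝ) : ∫ ω, Complex.exp ((t * X ω : ℝ) * Complex.I) ∂P =
      (Real.exp (-(Var[X; P] * t ^ 2 / 2)) : ℂ) := by
  rw [← charFun_map_real hX.aemeasurable, hX.map_eq_gaussianReal, h0, charFun_apply_real,
    ← integral_cexp_gaussianReal (variance_nonneg X P) t]
  simp

/-- The limiting density field is a centred Gaussian variable. The integral against the bridge is a
limit of Riemann sums, which are Gaussian and independent of the white noise. -/
lemma integral_cexp_bridge_add_noise [IsProbabilityMeasure P] {ψ : ℝ → ℝ} (hψ : Continuous ψ)
    (hB : IsBrownianBridge B P) {Y : Ω → ℝ} (hY : HasGaussianLaw Y P) (hY0 : ∫ ω, Y ω ∂P = 0)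
    (hind : IndepFun (fun ω s => B s ω) Y P) (c t : ℝ) :
    AEMeasurable (fun ω => c * (∫ s : unitInterval, ψ s * B s ω) + Y ω) P ∧
    ∫ ω, Complex.exp ((t * (c * (∫ s : unitInterval, ψ s * B s ω) + Y ω) : ℝ) * Complex.I) ∂P =
      (Real.exp (-((c ^ 2 * (∫ s in (0 : ℝ)..1, ∫ r in (0 : ℝ)..1,
        (min s r - s * r) * ψ s * ψ r) + Var[Y; P]) * t ^ 2 / 2)) : ℂ) := by
  have hlim := tendsto_bridgeSum hψ hB
  have hR := hasGaussianLaw_bridgeSum ψ hB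
  have hRm : ∀ n, AEMeasurable (bridgeSum ψ B n) P := fun n => (hR n).aemeasurable
  have hIm : AEMeasurable (fun ω => ∫ s : unitInterval, ψ s * B s ω) P :=
    aemeasurable_of_tendsto_metrizable_ae atTop hRm hlim
  refine ⟨(hIm.const_mul c).add hY.aemeasurable, ?_⟩
  have h1 : Tendsto (fun n => ∫ ω, Complex.exp ((t * (c * bridgeSum ψ B n ω + Y ω) : ℝ) * Complex.I) ∂P)
      atTop (𝓝 (∫ ω, Complex.exp ((t * (c * (∫ s : unitInterval, ψ s * B s ω) + Y ω) : ℝ) *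
        Complex.I) ∂P)) := by
    refine tendsto_integral_of_dominated_convergence (fun _ => 1) (fun n => ?_) (integrable_const _)
      (fun n => ae_of_all _ fun ω => (Complex.norm_exp_ofReal_mul_I _).le) ?_
    · exact (integrable_cexp (((hRm n).const_mul c).add hY.aemeasurable) t).1
    · filter_upwards [hlim] with ω hω
      have hc : Continuous fun x : ℝ => Complex.exp ((t * (c * x + Y ω) : ℝ) * Complex.I) := by
        fun_prop
      exact (hc.tendsto _).comp hω
  have h2 : ∀ n, ∫ ω, Complex.exp ((t * (c * bridgeSum ψ B n ω + Y ω) : ℝ) * Complex.I) ∂P =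
      (Real.exp (-((c ^ 2 * Var[bridgeSum ψ B n; P] + Var[Y; P]) * t ^ 2 / 2)) : ℂ) := fun n => by
    have hi : IndepFun (fun ω => c * bridgeSum ψ B n ω) Y P := by
      refine hind.comp (φ := fun x : unitInterval → ℝ => c * ∑ j ∈ Finset.range n,
        ((n : ℝ)⁻¹ * ψ (j / n)) * x (projIcc 0 1 zero_le_one ((j : ℝ) / n))) (ψ := id) ?_ measurable_id
      fun_prop
    have h := congrFun (hi.charFun_map_fun_add_eq_mul ((hRm n).const_mul c) hY.aemeasurable) t
    have hm : AEMeasurable (fun ω => c * bridgeSum ψ B n ω + Y ω) P :=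
      ((hRm n).const_mul c).add hY.aemeasurable
    rw [Pi.mul_apply, charFun_map_real hm,
      charFun_map_real ((hRm n).const_mul c), charFun_map_real hY.aemeasurable,
      integral_cexp_of_hasGaussianLaw hY hY0] at h
    rw [h]
    have e : ∀ ω, t * (c * bridgeSum ψ B n ω) = (t * c) * bridgeSum ψ B n ω := fun ω => by ring
    simp_rw [e]
    rw [integral_cexp_of_hasGaussianLaw (hR n) (integral_bridgeSum ψ hB n), ← Complex.ofReal_mul,
      ← Real.exp_add]
    congr 2
    ring
  have h3 : Tendsto (fun n => Var[bridgeSum ψ B n; P]) atTop (𝓝 (∫ s in (0 : ℝ)..1,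
      ∫ r in (0 : ℝ)..1, (min s r - s * r) * ψ s * ψ r)) := by
    simp_rw [variance_bridgeSum ψ hB]
    exact tendsto_double_riemannSum (K := fun s r => (min s r - s * r) * ψ s * ψ r)
      (by simp only [Function.uncurry_def]; fun_prop)
  have h4 : Continuous fun v : ℝ => (Real.exp (-((c ^ 2 * v + Var[Y; P]) * t ^ 2 / 2)) : ℂ) := by
    fun_prop
  refine tendsto_nhds_unique h1 ?_
  simp_rw [h2]
  exact (h4.tendsto _).comp h3

end Bridge

section DensityLimit

variable {a b : ℝ} {φ : ℝ → ℝ} {Ω' : Type*} {mΩ' : MeasurableSpace Ω'} {P' : Measure Ω'}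
  [IsProbabilityMeasure P'] {B : unitInterval → Ω' → ℝ} {W : TestFunction → Ω' → ℝ}

lemma integral_cexp_densityLimit (ha : 0 ≤ a) (hab : a < b)
    (hφ : ContDiffOn ℝ (⊤ : ℕ∞) φ (Icc 0 1)) (hB : IsBrownianBridge B P')
    (hW : IsWhiteNoise (fun x => Var[fun n : ℕ => (n : ℝ); geom (profile a b x)]) W P')
    (hind : IndepFun (fun ω s => B s ω) (fun ω ψ => W ψ ω) P') (t : ℝ) :
    AEMeasurable (fun ω => (b - a) * (∫ s : unitInterval, φ s * B s ω) + W ⟨φ, hφ⟩ ω) P' ∧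
    ∫ ω, Complex.exp ((t * ((b - a) * (∫ s : unitInterval, φ s * B s ω) + W ⟨φ, hφ⟩ ω) : ℝ) *
        Complex.I) ∂P' =
      (Real.exp (-((sigmaTSq a b occupation φ + sigmaESq a b occupation φ) * t ^ 2 / 2)) : ℂ) := by
  obtain ⟨ψ, hψ, hφψ⟩ := exists_contDiff_eqOn zero_lt_one (hφ.of_le (by exact_mod_cast le_top))
  have hY := hW.gaussian.hasGaussianLaw_eval ⟨φ, hφ⟩
  have hv : Var[W ⟨φ, hφ⟩; P'] = sigmaESq a b occupation φ := by
    rw [← covariance_self hY.aemeasurable, hW.covariance_eq, sigmaESq_occupation]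
    refine intervalIntegral.integral_congr fun x _ => ?_
    ring
  have hind' : IndepFun (fun ω s => B s ω) (W ⟨φ, hφ⟩) P' :=
    hind.comp (φ := id) (ψ := fun w : TestFunction → ℝ => w ⟨φ, hφ⟩) measurable_id
      (measurable_pi_apply _)
  have h := integral_cexp_bridge_add_noise hψ.continuous hB hY (hW.mean_zero _) hind' (b - a) t
  have e : ∀ s : unitInterval, φ s = ψ s := fun s => hφψ s.2
  simp_rw [e]
  rw [hv] at h
  rw [sigmaTSq_congr hφψ, sigmaTSq_occupation ha hab]
  exact h

end DensityLimit

end HarmonicNESS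

theorem mainTheorem1 {θL θR : ℝ} (hL : 0 ≤ θL) (hLR : θL < θR)
    (φ : ℝ → ℝ) (hφ : ContDiffOn ℝ (⊤ : ℕ∞) φ (Icc 0 1))
    {Ω : ℕ → Type*} {mΩ : ∀ N, MeasurableSpace (Ω N)}
    (P : (N : ℕ) → Measure (Ω N)) [∀ N, IsProbabilityMeasure (P N)]
    (η : (N : ℕ) → Ω N → (Fin N → ℕ))
    (hη : ∀ N, HasLaw (η N) (HarmonicNESS.ness θL θR N) (P N)) :
    -- the central limit theorem for a general local function
    (∀ (k : ℕ) (g : (Fin k → ℕ) → ℝ), HarmonicNESS.FiniteFourthMoments θL θR g →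
      ContDiffOn ℝ 1 (HarmonicNESS.localMean g) (Icc θL θR) ∧
      ContinuousOn (HarmonicNESS.localVariance g) (Icc θL θR) ∧
      0 ≤ HarmonicNESS.sigmaTSq θL θR g φ ∧
      0 ≤ HarmonicNESS.sigmaESq θL θR g φ ∧
      TendstoInDistribution
        (fun N ω =>
          HarmonicNESS.fluctuationField g φ N (HarmonicNESS.ness θL θR N) (η N ω))
        atTop (id : ℝ → ℝ) P
        (gaussianReal 0
          (HarmonicNESS.sigmaTSq θL θR g φ + HarmonicNESS.sigmaESq θL θR g φ).toNNReal)) ∧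
    -- the density fluctuation field
    (∀ {Ω' : Type*} {mΩ' : MeasurableSpace Ω'} (P' : Measure Ω') [IsProbabilityMeasure P']
      (B : unitInterval → Ω' → ℝ) (W : HarmonicNESS.TestFunction → Ω' → ℝ),
      HarmonicNESS.IsBrownianBridge B P' →
      HarmonicNESS.IsWhiteNoise
        (fun x => Var[fun n : ℕ => (n : ℝ);
          HarmonicNESS.geom (HarmonicNESS.profile θL θR x)]) W P' →
      IndepFun (fun ω s => B s ω) (fun ω ψ => W ψ ω) P' →
      TendstoInDistribution
        (fun N ω =>
          HarmonicNESS.fluctuationField (fun x : Fin 1 → ℕ => (x 0 : ℝ)) φ N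
            (HarmonicNESS.ness θL θR N) (η N ω))
        atTop (fun ω => (θR - θL) * (∫ s : unitInterval, φ s * B s ω) + W ⟨φ, hφ⟩ ω) P P' ∧
      TendstoInDistribution
        (fun N ω => HarmonicNESS.densityField φ N (HarmonicNESS.ness θL θR N) (η N ω))
        atTop (fun ω => (θR - θL) * (∫ s : unitInterval, φ s * B s ω) + W ⟨φ, hφ⟩ ω) P P') := by
  have hφ1 : ContDiffOn ℝ 1 φ (Icc 0 1) := hφ.of_le (by exact_mod_cast le_top)
  have hX : ∀ (F : (N : ℕ) → (Fin N → ℕ) → ℝ) (N : ℕ), AEMeasurable (fun ω => F N (η N ω)) (P N) :=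
    fun F N => (measurable_of_countable (F N)).comp_aemeasurable (hη N).aemeasurable
  refine ⟨fun k g hg => ?_, fun {Ω'} {mΩ'} P' _ B W hB hW hind => ?_⟩
  · have hg4 := hg.memLp hLR
    obtain ⟨h1, h2⟩ := HarmonicNESS.sigma_nonneg hL hLR hg4 hφ1
    exact ⟨HarmonicNESS.contDiffOn_localMean hL hLR hg4,
      HarmonicNESS.continuousOn_localVariance hL hLR hg4, h1, h2,
      HarmonicNESS.tendstoInDistribution_fluctuationField hη hL hLR hg4 hφ1⟩
  · have hZ := HarmonicNESS.integral_cexp_densityLimit hL hLR hφ hB hW hind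
    constructor
    · refine HarmonicNESS.tendstoInDistribution_of_tendsto_integral_cexp
        (hX fun N => HarmonicNESS.fluctuationField (fun x : Fin 1 → ℕ => (x 0 : ℝ)) φ N
          (HarmonicNESS.ness θL θR N)) (hZ 0).1 fun t => ?_
      rw [(hZ t).2]
      simp_rw [fun N => HarmonicNESS.integral_cexp_of_hasLaw_ness (hη N)
        (HarmonicNESS.fluctuationField (fun x : Fin 1 → ℕ => (x 0 : ℝ)) φ N
          (HarmonicNESS.ness θL θR N)) t]
      exact HarmonicNESS.tendsto_integral_cexp_field hL hLR
        (HarmonicNESS.memLp_occupation (hL.trans hLR.le)) hφ1 t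
    · refine HarmonicNESS.tendstoInDistribution_of_tendsto_integral_cexp
        (hX fun N => HarmonicNESS.densityField φ N (HarmonicNESS.ness θL θR N)) (hZ 0).1 fun t => ?_
      rw [(hZ t).2]
      simp_rw [fun N => HarmonicNESS.integral_cexp_of_hasLaw_ness (hη N)
        (HarmonicNESS.densityField φ N (HarmonicNESS.ness θL θR N)) t]
      exact HarmonicNESS.tendsto_integral_cexp_densityField hL hLR hφ1 t
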